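/- **Setting.** An episodic leader–follower Markov game has states $S$, leader actions $A$, follower actions $B$ (measurable spaces), horizon $H\ge 1$, initial law $\rho_0$, Markov kernels $P_h(\cdot\mid s,a,b)$, leader rewards $u_h$ and follower rewards $r_h$ (measurable, with values in $[0,1]$), $h=1,\dots,H$. Entropies and densities on $B$ are taken with respect to a finite reference measure of total mass $|B|\ge 1$ (counting measure for finite $B$, Lebesgue measure for $B=[0,1]$); sums over $b$ below are integrals against it. Let $\eta>0$. A leader policy is a sequence of Markov kernels $\pi_h(\cdot\mid s,b)$ on $A$. For a reward $r^\theta_h$ write $r^{\pi,\theta}_h(s,b)=\langle \pi_h(\cdot\mid s,b), r^\theta_h(s,\cdot,b)\rangle$, $V^{\pi,\theta}_h(s)=\eta^{-1}\log\sum_b e^{\eta r^{\pi,\theta}_h(s,b)}$, $A^{\pi,\theta}_h(s,b)=r^{\pi,\theta}_h(s,b)-V^{\pi,\theta}_h(s)$, and let $\nu^{\pi,\theta}_h(b\mid s)=e^{\eta A^{\pi,\theta}_h(s,b)}$ be the quantal response of a myopic follower; $A_h^{\pi}$, $\nu^\pi_h$ are those for the true reward $r_h$. In each episode the leader announces $\pi$;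 then $s_1\sim\rho_0$, $b_h\sim\nu^\pi_h(\cdot\mid s_h)$, $a_h\sim\pi_h(\cdot\mid s_h,b_h)$, $s_{h+1}\sim P_h(\cdot\mid s_h,a_h,b_h)$. Put $J(\pi)=\mathbb E^\pi\sum_{h=1}^H u_h(s_h,a_h,b_h)$. **Classes.** $\Pi=\prod_h\Pi_h$ is a class of leader policies; $\Theta=\prod_h\Theta_h$ parametrizes measurable rewards $r^\theta_h$ with values in $[0,1]$; $\mathcal U$ is a class of sequences $U=(U_h)_h$ of measurable functions on $S\times A\times B$ with $|U_h|\le H$, $U_{H+1}=0$. Define $$(T^{\pi,\theta}_hf)(s)=\langle f(s,\cdot,\cdot),\ \pi_h\otimes\nu^{\pi,\theta}_h(\cdot,\cdot\mid s)\rangle,\quad (T^{*,\theta}_hf)(s)=\max_{\pi_h\in\Pi_h}(T^{\pi,\theta}_hf)(s),\quad (\mathbb T^{*,\theta}_hf)(z)=u_h(z)+\mathbb E_{s'\sim P_h(\cdot\mid z)}(T^{*,\theta}_{h+1}f)(s').$$ Assume that for $f=U_h$, $U\in\mathcal U$, $\theta\in\Theta$, $h\le H$, the maximum is attained by one $\pi_h\in\Pi_h$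 at all states; *realizability*: some $\theta^*\in\Theta$ has $r^{\theta^*}_h=r_h$ for all $h$, and for every $\theta\in\Theta$ some $U\in\mathcal U$ has $U_h=\mathbb T^{*,\theta}_hU_{h+1}$ for all $h$; *completeness*: for all $U\in\mathcal U$, $\theta\in\Theta$, $h$ there is $U'\in\mathcal U$ with $U'_h=\mathbb T^{*,\theta}_hU_{h+1}$. **Algorithm (MLE-GOLF with parameter $\beta$).** For episode $t=1,\dots,T$, from the data $z^i_h=(s^i_h,a^i_h,b^i_h)$, $u_h^i=u_h(z_h^i)$, $i<t$, and the announced policies $\hat\pi^i$, form $$\mathcal L^t_h(\theta)=-\sum_{i<t}\eta A^{\hat\pi^i,\theta}_h(s^i_h,b^i_h),\qquad \ell^t_h(f,g,\theta)=\sum_{i<t}\bigl(f(z^i_h)-u^i_h-(T^{*,\theta}_{h+1}g)(s^i_{h+1})\bigr)^2$$ (the $T^{*,\theta}_{h+1}$ term is absent for $h=H$), and the confidence set $\mathcal C^t$ of all $(U,\theta)\in\mathcal U\times\Theta$ with, for all $h$, $$\mathcal L^t_h(\theta_h)\le\inf_{\theta'\in\Theta_h}\mathcal L^t_h(\theta')+\beta,\qquad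 \ell^t_h(U_h,U_{h+1},\theta)\le\inf_{U'\in\mathcal U}\ell^t_h(U'_h,U_{h+1},\theta)+H^2\beta .$$ Choose $(\hat U^t,\hat\theta^t)\in\arg\max_{(U,\theta)\in\mathcal C^t}\ \max_{\pi_1\in\Pi_1}\mathbb E_{s_1\sim\rho_0}(T^{\pi,\theta}_1U_1)(s_1)$ and announce $\hat\pi^t\in\Pi$ with $T^{\hat\pi^t,\hat\theta^t}_h\hat U^t_h=T^{*,\hat\theta^t}_h\hat U^t_h$ at every state, for all $h$. (If $\mathcal C^t=\emptyset$ an arbitrary $\hat\pi^t\in\Pi$ is announced; $\hat\pi^t$ and $r^{\hat\theta^t}$ depend measurably on the data.) The regret is $\mathrm{Reg}(T)=\sum_{t=1}^T\bigl(\sup_{\pi\in\Pi}J(\pi)-J(\hat\pi^t)\bigr)$. **Complexity measures.** With the Hellinger distance $D_H^2(p,q)=\frac12\int(\sqrt p-\sqrt q)^2$, let $N_\Theta$ be the maximum over $h$ of the $T^{-1}$-covering number of $\Theta_h$ for the distance $\max\{(1+\eta)\|r^\theta_h-r^{\tilde\theta}_h\|_\infty,\ \sup_{\pi\in\Pi,s}D_H(\nu^{\pi,\theta}_h(\cdot\mid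 s),\nu^{\pi,\tilde\theta}_h(\cdot\mid s))\}$, and $N_{\mathcal Z}$ the maximum over $h$ of the $T^{-1}$-covering number of the set of triples $(U,U',\theta)\in\mathcal U\times\mathcal U\times\Theta$ for the distance $\max\{\|U_h-\tilde U_h\|_\infty,\|T^{*,\theta}_{h+1}U'_{h+1}-T^{*,\tilde\theta}_{h+1}\tilde U'_{h+1}\|_\infty\}$ (centres are taken in the set covered). For a class $\mathcal G$ of functions and a class $\mathcal P$ of signed measures, $\dim(\mathcal G,\mathcal P,\varepsilon)$ is the largest $n$ such that for some $\varepsilon'\ge\varepsilon$ there are $\rho_1,\dots,\rho_n\in\mathcal P$ such that for every $m\le n$ some $g\in\mathcal G$ satisfies $\bigl(\sum_{i<m}(\int g\,d\rho_i)^2\bigr)^{1/2}\le\varepsilon'<|\int g\,d\rho_m|$. Let - $\mathcal G_{h,L}=\{U_h-\mathbb T^{*,\theta}_hU_{h+1}: U\in\mathcal U,\theta\in\Theta\}$ and $\mathcal P_{h,L}$ the laws of $(s_h,a_h,b_h)$ under $\pi\in\Pi$ and the quantal response $\nu^\pi$; - $\mathcal G_{h,F}=\{r^\theta_h-r_h:\theta\in\Theta_h\}$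 and $\mathcal P_{h,F}$ the signed measures $\pi_h(\cdot\mid s,b)\otimes\delta_{(s,b)}-(\pi_h\otimes\nu^\pi_h)(\cdot,\cdot\mid s)\otimes\delta_s$, for $\pi_h\in\Pi_h$, $s\in S$, $b\in B$. Put $d_L=\max\{1,\max_h\dim(\mathcal G_{h,L},\mathcal P_{h,L},T^{-1/2})\}$, $d_F=\max\{1,\max_h\dim(\mathcal G_{h,F},\mathcal P_{h,F},T^{-1/2})\}$, $B_A=2(\eta^{-1}\log|B|+1)$, $C_\eta=\eta^{-1}+B_A$. **Theorem.** There are absolute constants $C,c>0$ such that for every such game and classes with $N_\Theta,N_{\mathcal Z},d_L,d_F<\infty$, all $T\ge1$, $\delta\in(0,1)$ and all $$\beta\ \ge\ C\log\bigl(e\,HT\max\{N_\Theta,N_{\mathcal Z}\}/\delta\bigr),$$ every run of MLE-GOLF with parameter $\beta$ satisfies, with probability at least $1-\delta$, $$\mathrm{Reg}(T)\le c\Bigl(H^2\sqrt{d_L\,\beta T}+H^2\,\eta C_\eta\sqrt{d_F\,\beta T}+H^2(\eta C_\eta)^3e^{4\eta B_A}\,d_F\,\beta\log T\Bigr).$$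 -/

import Mathlib

open MeasureTheory ProbabilityTheory
open scoped ENNReal

noncomputable section

namespace QSE

/-! Steps are numbered `0, …, H - 1`; objects attached to the step `H` after the last one matter only
through the convention that leader value functions vanish there. A point of `S × A × B` is a triple
(state, leader action, follower action). -/

section Game

variable {S A B : Type*} [MeasurableSpace S] [MeasurableSpace A] [MeasurableSpace B]

/-- An episodic leader-follower Markov game, together with the follower's inverse temperature `η`
and the reference measure `base` on the follower's action space with respect to which entropies and
densities are taken (counting measure for a finite action set, Lebesgue measure for `[0, 1]`);
`|B|` is the total mass of `base`. -/
structure Game (S A B : Type*) [MeasurableSpace S] [MeasurableSpace A] [MeasurableSpace B] where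
  /-- initial state distribution -/
  ρ₀ : Measure S
  /-- transition kernels -/
  P : ℕ → Kernel (S × A × B) S
  /-- leader's rewards -/
  u : ℕ → S × A × B → ℝ
  /-- follower's rewards -/
  r : ℕ → S × A × B → ℝ
  base : Measure B
  η : ℝ
  isProb_ρ₀ : IsProbabilityMeasure ρ₀
  isMarkov_P : ∀ h, IsMarkovKernel (P h)
  measurable_u : ∀ h, Measurable (u h)
  u_mem : ∀ h z, u h z ∈ Set.Icc (0 : ℝ) 1
  measurable_r : ∀ h, Measurable (r h)
  r_mem : ∀ h z, r h z ∈ Set.Icc (0 : ℝ) 1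
  isFinite_base : IsFiniteMeasure base
  one_le_base : 1 ≤ base.real Set.univ
  η_pos : 0 < η

/-- `f^π(s, b) = ⟨π(· | s, b), f(s, ·, b)⟩`. -/
def avg (f : S × A × B → ℝ) (π : Kernel (S × B) A) (s : S) (b : B) : ℝ :=
  ∫ a, f (s, a, b) ∂(π (s, b))

namespace Game

variable (M : Game S A B)

/-- The myopic follower's soft value `V(s) = η⁻¹ log ∑_b exp(η r^π(s, b))` for the reward `r`. -/
def softV (r : S × A × B → ℝ) (π : Kernel (S × B) A) (s : S) : ℝ :=
  M.η⁻¹ * Real.log (∫ b, Real.exp (M.η * avg r π s b) ∂M.base)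

/-- The myopic follower's advantage function for the reward `r`. -/
def adv (r : S × A × B → ℝ) (π : Kernel (S × B) A) (s : S) (b : B) : ℝ :=
  avg r π s b - M.softV r π s

/-- The quantal response `ν^π(db | s) = exp(η A^π(s, b)) base(db)` for the reward `r`. -/
def quantalResponse (r : S × A × B → ℝ) (π : Kernel (S × B) A) (s : S) : Measure B :=
  M.base.withDensity fun b => ENNReal.ofReal (Real.exp (M.η * M.adv r π s b))

/-- The integral operator `(T^{π, r} f)(s) = ⟨f(s, ·, ·), π ⊗ ν^{π, r}(·, · | s)⟩`. -/
def evalOp (r : S × A × B → ℝ) (π : Kernel (S × B) A) (f : S × A × B → ℝ) (s : S) : ℝ :=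
  ∫ b, avg f π s b ∂(M.quantalResponse r π s)

/-- The optimistic operator `(T^{*, r} f)(s) = max_{π ∈ Π_h} (T^{π, r} f)(s)`. -/
def optOp (polh : Set (Kernel (S × B) A)) (r : S × A × B → ℝ) (f : S × A × B → ℝ) (s : S) : ℝ :=
  ⨆ π : polh, M.evalOp r π.1 f s

/-- Law of the state at step `h`, given the steps before it. -/
def stateLaw : {h : ℕ} → (Fin h → S × A × B) → Measure S
  | 0, _ => M.ρ₀
  | h + 1, τ => M.P h (τ (Fin.last h))

/-- Law of the first `h` steps of an episode in which the leader has announced `π` and the myopic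
follower plays the quantal response to it. -/
def trajLaw (π : ℕ → Kernel (S × B) A) : (h : ℕ) → Measure (Fin h → S × A × B)
  | 0 => Measure.dirac fun i => i.elim0
  | h + 1 => (trajLaw π h).bind fun τ => (M.stateLaw τ).bind fun s =>
      (M.quantalResponse (M.r h) (π h) s).bind fun b =>
        (π h (s, b)).map fun a => Fin.snoc (α := fun _ => S × A × B) τ (s, a, b)

/-- Law of `(s_h, a_h, b_h)` under `π` and the quantal response to it. -/
def stepLaw (π : ℕ → Kernel (S × B) A) (h : ℕ) : Measure (S × A × B) :=
  (M.trajLaw π (h + 1)).map fun τ => τ (Fin.last h)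

/-- The leader's expected total reward `J(π)`. -/
def J (H : ℕ) (π : ℕ → Kernel (S × B) A) : ℝ :=
  ∫ τ, ∑ h : Fin H, M.u h (τ h) ∂(M.trajLaw π H)

/-- Hellinger distance between the quantal responses to `π` under the rewards `r` and `r'`,
`D_H² = ½ ∫ (√p - √q)²`. -/
def hellinger (r r' : S × A × B → ℝ) (π : Kernel (S × B) A) (s : S) : ℝ :=
  Real.sqrt (1 / 2 * ∫ b, (Real.sqrt (Real.exp (M.η * M.adv r π s b)) -
    Real.sqrt (Real.exp (M.η * M.adv r' π s b))) ^ 2 ∂M.base)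

/-- `B_A = (1 + eff_H(γ)) (η⁻¹ log |B| + 1)` for the myopic follower, `γ = 0`, `eff_H(0) = 1`. -/
def BA : ℝ := 2 * (M.η⁻¹ * Real.log (M.base.real Set.univ) + 1)

/-- `C_η = η⁻¹ + B_A`. -/
def Ceta : ℝ := M.η⁻¹ + M.BA

end Game

end Game

section Dimensions

/-- The `ε`-covering number of `s` (by centres in `s`) for the distance function `ρ`. -/
def coveringNumber {X : Type*} (ρ : X → X → ℝ≥0∞) (s : Set X) (ε : ℝ≥0∞) : ℕ∞ :=
  ⨅ (C : Set X) (_ : C ⊆ s) (_ : ∀ x ∈ s, ∃ y ∈ C, ρ x y ≤ ε), C.encard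

/-- The eluder dimension `dim_DE(G, P, ε)` of the function class `G` with respect to the family `P`
of signed measures: the largest length of a sequence in `P` each of whose members is
`ε'`-independent of its predecessors, for one common `ε' ≥ ε`. -/
def dimDE {X : Type*} [MeasurableSpace X] (G : Set (X → ℝ)) (P : Set (SignedMeasure X)) (ε : ℝ) :
    ℕ∞ :=
  ⨆ (n : ℕ) (_ : ∃ ε' : ℝ, ε ≤ ε' ∧ ∃ ρ : Fin n → SignedMeasure X, (∀ i, ρ i ∈ P) ∧
    ∀ m, ∃ g ∈ G,
      Real.sqrt (∑ i ∈ Finset.Iio m,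
        ((ρ i).integral g (ContinuousLinearMap.lsmul ℝ ℝ)) ^ 2) ≤ ε' ∧
      ε' < |(ρ m).integral g (ContinuousLinearMap.lsmul ℝ ℝ)|), (n : ℕ∞)

end Dimensions

section Classes

variable {S A B Par : Type*} [MeasurableSpace S] [MeasurableSpace A] [MeasurableSpace B]

/-- The classes of the learner: leader's policies `Π = {Π_h}`, follower's reward parameters
`Θ = {Θ_h}` with their reward functions `r_h^θ`, leader's value functions `𝒰`. -/
structure Classes (S A B Par : Type*) [MeasurableSpace S] [MeasurableSpace A]
    [MeasurableSpace B] where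
  Pol : ℕ → Set (Kernel (S × B) A)
  Θ : ℕ → Set Par
  rew : ℕ → Par → S × A × B → ℝ
  U : Set (ℕ → S × A × B → ℝ)

namespace Classes

variable (M : Game S A B) (K : Classes S A B Par) (H : ℕ)

/-- The leader's policies `π ∈ Π`. -/
def policies : Set (ℕ → Kernel (S × B) A) := {π | ∀ h < H, π h ∈ K.Pol h}

/-- The parameters `θ = (θ_h)_h ∈ Θ`. -/
def params : Set (ℕ → Par) := {θ | ∀ h < H, θ h ∈ K.Θ h}

/-- `T_h^{*, θ} f`. -/
def Topt (h : ℕ) (θ : ℕ → Par) (f : S × A × B → ℝ) : S → ℝ :=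
  M.optOp (K.Pol h) (K.rew h (θ h)) f

/-- The optimistic Bellman operator `(𝕋_h^{*, θ} f)(z) = u_h(z) + E_{s' ∼ P_h(· | z)} (T_{h+1}^{*, θ} f)(s')`. -/
def bellmanOpt (h : ℕ) (θ : ℕ → Par) (f : S × A × B → ℝ) (z : S × A × B) : ℝ :=
  M.u h z + ∫ s', K.Topt M (h + 1) θ f s' ∂(M.P h z)

/-- Standing regularity of the classes: policies are Markov kernels, follower rewards are measurable
with values in `[0, 1]`, leader value functions are measurable, bounded by `H`, and vanish after the
last step. -/
structure Regular : Prop where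
  isMarkov : ∀ h < H, ∀ π ∈ K.Pol h, IsMarkovKernel π
  measurable_rew : ∀ h < H, ∀ θ ∈ K.Θ h, Measurable (K.rew h θ)
  rew_mem : ∀ h < H, ∀ θ ∈ K.Θ h, ∀ z, K.rew h θ z ∈ Set.Icc (0 : ℝ) 1
  measurable_U : ∀ U ∈ K.U, ∀ h, Measurable (U h)
  U_le : ∀ U ∈ K.U, ∀ h z, |U h z| ≤ H
  U_end : ∀ U ∈ K.U, ∀ h, H ≤ h → U h = 0

/-- The maxima over `π_h ∈ Π_h` are attained, by one policy at all states. -/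
def MaxAttained : Prop :=
  ∀ U ∈ K.U, ∀ θ ∈ K.params H, ∀ h < H, ∃ π ∈ K.Pol h, ∀ s,
    M.evalOp (K.rew h (θ h)) π (U h) s = K.Topt M h θ (U h) s

/-- Realizability: the follower's true reward belongs to the model, and for every `θ ∈ Θ` the
optimal value function `U^{*, θ}` belongs to `𝒰`. -/
def Realizable : Prop :=
  (∃ θ ∈ K.params H, ∀ h < H, K.rew h (θ h) = M.r h) ∧
  ∀ θ ∈ K.params H, ∃ U ∈ K.U, ∀ h < H, U h = K.bellmanOpt M h θ (U (h + 1))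

/-- Completeness of `𝒰` under the optimistic Bellman operators. -/
def Complete : Prop :=
  ∀ U ∈ K.U, ∀ θ ∈ K.params H, ∀ h < H, ∃ U' ∈ K.U, U' h = K.bellmanOpt M h θ (U (h + 1))

/-- The distance on `Θ_h`: maximum of `(1 + η) ‖r_h^θ - r_h^{θ'}‖_∞` and the largest Hellinger
distance of the quantal responses. -/
def distΘ (h : ℕ) (θ θ' : Par) : ℝ≥0∞ :=
  max (⨆ z, ENNReal.ofReal ((1 + M.η) * |K.rew h θ z - K.rew h θ' z|))
    (⨆ π ∈ K.Pol h, ⨆ s, ENNReal.ofReal (M.hellinger (K.rew h θ) (K.rew h θ') π s))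

/-- `N_ρ(Θ, ε) = max_h N_ρ(Θ_h, ε)`. -/
def coverΘ (ε : ℝ≥0∞) : ℕ∞ := ⨆ h : Fin H, coveringNumber (K.distΘ M h) (K.Θ h) ε

/-- The distance on `𝒵_h = 𝒰² × Θ_{h+1}`: maximum of `‖U_h - Ũ_h‖_∞` (first components) and
`‖T_{h+1}^{*, θ} U_{h+1} - T_{h+1}^{*, θ̃} Ũ_{h+1}‖_∞` (second components). Here `Θ_{h+1}` enters
through whole sequences `θ`, of which only the entry `h + 1` matters. -/
def distZ (h : ℕ) (z z' : (ℕ → S × A × B → ℝ) × (ℕ → S × A × B → ℝ) × (ℕ → Par)) : ℝ≥0∞ :=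
  max (⨆ x, ENNReal.ofReal |z.1 h x - z'.1 h x|)
    (⨆ s, ENNReal.ofReal |K.Topt M (h + 1) z.2.2 (z.2.1 (h + 1)) s -
      K.Topt M (h + 1) z'.2.2 (z'.2.1 (h + 1)) s|)

/-- `N_ρ(𝒵, ε) = max_h N_ρ(𝒵_h, ε)`. -/
def coverZ (ε : ℝ≥0∞) : ℕ∞ :=
  ⨆ h : Fin H, coveringNumber (K.distZ M h) (K.U ×ˢ K.U ×ˢ K.params H) ε

/-- Leader's Bellman errors `U_h - 𝕋_h^{*, θ} U_{h+1}`. -/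
def classL (h : ℕ) : Set (S × A × B → ℝ) :=
  {g | ∃ U ∈ K.U, ∃ θ ∈ K.params H, g = fun z => U h z - K.bellmanOpt M h θ (U (h + 1)) z}

/-- Laws of `(s_h, a_h, b_h)` under the policies `π ∈ Π`. -/
def measL (h : ℕ) : Set (SignedMeasure (S × A × B)) :=
  {ρ | ∃ π ∈ K.policies H, ∀ E, MeasurableSet E → ρ E = (M.stepLaw π h).real E}

/-- Follower's reward errors `r_h^θ - r_h`. -/
def classF (h : ℕ) : Set (S × A × B → ℝ) :=
  {g | ∃ θ ∈ K.Θ h, g = fun z => K.rew h θ z - M.r h z}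

/-- The signed measures `π_h(· | s, b) ⊗ δ_{(s, b)} - (π_h ⊗ ν_h^π)(· | s) ⊗ δ_s`, so that integrating
`r_h^θ - r_h` gives the quantal response error at `(s, b)`. -/
def measF (h : ℕ) : Set (SignedMeasure (S × A × B)) :=
  {ρ | ∃ π ∈ K.Pol h, ∃ s b, ∀ E, MeasurableSet E →
    ρ E = ((π (s, b)).map fun a => (s, a, b)).real E -
      ((M.quantalResponse (M.r h) π s).bind fun b' => (π (s, b')).map fun a => (s, a, b')).real E}

/-- `dim(G_L)` at scale `ε`. -/
def dimL (ε : ℝ) : ℕ∞ := ⨆ h : Fin H, dimDE (K.classL M H h) (K.measL M H h) ε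

/-- `dim(G_F)` at scale `ε`. -/
def dimF (ε : ℝ) : ℕ∞ := ⨆ h : Fin H, dimDE (K.classF M h) (K.measF M h) ε

end Classes

end Classes

section Online

variable {S A B Par : Type*} [MeasurableSpace S] [MeasurableSpace A] [MeasurableSpace B]

/-- The data of `t` episodes. -/
abbrev Hist (S A B : Type*) (H t : ℕ) : Type _ := Fin t → Fin H → S × A × B

/-- The episodes before episode `i`. -/
def Hist.before {H t : ℕ} (x : Hist S A B H t) (i : Fin t) : Hist S A B H i :=
  fun j => x ⟨j, j.2.trans i.2⟩

/-- What a learner selects in each episode, as a function of the data of the earlier episodes: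
estimates `Û^t`, `θ̂^t` and the policy `π̂^t` to be announced. -/
structure Learner (S A B Par : Type*) [MeasurableSpace S] [MeasurableSpace A] [MeasurableSpace B]
    (H : ℕ) where
  Uhat : (t : ℕ) → Hist S A B H t → ℕ → S × A × B → ℝ
  θhat : (t : ℕ) → Hist S A B H t → ℕ → Par
  pol : (t : ℕ) → (h : ℕ) → Kernel (Hist S A B H t × S × B) A

namespace Learner

variable {H : ℕ} (M : Game S A B) (K : Classes S A B Par) (L : Learner S A B Par H)

/-- The policy `π̂^t` announced after the data `x`. -/
def policyAt (t : ℕ) (x : Hist S A B H t) (h : ℕ) : Kernel (S × B) A := (L.pol t h).sectR x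

/-- Law of the data of the first `t` episodes when the learner interacts with the game. -/
def law : (t : ℕ) → Measure (Hist S A B H t)
  | 0 => Measure.dirac fun i => i.elim0
  | t + 1 => (law t).bind fun x => (M.trajLaw (L.policyAt t x) H).map fun τ =>
      Fin.snoc (α := fun _ => Fin H → S × A × B) x τ

/-- The follower's negative log-likelihood `𝓛_h^t(θ_h)`. -/
def negLogLik {t : ℕ} (x : Hist S A B H t) (h : Fin H) (θ : Par) : ℝ :=
  -∑ i : Fin t, M.η * M.adv (K.rew h θ) (L.policyAt i (x.before i) h) (x i h).1 (x i h).2.2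

/-- The leader's Bellman loss
`ℓ_h^t(f, g, θ) = ∑_i (f(z_h^i) - u_h^i - (T_{h+1}^{*, θ} g)(s_{h+1}^i))²`; the last term is absent at
the last step. -/
def bellmanLoss {t : ℕ} (x : Hist S A B H t) (h : Fin H) (f g : S × A × B → ℝ) (θ : ℕ → Par) : ℝ :=
  ∑ i : Fin t, (f (x i h) - M.u h (x i h) -
    (if hh : (h : ℕ) + 1 < H then K.Topt M (h + 1) θ g (x i ⟨h + 1, hh⟩).1 else 0)) ^ 2

/-- The confidence set: `(U, θ) ∈ 𝒰 × Θ` such that for all `h` the negative log-likelihood exceeds its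
infimum over `Θ_h` by at most `β` and the Bellman loss exceeds its infimum over the first argument
by at most `H² β`. -/
def confSet (β : ℝ) {t : ℕ} (x : Hist S A B H t) : Set ((ℕ → S × A × B → ℝ) × (ℕ → Par)) :=
  {p | p.1 ∈ K.U ∧ p.2 ∈ K.params H ∧ ∀ h : Fin H,
    (∀ θ' ∈ K.Θ h, L.negLogLik M K x h (p.2 h) ≤ L.negLogLik M K x h θ' + β) ∧
    ∀ V ∈ K.U, bellmanLoss M K x h (p.1 h) (p.1 (h + 1)) p.2 ≤
      bellmanLoss M K x h (V h) (p.1 (h + 1)) p.2 + (H : ℝ) ^ 2 * β}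

/-- The optimistic objective `J(U, θ) = max_{π_1} E_{s_1 ∼ ρ_0} ⟨U_1(s_1, ·, ·), π_1 ⊗ ν^{π, θ}⟩`. -/
def objective (p : (ℕ → S × A × B → ℝ) × (ℕ → Par)) : ℝ :=
  ⨆ π : K.Pol 0, ∫ s, M.evalOp (K.rew 0 (p.2 0)) π.1 (p.1 0) s ∂M.ρ₀

/-- `L` runs MLE-GOLF with parameter `β` for `T` episodes: whenever the confidence set is nonempty,
the estimates maximise the optimistic objective over it and the announced policy is greedy for
the estimates at every step and state. When the confidence set is empty the choice
within `Π` is free. -/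
structure IsMLEGOLF (β : ℝ) (T : ℕ) : Prop where
  isMarkov : ∀ t < T, ∀ h < H, IsMarkovKernel (L.pol t h)
  pol_mem : ∀ t < T, ∀ x : Hist S A B H t, L.policyAt t x ∈ K.policies H
  /-- The follower's estimated reward depends measurably on the data. -/
  measurable_rew : ∀ t < T, ∀ h < H, Measurable fun p : Hist S A B H t × (S × A × B) =>
    K.rew h (L.θhat t p.1 h) p.2
  mem_confSet : ∀ t < T, ∀ x : Hist S A B H t, (L.confSet M K β x).Nonempty →
    (L.Uhat t x, L.θhat t x) ∈ L.confSet M K β x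
  optimistic : ∀ t < T, ∀ x : Hist S A B H t, ∀ p ∈ L.confSet M K β x,
    objective M K p ≤ objective M K (L.Uhat t x, L.θhat t x)
  greedy : ∀ t < T, ∀ x : Hist S A B H t, (L.confSet M K β x).Nonempty → ∀ h < H, ∀ s,
    M.evalOp (K.rew h (L.θhat t x h)) (L.policyAt t x h) (L.Uhat t x h) s =
      K.Topt M h (L.θhat t x) (L.Uhat t x h) s

/-- `Reg(T) = ∑_t (max_{π ∈ Π} J(π) - J(π̂^t))` on the data `x`. -/
def regret {T : ℕ} (x : Hist S A B H T) : ℝ :=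
  ∑ t : Fin T, ((⨆ π : K.policies H, M.J H π.1) - M.J H (L.policyAt t (x.before t)))

end Learner

end Online

end QSE

end

/-!
Why the theorem holds. Write `𝕋` for the optimistic Bellman operator, `π̂^t` for the announced
policies, `E` for the quantal response error of a reward `r'` at `(s, b)`, that is, the deviation of
`⟨π, r' - r⟩(s, b)` from its mean under the true response (`Game.respError`), and
`ι = log (e H T N / δ)`, with `N` the larger of the two covering numbers.

*Confidence.* Three families of increments have conditional exponential moment at most one
(`Game.lintegral_exp_bellman_le`, `Game.lintegral_exp_likelihood_le`,
`Game.lintegral_exp_neg_add_mean_le`), so their sums over episodes are exponential supermartingales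
(`Learner.lintegral_exp_additive_le`). Markov's inequality and a union bound over steps, episodes
and the centres of the covers bound all of them by multiples of `ι` with probability `1 - δ`
(`Learner.law_not_isGood_le`); stability of the increments under the covering distances extends the
bounds from the centres to the whole classes. The three families control

* the mean squared Bellman error of `(U, U', θ)` by the excess of its Bellman loss: given
  `(s_h, a_h, b_h)` the loss of `𝕋 U'` has a bounded centred noise, so that Hoeffding's lemma
  applies;
* the squared response errors on the data by the excess of the negative log-likelihood: the response
  to `r'` is an exponential tilt of the true response, and its squared Hellinger distance to the
  latter dominates the variance of the tilting function, which is the conditional mean of `E²`;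
* the conditional means of the response errors by their values on the data.

*Regret.* On this event the true model lies in every confidence set, hence `(Û^t, θ̂^t)` is
optimistic, and telescoping along the episode (`Game.integral_sub_J_eq`) bounds its regret by the
Bellman errors `∫ (Û - 𝕋 Û)` plus `H` times the total variation between the estimated and the true
response, which is at most the mean of `η |E| + 2 η² exp (2 η) E²` (`Game.abs_evalOp_sub_le`).
Membership in the confidence set and completeness bound the second moments of the Bellman errors
and of `E` over the past by `O(H² β)` and `O((1 + 1/η)² β)`. The eluder dimension turns these into
bounds on the sums of the errors, each evaluated in its own episode (`eluder_sum_le`): the episodes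
where an error exceeds `ε` can be distributed over `⌈b / ε²⌉` classes so that each is
`ε`-independent of its predecessors in its class, and summing over the levels `ε` gives
`√(d b T)` for absolute values and `d b log T` for squares. For `T = 1`, where `log T` vanishes, the
regret is trivially at most `H`.
-/

namespace QSE

attribute [instance] Game.isProb_ρ₀ Game.isMarkov_P Game.isFinite_base

/-! ### Binding families of probability measures -/

section Bind

variable {X Y Z : Type*} [MeasurableSpace X] [MeasurableSpace Y] [MeasurableSpace Z]

theorem measurable_lintegral_param {μ : X → Measure Y} (hμ : Measurable μ)
    [∀ x, IsProbabilityMeasure (μ x)] {f : X → Y → ℝ≥0∞} (hf : Measurable fun p : X × Y => f p.1 p.2) :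
    Measurable fun x => ∫⁻ y, f x y ∂(μ x) := by
  let κ : Kernel X Y := ⟨μ, hμ⟩
  have : IsMarkovKernel κ := ⟨fun x => inferInstanceAs (IsProbabilityMeasure (μ x))⟩
  exact Measurable.lintegral_kernel_prod_right (κ := κ) hf

theorem measurable_integral_param {μ : X → Measure Y} (hμ : Measurable μ)
    [∀ x, IsProbabilityMeasure (μ x)] {f : X → Y → ℝ} (hf : Measurable fun p : X × Y => f p.1 p.2) :
    Measurable fun x => ∫ y, f x y ∂(μ x) := by
  let κ : Kernel X Y := ⟨μ, hμ⟩
  have : IsMarkovKernel κ := ⟨fun x => inferInstanceAs (IsProbabilityMeasure (μ x))⟩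
  exact (StronglyMeasurable.integral_kernel_prod_right (κ := κ) (f := f)
    hf.stronglyMeasurable).measurable

theorem measurable_bind_param {μ : X → Measure Y} (hμ : Measurable μ)
    [∀ x, IsProbabilityMeasure (μ x)] {ν : X → Y → Measure Z}
    (hν : Measurable fun p : X × Y => ν p.1 p.2) :
    Measurable fun x => (μ x).bind (ν x) := by
  refine Measure.measurable_of_measurable_coe _ fun E hE => ?_
  have h : ∀ x, Measurable (ν x) := fun x => hν.comp measurable_prodMk_left
  simp_rw [fun x => Measure.bind_apply (m := μ x) hE (h x).aemeasurable]
  exact measurable_lintegral_param hμ ((Measure.measurable_coe hE).comp hν)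

theorem measurable_map_param {μ : X → Measure Y} (hμ : Measurable μ)
    [∀ x, IsProbabilityMeasure (μ x)] {f : X → Y → Z}
    (hf : Measurable fun p : X × Y => f p.1 p.2) :
    Measurable fun x => (μ x).map (f x) := by
  have h : ∀ x, Measurable (f x) := fun x => hf.comp measurable_prodMk_left
  have : (fun x => (μ x).map (f x)) = fun x => (μ x).bind fun y => Measure.dirac (f x y) := by
    funext x
    rw [← Measure.bind_dirac_eq_map _ (h x)]
  rw [this]
  exact measurable_bind_param hμ (Measure.measurable_dirac.comp hf)

theorem isProbabilityMeasure_bind {μ : Measure Y} [IsProbabilityMeasure μ] {ν : Y → Measure Z}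
    (hν : Measurable ν) [∀ y, IsProbabilityMeasure (ν y)] : IsProbabilityMeasure (μ.bind ν) :=
  ⟨by rw [Measure.bind_apply .univ hν.aemeasurable]; simp⟩

theorem map_bind {μ : Measure X} {ν : X → Measure Y} (hν : Measurable ν) {f : Y → Z}
    (hf : Measurable f) : (μ.bind ν).map f = μ.bind fun x => (ν x).map f := by
  ext E hE
  rw [Measure.map_apply hf hE, Measure.bind_apply (hf hE) hν.aemeasurable,
    Measure.bind_apply (f := fun x => (ν x).map f) hE
      ((Measure.measurable_map f hf).comp hν).aemeasurable]
  simp_rw [Measure.map_apply hf hE]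

theorem bind_map {μ : Measure X} {f : X → Y} (hf : Measurable f) {ν : Y → Measure Z}
    (hν : Measurable ν) : (μ.map f).bind ν = μ.bind fun x => ν (f x) := by
  ext E hE
  rw [Measure.bind_apply hE hν.aemeasurable, Measure.bind_apply (f := fun x => ν (f x)) hE
    (hν.comp hf).aemeasurable,
    lintegral_map (f := fun y => ν y E) ((Measure.measurable_coe hE).comp hν) hf]

theorem integrable_of_bounded {μ : Measure X} [IsFiniteMeasure μ] {f : X → ℝ} (hf : Measurable f)
    {c : ℝ} (hc : ∀ x, |f x| ≤ c) : Integrable f μ :=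
  Integrable.of_bound hf.aestronglyMeasurable c (.of_forall hc)

theorem abs_integral_le_of_bounded {μ : Measure X} [IsProbabilityMeasure μ] {f : X → ℝ}
    {c : ℝ} (hc : ∀ x, |f x| ≤ c) : |∫ x, f x ∂μ| ≤ c := by
  have := norm_integral_le_of_norm_le_const (μ := μ) (f := f) (C := c) (.of_forall hc)
  simpa using this

theorem integral_bind {μ : Measure Y} [IsProbabilityMeasure μ] {ν : Y → Measure Z}
    (hν : Measurable ν) [∀ y, IsProbabilityMeasure (ν y)] {f : Z → ℝ} (hf : Measurable f)
    {c : ℝ} (hc : ∀ z, |f z| ≤ c) : ∫ z, f z ∂(μ.bind ν) = ∫ y, ∫ z, f z ∂(ν y) ∂μ := by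
  let κ : Kernel Y Z := ⟨ν, hν⟩
  have : IsProbabilityMeasure (μ.bind ν) := isProbabilityMeasure_bind hν
  have hk : μ.bind ν = (κ ∘ₖ (Kernel.const Unit μ)) () := by
    rw [Kernel.comp_apply]; rfl
  have hi : Integrable f ((κ ∘ₖ (Kernel.const Unit μ)) ()) := by
    rw [← hk]; exact integrable_of_bounded hf hc
  rw [hk, Kernel.integral_comp hi]
  rfl

theorem integral_mem_Icc {μ : Measure X} [IsProbabilityMeasure μ] {f : X → ℝ} (hf : Measurable f)
    {c d : ℝ} (hc : ∀ x, f x ∈ Set.Icc c d) : ∫ x, f x ∂μ ∈ Set.Icc c d := by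
  have hi : Integrable f μ := Integrable.of_mem_Icc c d hf.aemeasurable (.of_forall hc)
  constructor
  · simpa using integral_mono (integrable_const c) hi (fun x => (hc x).1)
  · simpa using integral_mono hi (integrable_const d) (fun x => (hc x).2)

end Bind

/-! ### Averages over the leader's action and quantal responses -/

section Response

variable {S A B X : Type*} [MeasurableSpace S] [MeasurableSpace A] [MeasurableSpace B]
  [MeasurableSpace X]

/-- A measurable reward function with values in `[0, 1]`. -/
structure IsReward (r : S × A × B → ℝ) : Prop where
  measurable : Measurable r
  mem : ∀ z, r z ∈ Set.Icc (0 : ℝ) 1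

/-- A family of leader's one-step policies that are Markov kernels and depend measurably on a
parameter. -/
structure IsPolicyFamily (π : X → Kernel (S × B) A) : Prop where
  measurable : Measurable fun p : X × S × B => π p.1 p.2
  isMarkov : ∀ x, IsMarkovKernel (π x)

theorem IsPolicyFamily.const (π : Kernel (S × B) A) [hπ : IsMarkovKernel π] :
    IsPolicyFamily fun _ : X => π :=
  ⟨π.measurable.comp measurable_snd, fun _ => hπ⟩

theorem IsPolicyFamily.sectR (π : Kernel (X × S × B) A) [IsMarkovKernel π] :
    IsPolicyFamily fun x : X => π.sectR x :=
  ⟨π.measurable, fun _ => inferInstance⟩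

theorem measurable_avg_param {π : X → Kernel (S × B) A} (hπ : IsPolicyFamily π)
    {f : X → S × A × B → ℝ} (hf : Measurable fun p : X × (S × A × B) => f p.1 p.2) :
    Measurable fun p : X × S × B => avg (f p.1) (π p.1) p.2.1 p.2.2 := by
  have : ∀ p : X × S × B, IsProbabilityMeasure (π p.1 p.2) := fun p =>
    (hπ.isMarkov p.1).isProbabilityMeasure p.2
  refine measurable_integral_param (μ := fun p : X × S × B => π p.1 p.2)
    (f := fun p a => f p.1 (p.2.1, a, p.2.2)) hπ.measurable ?_
  exact hf.comp (by fun_prop : Measurable fun q : (X × S × B) × A =>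
    (q.1.1, (q.1.2.1, q.2, q.1.2.2)))

section Avg

variable {π : Kernel (S × B) A} [IsMarkovKernel π] {f g : S × A × B → ℝ}

theorem measurable_avg (hf : Measurable f) : Measurable fun p : S × B => avg f π p.1 p.2 :=
  (measurable_avg_param (X := Unit) (IsPolicyFamily.const π) (f := fun _ => f)
    (hf.comp measurable_snd)).comp (measurable_prodMk_left (x := ()))

theorem measurable_avg_right (hf : Measurable f) (s : S) : Measurable fun b => avg f π s b :=
  (measurable_avg (π := π) hf).comp measurable_prodMk_left

theorem measurable_section (hf : Measurable f) (s : S) (b : B) :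
    Measurable fun a => f (s, a, b) :=
  hf.comp (measurable_const.prodMk (measurable_id.prodMk measurable_const))

theorem abs_avg_le {c : ℝ} (hc : ∀ z, |f z| ≤ c) (s : S) (b : B) : |avg f π s b| ≤ c :=
  abs_integral_le_of_bounded fun _ => hc _

theorem avg_mem_Icc (hf : Measurable f) {c d : ℝ} (hc : ∀ z, f z ∈ Set.Icc c d) (s : S) (b : B) :
    avg f π s b ∈ Set.Icc c d :=
  integral_mem_Icc (measurable_section hf s b) fun _ => hc _

theorem avg_sub (hf : Measurable f) (hg : Measurable g) {c d : ℝ} (hc : ∀ z, |f z| ≤ c)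
    (hd : ∀ z, |g z| ≤ d) (s : S) (b : B) :
    avg (fun z => f z - g z) π s b = avg f π s b - avg g π s b :=
  integral_sub (integrable_of_bounded (measurable_section hf s b) fun _ => hc _)
    (integrable_of_bounded (measurable_section hg s b) fun _ => hd _)

end Avg

theorem IsReward.abs_apply_le {r : S × A × B → ℝ} (hr : IsReward r) (z : S × A × B) : |r z| ≤ 1 :=
  abs_le.2 ⟨by linarith [(hr.mem z).1], (hr.mem z).2⟩

namespace Game

variable (M : Game S A B)

theorem isReward_r (h : ℕ) : IsReward (M.r h) := ⟨M.measurable_r h, M.r_mem h⟩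

/-- The normalising constant `∑_b exp(η r^π(s, b))` of the quantal response. -/
noncomputable def partition (r : S × A × B → ℝ) (π : Kernel (S × B) A) (s : S) : ℝ :=
  ∫ b, Real.exp (M.η * avg r π s b) ∂M.base

theorem eta_mul_adv (r : S × A × B → ℝ) (π : Kernel (S × B) A) (s : S) (b : B) :
    M.η * M.adv r π s b = M.η * avg r π s b - Real.log (M.partition r π s) := by
  rw [adv, softV, mul_sub, ← mul_assoc, mul_inv_cancel₀ M.η_pos.ne', one_mul]
  rfl

section Single

variable {r r' : S × A × B → ℝ} {π : Kernel (S × B) A} [IsMarkovKernel π]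

theorem integrable_exp_avg (hr : IsReward r) (s : S) :
    Integrable (fun b => Real.exp (M.η * avg r π s b)) M.base := by
  refine integrable_of_bounded (c := Real.exp M.η)
    (((measurable_avg_right hr.measurable s).const_mul _).exp) fun b => ?_
  rw [abs_of_pos (Real.exp_pos _)]
  refine Real.exp_le_exp.2 ?_
  have := (avg_mem_Icc (π := π) hr.measurable hr.mem s b).2
  nlinarith [M.η_pos]

theorem one_le_partition (hr : IsReward r) (s : S) : 1 ≤ M.partition r π s := by
  have h1 : ∫ _b, (1 : ℝ) ∂M.base ≤ M.partition r π s := by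
    refine integral_mono (integrable_const _) (M.integrable_exp_avg hr s) fun b => ?_
    refine Real.one_le_exp (mul_nonneg M.η_pos.le (avg_mem_Icc hr.measurable hr.mem s b).1)
  simp only [integral_const, smul_eq_mul, mul_one] at h1
  exact M.one_le_base.trans h1

theorem partition_pos (hr : IsReward r) (s : S) : 0 < M.partition r π s :=
  lt_of_lt_of_le one_pos (M.one_le_partition hr s)

theorem exp_adv (hr : IsReward r) (s : S) (b : B) :
    Real.exp (M.η * M.adv r π s b) = Real.exp (M.η * avg r π s b) / M.partition r π s := by
  rw [eta_mul_adv, Real.exp_sub, Real.exp_log (M.partition_pos hr s)]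

end Single

theorem measurable_softV_param {π : X → Kernel (S × B) A} (hπ : IsPolicyFamily π)
    {f : X → S × A × B → ℝ} (hf : Measurable fun p : X × (S × A × B) => f p.1 p.2) :
    Measurable fun p : X × S => M.softV (f p.1) (π p.1) p.2 := by
  refine Measurable.const_mul (Measurable.log ?_) _
  have h : Measurable fun q : (X × S) × B =>
      Real.exp (M.η * avg (f q.1.1) (π q.1.1) q.1.2 q.2) :=
    (((measurable_avg_param hπ hf).comp (by fun_prop : Measurable fun q : (X × S) × B =>
      (q.1.1, q.1.2, q.2))).const_mul M.η).exp
  exact (StronglyMeasurable.integral_prod_right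
    (f := fun (p : X × S) (b : B) => Real.exp (M.η * avg (f p.1) (π p.1) p.2 b))
    h.stronglyMeasurable).measurable

theorem measurable_adv_param {π : X → Kernel (S × B) A} (hπ : IsPolicyFamily π)
    {f : X → S × A × B → ℝ} (hf : Measurable fun p : X × (S × A × B) => f p.1 p.2) :
    Measurable fun p : X × S × B => M.adv (f p.1) (π p.1) p.2.1 p.2.2 :=
  (measurable_avg_param hπ hf).sub ((M.measurable_softV_param hπ hf).comp
    (by fun_prop : Measurable fun p : X × S × B => (p.1, p.2.1)))

theorem measurable_quantalResponse_param {π : X → Kernel (S × B) A} (hπ : IsPolicyFamily π)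
    {f : X → S × A × B → ℝ} (hf : Measurable fun p : X × (S × A × B) => f p.1 p.2) :
    Measurable fun p : X × S => M.quantalResponse (f p.1) (π p.1) p.2 := by
  refine Measure.measurable_of_measurable_coe _ fun E hE => ?_
  simp_rw [quantalResponse, withDensity_apply _ hE]
  refine Measurable.lintegral_prod_right' (f := fun q : (X × S) × B =>
    ENNReal.ofReal (Real.exp (M.η * M.adv (f q.1.1) (π q.1.1) q.1.2 q.2))) ?_
  exact ((((M.measurable_adv_param hπ hf).comp (by fun_prop : Measurable fun q : (X × S) × B =>
      (q.1.1, q.1.2, q.2))).const_mul M.η).exp).ennreal_ofReal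

section Single

variable {r r' : S × A × B → ℝ} {π : Kernel (S × B) A} [IsMarkovKernel π]

theorem measurable_adv (hr : Measurable r) :
    Measurable fun p : S × B => M.adv r π p.1 p.2 :=
  (M.measurable_adv_param (X := Unit) (IsPolicyFamily.const π) (f := fun _ => r)
    (hr.comp measurable_snd)).comp (measurable_prodMk_left (x := ()))

theorem measurable_adv_right (hr : Measurable r) (s : S) : Measurable fun b => M.adv r π s b :=
  (M.measurable_adv (π := π) hr).comp measurable_prodMk_left

theorem isProbabilityMeasure_quantalResponse (hr : IsReward r) (s : S) :
    IsProbabilityMeasure (M.quantalResponse r π s) := by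
  constructor
  rw [quantalResponse, withDensity_apply _ .univ, Measure.restrict_univ,
    ← ofReal_integral_eq_lintegral_ofReal]
  · simp_rw [M.exp_adv hr, integral_div]
    rw [← partition, div_self (M.partition_pos hr s).ne', ENNReal.ofReal_one]
  · simp_rw [M.exp_adv hr]
    exact (M.integrable_exp_avg hr s).div_const _
  · exact .of_forall fun b => (Real.exp_pos _).le

theorem integral_quantalResponse (hr : IsReward r) (s : S) (g : B → ℝ) :
    ∫ b, g b ∂(M.quantalResponse r π s) = ∫ b, Real.exp (M.η * M.adv r π s b) * g b ∂M.base := by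
  rw [quantalResponse, integral_withDensity_eq_integral_toReal_smul
    (((M.measurable_adv_right hr.measurable s).const_mul _).exp.ennreal_ofReal)
    (.of_forall fun b => ENNReal.ofReal_lt_top)]
  refine integral_congr_ae (.of_forall fun b => ?_)
  simp [ENNReal.toReal_ofReal (Real.exp_pos _).le]

/-- The quantal response to `r'` has density `exp(η (A^{π, r'} - A^{π, r}))` with respect to the
quantal response to `r`. -/
theorem integral_quantalResponse_change (hr : IsReward r) (hr' : IsReward r') (s : S)
    (g : B → ℝ) : ∫ b, g b ∂(M.quantalResponse r' π s) =
      ∫ b, Real.exp (M.η * M.adv r' π s b - M.η * M.adv r π s b) * g b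
        ∂(M.quantalResponse r π s) := by
  rw [M.integral_quantalResponse hr, M.integral_quantalResponse hr']
  refine integral_congr_ae (.of_forall fun b => ?_)
  simp only
  rw [← mul_assoc, ← Real.exp_add, add_sub_cancel]

end Single

end Game

end Response

/-! ### Laws of steps and episodes -/

section Laws

variable {S A B X : Type*} [MeasurableSpace S] [MeasurableSpace A] [MeasurableSpace B]
  [MeasurableSpace X]

theorem measurable_snoc {Y : Type*} [MeasurableSpace Y] {n : ℕ} :
    Measurable fun p : (Fin n → Y) × Y => (Fin.snoc (α := fun _ => Y) p.1 p.2 : Fin (n + 1) → Y) := by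
  refine measurable_pi_iff.2 fun i => ?_
  induction i using Fin.lastCases with
  | last => simpa using measurable_snd
  | cast i =>
    simp only [Fin.snoc_castSucc]
    fun_prop

theorem measurable_snoc_right {Y : Type*} [MeasurableSpace Y] {n : ℕ} (τ : Fin n → Y) :
    Measurable fun z : Y => (Fin.snoc (α := fun _ => Y) τ z : Fin (n + 1) → Y) :=
  measurable_snoc.comp measurable_prodMk_left

namespace Game

variable (M : Game S A B)

/-- Law of `(s, a, b)` when the leader plays `π` at the state `s` and the follower responds to `π`
for the reward `r`. -/
noncomputable def actLaw (r : S × A × B → ℝ) (π : Kernel (S × B) A) (s : S) :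
    Measure (S × A × B) :=
  (M.quantalResponse r π s).bind fun b => (π (s, b)).map fun a => (s, a, b)

theorem measurable_actLaw_param {π : X → Kernel (S × B) A} (hπ : IsPolicyFamily π)
    {r : S × A × B → ℝ} (hr : IsReward r) :
    Measurable fun p : X × S => M.actLaw r (π p.1) p.2 := by
  have := hπ.isMarkov
  have : ∀ p : X × S, IsProbabilityMeasure (M.quantalResponse r (π p.1) p.2) := fun p =>
    M.isProbabilityMeasure_quantalResponse hr p.2
  have : ∀ p : (X × S) × B, IsProbabilityMeasure (π p.1.1 (p.1.2, p.2)) := fun p =>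
    (hπ.isMarkov p.1.1).isProbabilityMeasure _
  refine measurable_bind_param (μ := fun p : X × S => M.quantalResponse r (π p.1) p.2)
    (ν := fun p b => (π p.1 (p.2, b)).map fun a => (p.2, a, b))
    (M.measurable_quantalResponse_param hπ (f := fun _ => r) (hr.measurable.comp measurable_snd)) ?_
  refine measurable_map_param (μ := fun p : (X × S) × B => π p.1.1 (p.1.2, p.2))
    (f := fun p a => (p.1.2, a, p.2)) ?_ (by fun_prop)
  exact hπ.measurable.comp (by fun_prop : Measurable fun p : (X × S) × B => (p.1.1, p.1.2, p.2))

theorem measurable_map_policy (π : Kernel (S × B) A) [IsMarkovKernel π] (s : S) :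
    Measurable fun b => (π (s, b)).map fun a => (s, a, b) :=
  measurable_map_param (μ := fun b => π (s, b)) (f := fun b a => (s, a, b))
    (π.measurable.comp measurable_prodMk_left) (by fun_prop)

section Single

variable {r : S × A × B → ℝ} {π : Kernel (S × B) A} [IsMarkovKernel π]

theorem measurable_actLaw (hr : IsReward r) : Measurable (M.actLaw r π) := by
  have h : Measurable fun p : Unit × S => M.actLaw r ((fun _ : Unit => π) p.1) p.2 :=
    M.measurable_actLaw_param (IsPolicyFamily.const π) hr
  have h' := h.comp (by fun_prop : Measurable fun s : S => ((), s))
  exact h'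

theorem isProbabilityMeasure_map_policy (s : S) (b : B) :
    IsProbabilityMeasure ((π (s, b)).map fun a => (s, a, b)) :=
  Measure.isProbabilityMeasure_map (by fun_prop)

theorem isProbabilityMeasure_actLaw (hr : IsReward r) (s : S) :
    IsProbabilityMeasure (M.actLaw r π s) := by
  have := M.isProbabilityMeasure_quantalResponse (π := π) hr s
  have := isProbabilityMeasure_map_policy (π := π) s
  exact isProbabilityMeasure_bind (measurable_map_policy π s)

theorem lintegral_actLaw (s : S) {g : S × A × B → ℝ≥0∞} (hg : Measurable g) :
    ∫⁻ z, g z ∂(M.actLaw r π s) =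
      ∫⁻ b, ∫⁻ a, g (s, a, b) ∂(π (s, b)) ∂(M.quantalResponse r π s) := by
  rw [actLaw, Measure.lintegral_bind (measurable_map_policy π s).aemeasurable hg.aemeasurable]
  refine lintegral_congr fun b => ?_
  rw [lintegral_map hg (by fun_prop)]

/-- Functions of the state and the follower's action integrate against the follower's response. -/
theorem lintegral_actLaw_response (s : S) {g : S → B → ℝ≥0∞}
    (hg : Measurable fun p : S × B => g p.1 p.2) :
    ∫⁻ z, g z.1 z.2.2 ∂(M.actLaw r π s) = ∫⁻ b, g s b ∂(M.quantalResponse r π s) := by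
  rw [M.lintegral_actLaw s (g := fun z => g z.1 z.2.2)
    (hg.comp (by fun_prop : Measurable fun z : S × A × B => (z.1, z.2.2)))]
  simp

omit [IsMarkovKernel π] in
theorem integral_map_policy (s : S) (b : B) {f : S × A × B → ℝ} (hf : Measurable f) :
    ∫ z, f z ∂((π (s, b)).map fun a => (s, a, b)) = avg f π s b :=
  integral_map (by fun_prop) hf.aestronglyMeasurable

theorem integral_actLaw (hr : IsReward r) (s : S) {f : S × A × B → ℝ} (hf : Measurable f)
    {c : ℝ} (hc : ∀ z, |f z| ≤ c) : ∫ z, f z ∂(M.actLaw r π s) = M.evalOp r π f s := by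
  have := M.isProbabilityMeasure_quantalResponse (π := π) hr s
  have := isProbabilityMeasure_map_policy (π := π) s
  rw [actLaw, integral_bind (measurable_map_policy π s) hf hc]
  simp_rw [integral_map_policy s _ hf]
  rfl

theorem measurable_evalOp (hr : IsReward r) {f : S × A × B → ℝ} (hf : Measurable f)
    {c : ℝ} (hc : ∀ z, |f z| ≤ c) : Measurable (M.evalOp r π f) := by
  have := M.isProbabilityMeasure_actLaw (π := π) hr
  have h : Measurable fun s => ∫ z, f z ∂(M.actLaw r π s) :=
    measurable_integral_param (M.measurable_actLaw hr) (hf.comp measurable_snd)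
  simpa only [M.integral_actLaw hr _ hf hc] using h

theorem abs_evalOp_le (hr : IsReward r) (s : S) {f : S × A × B → ℝ}
    {c : ℝ} (hc : ∀ z, |f z| ≤ c) : |M.evalOp r π f s| ≤ c := by
  have := M.isProbabilityMeasure_quantalResponse (π := π) hr s
  exact abs_integral_le_of_bounded fun b => abs_avg_le hc s b

end Single

theorem measurable_stateLaw {h : ℕ} : Measurable (M.stateLaw (h := h)) := by
  cases h with
  | zero => exact measurable_const
  | succ h => exact (M.P h).measurable.comp (measurable_pi_apply _)

instance isProbabilityMeasure_stateLaw {h : ℕ} (τ : Fin h → S × A × B) :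
    IsProbabilityMeasure (M.stateLaw τ) := by
  cases h with
  | zero => exact M.isProb_ρ₀
  | succ h => exact (M.isMarkov_P h).isProbabilityMeasure _

/-- Law of the next step `(s, a, b)`, given the steps before it. -/
noncomputable def nextLaw (π : Kernel (S × B) A) {h : ℕ} (τ : Fin h → S × A × B) :
    Measure (S × A × B) :=
  (M.stateLaw τ).bind (M.actLaw (M.r h) π)

theorem measurable_nextLaw_param {π : X → Kernel (S × B) A} (hπ : IsPolicyFamily π) (h : ℕ) :
    Measurable fun p : X × (Fin h → S × A × B) => M.nextLaw (π p.1) p.2 := by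
  have h1 := (M.measurable_actLaw_param hπ (M.isReward_r h)).comp
    (by fun_prop : Measurable fun p : (X × (Fin h → S × A × B)) × S => (p.1.1, p.2))
  exact measurable_bind_param (μ := fun p : X × (Fin h → S × A × B) => M.stateLaw p.2)
    (ν := fun p => M.actLaw (M.r h) (π p.1)) (M.measurable_stateLaw.comp measurable_snd) h1

theorem isProbabilityMeasure_nextLaw (π : Kernel (S × B) A) [IsMarkovKernel π] {h : ℕ}
    (τ : Fin h → S × A × B) : IsProbabilityMeasure (M.nextLaw π τ) := by
  have := M.isProbabilityMeasure_actLaw (π := π) (M.isReward_r h)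
  exact isProbabilityMeasure_bind (M.measurable_actLaw (M.isReward_r h))

theorem measurable_nextLaw (π : Kernel (S × B) A) [IsMarkovKernel π] (h : ℕ) :
    Measurable (M.nextLaw π (h := h)) := by
  have := M.measurable_nextLaw_param (IsPolicyFamily.const (X := Unit) π) h
  have h' := this.comp (by fun_prop : Measurable fun τ : Fin h → S × A × B => ((), τ))
  exact h'

theorem trajLaw_succ (π : ℕ → Kernel (S × B) A) (h : ℕ) [IsMarkovKernel (π h)] :
    M.trajLaw π (h + 1) = (M.trajLaw π h).bind fun τ =>
      (M.nextLaw (π h) τ).map fun z => Fin.snoc (α := fun _ => S × A × B) τ z := by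
  rw [trajLaw]
  congr 1
  funext τ
  have hsn := measurable_snoc_right (Y := S × A × B) τ
  rw [nextLaw, map_bind (M.measurable_actLaw (M.isReward_r h)) hsn]
  congr 1
  funext s
  rw [actLaw, map_bind (measurable_map_policy (π h) s) hsn]
  congr 1
  funext b
  rw [Measure.map_map hsn (by fun_prop)]
  rfl

/-- The law of an episode is a probability measure that depends measurably on a parameter of the
policy. -/
theorem trajLaw_param {H : ℕ} {π : X → ℕ → Kernel (S × B) A}
    (hπ : ∀ h < H, IsPolicyFamily fun x => π x h) (n : ℕ) (hn : n ≤ H) :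
    (Measurable fun x => M.trajLaw (π x) n) ∧
      ∀ x, IsProbabilityMeasure (M.trajLaw (π x) n) := by
  induction n with
  | zero => exact ⟨measurable_const, fun x => by rw [trajLaw]; infer_instance⟩
  | succ n ih =>
    obtain ⟨ih, ihp⟩ := ih (by omega)
    have hn' := hπ n (by omega)
    have := hn'.isMarkov
    have hN : ∀ p : X × (Fin n → S × A × B), IsProbabilityMeasure (M.nextLaw (π p.1 n) p.2) :=
      fun p => M.isProbabilityMeasure_nextLaw _ _
    have hm : Measurable fun p : X × (Fin n → S × A × B) => (M.nextLaw (π p.1 n) p.2).map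
        fun z => (Fin.snoc (α := fun _ => S × A × B) p.2 z : Fin (n + 1) → S × A × B) :=
      measurable_map_param (μ := fun p : X × (Fin n → S × A × B) => M.nextLaw (π p.1 n) p.2)
        (f := fun p z => (Fin.snoc (α := fun _ => S × A × B) p.2 z : Fin (n + 1) → S × A × B))
        (M.measurable_nextLaw_param hn' n)
        (measurable_snoc.comp (by fun_prop : Measurable
          fun q : (X × (Fin n → S × A × B)) × (S × A × B) => (q.1.2, q.2)))
    have hp : ∀ p : X × (Fin n → S × A × B), IsProbabilityMeasure ((M.nextLaw (π p.1 n) p.2).map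
        fun z => (Fin.snoc (α := fun _ => S × A × B) p.2 z : Fin (n + 1) → S × A × B)) := fun p =>
      Measure.isProbabilityMeasure_map (measurable_snoc_right p.2).aemeasurable
    simp_rw [trajLaw_succ]
    refine ⟨measurable_bind_param ih hm, fun x => ?_⟩
    have : ∀ τ, IsProbabilityMeasure ((M.nextLaw (π x n) τ).map
        fun z => (Fin.snoc (α := fun _ => S × A × B) τ z : Fin (n + 1) → S × A × B)) :=
      fun τ => hp (x, τ)
    exact isProbabilityMeasure_bind (hm.comp measurable_prodMk_left)

section Single

variable {H : ℕ} {π : ℕ → Kernel (S × B) A} (hπ : ∀ h < H, IsMarkovKernel (π h))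
include hπ

theorem isProbabilityMeasure_trajLaw {n : ℕ} (hn : n ≤ H) :
    IsProbabilityMeasure (M.trajLaw π n) := by
  refine (M.trajLaw_param (X := Unit) (π := fun _ => π) (fun h hh => ?_) n hn).2 ()
  have := hπ h hh
  exact IsPolicyFamily.const _

theorem lintegral_trajLaw_succ {n : ℕ} (hn : n < H) {g : (Fin (n + 1) → S × A × B) → ℝ≥0∞}
    (hg : Measurable g) : ∫⁻ τ, g τ ∂(M.trajLaw π (n + 1)) =
      ∫⁻ τ, ∫⁻ z, g (Fin.snoc (α := fun _ => S × A × B) τ z) ∂(M.nextLaw (π n) τ)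
        ∂(M.trajLaw π n) := by
  have := hπ n hn
  have hN := M.isProbabilityMeasure_nextLaw (π n) (h := n)
  rw [trajLaw_succ, Measure.lintegral_bind _ hg.aemeasurable]
  · refine lintegral_congr fun τ => ?_
    rw [lintegral_map hg (measurable_snoc_right τ)]
  · exact (measurable_map_param (μ := M.nextLaw (π n)) (f := fun τ z =>
      (Fin.snoc (α := fun _ => S × A × B) τ z : Fin (n + 1) → S × A × B))
      (M.measurable_nextLaw _ _) measurable_snoc).aemeasurable

/-- The first `k` steps of an episode of `n` steps form an episode of `k` steps. -/
theorem map_castLE_trajLaw {k n : ℕ} (hk : k ≤ n) (hn : n ≤ H) :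
    (M.trajLaw π n).map (fun τ (i : Fin k) => τ (Fin.castLE hk i)) = M.trajLaw π k := by
  induction n, hk using Nat.le_induction with
  | base => exact Measure.map_id
  | succ n hk ih =>
    rw [← ih (by omega)]
    ext E hE
    have h1 : Measurable fun (τ : Fin (n + 1) → S × A × B) (i : Fin k) =>
        τ (Fin.castLE (by omega) i) := by fun_prop
    have h2 : Measurable fun (τ : Fin n → S × A × B) (i : Fin k) =>
        τ (Fin.castLE (by omega) i) := by fun_prop
    rw [Measure.map_apply h1 hE, Measure.map_apply h2 hE, ← lintegral_indicator_one (h1 hE),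
      ← lintegral_indicator_one (h2 hE),
      M.lintegral_trajLaw_succ hπ (by omega) (measurable_one.indicator (h1 hE))]
    refine lintegral_congr fun τ => ?_
    have := hπ n (by omega)
    have := M.isProbabilityMeasure_nextLaw (π n) τ
    have h3 : ∀ z : S × A × B, (fun i : Fin k =>
        (Fin.snoc (α := fun _ => S × A × B) τ z : Fin (n + 1) → S × A × B)
          (Fin.castLE (by omega) i)) = fun i => τ (Fin.castLE (by omega) i) := fun z => funext fun i =>
      Fin.snoc_castSucc (α := fun _ => S × A × B) z τ (Fin.castLE (by omega) i)
    have h4 : ∀ z : S × A × B, Set.indicator ((fun (τ : Fin (n + 1) → S × A × B) (i : Fin k) =>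
        τ (Fin.castLE (by omega) i)) ⁻¹' E) (1 : (Fin (n + 1) → S × A × B) → ℝ≥0∞)
          (Fin.snoc (α := fun _ => S × A × B) τ z) =
        Set.indicator ((fun (τ : Fin n → S × A × B) (i : Fin k) =>
          τ (Fin.castLE (by omega) i)) ⁻¹' E) 1 τ := fun z => by
      classical
      rw [Set.indicator_apply, Set.indicator_apply, Set.mem_preimage, Set.mem_preimage, h3]
      rfl
    simp_rw [h4]
    simp

/-- Law of the state at step `h`. -/
noncomputable def _root_.QSE.Game.stateMarg (M : Game S A B) (π : ℕ → Kernel (S × B) A) (h : ℕ) :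
    Measure S :=
  (M.trajLaw π h).bind M.stateLaw

omit hπ in
theorem stateMarg_zero : M.stateMarg π 0 = M.ρ₀ := by
  rw [stateMarg, trajLaw, Measure.dirac_bind M.measurable_stateLaw]
  rfl

theorem isProbabilityMeasure_stateMarg {n : ℕ} (hn : n ≤ H) :
    IsProbabilityMeasure (M.stateMarg π n) := by
  have := M.isProbabilityMeasure_trajLaw hπ hn
  exact isProbabilityMeasure_bind M.measurable_stateLaw

omit hπ in
theorem stateMarg_succ (h : ℕ) : M.stateMarg π (h + 1) = (M.stepLaw π h).bind (M.P h) := by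
  have hm : Measurable fun τ : Fin (h + 1) → S × A × B => τ (Fin.last h) := by fun_prop
  rw [stateMarg, stepLaw, bind_map hm (M.P h).measurable]
  rfl

theorem stepLaw_eq {h : ℕ} (hh : h < H) :
    M.stepLaw π h = (M.stateMarg π h).bind (M.actLaw (M.r h) (π h)) := by
  have := hπ h hh
  have := M.isProbabilityMeasure_nextLaw (π h) (h := h)
  have hm : Measurable fun τ => (M.nextLaw (π h) τ).map
        fun z => (Fin.snoc (α := fun _ => S × A × B) τ z : Fin (h + 1) → S × A × B) :=
    measurable_map_param (M.measurable_nextLaw (π h) h) measurable_snoc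
  rw [stepLaw, trajLaw_succ, map_bind hm (measurable_pi_apply _), stateMarg,
    Measure.bind_bind M.measurable_stateLaw.aemeasurable
      (M.measurable_actLaw (M.isReward_r h)).aemeasurable]
  congr 1
  funext τ
  rw [Measure.map_map (measurable_pi_apply _) (measurable_snoc_right τ)]
  simp [Function.comp_def, nextLaw]

theorem isProbabilityMeasure_stepLaw {h : ℕ} (hh : h < H) :
    IsProbabilityMeasure (M.stepLaw π h) := by
  have := M.isProbabilityMeasure_trajLaw hπ (n := h + 1) hh
  exact Measure.isProbabilityMeasure_map (measurable_pi_apply _).aemeasurable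

theorem map_apply_trajLaw {h : ℕ} (hh : h < H) :
    (M.trajLaw π H).map (fun τ => τ ⟨h, hh⟩) = M.stepLaw π h := by
  rw [stepLaw, ← M.map_castLE_trajLaw hπ (k := h + 1) hh le_rfl,
    Measure.map_map (by fun_prop) (by fun_prop)]
  rfl

/-- Integrating out the transition: the law of a step together with the next state. -/
theorem lintegral_trajLaw_transition {h : ℕ} (hh : h + 1 < H) {g : S × A × B → S → ℝ≥0∞}
    (hg : Measurable fun p : (S × A × B) × S => g p.1 p.2) :
    ∫⁻ τ, g (τ ⟨h, by omega⟩) (τ ⟨h + 1, hh⟩).1 ∂(M.trajLaw π H) =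
      ∫⁻ z, ∫⁻ s, g z s ∂(M.P h z) ∂(M.stepLaw π h) := by
  have := hπ (h + 1) hh
  have hg2 : Measurable fun τ : Fin (h + 2) → S × A × B =>
      g (τ (Fin.castSucc (Fin.last h))) (τ (Fin.last (h + 1))).1 :=
    hg.comp (by fun_prop : Measurable fun τ : Fin (h + 2) → S × A × B =>
      (τ (Fin.castSucc (Fin.last h)), (τ (Fin.last (h + 1))).1))
  have e1 : ∫⁻ τ, g (τ ⟨h, by omega⟩) (τ ⟨h + 1, hh⟩).1 ∂(M.trajLaw π H) =
      ∫⁻ τ, g (τ (Fin.castSucc (Fin.last h))) (τ (Fin.last (h + 1))).1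
        ∂(M.trajLaw π (h + 2)) := by
    rw [← M.map_castLE_trajLaw hπ (k := h + 2) hh le_rfl, lintegral_map hg2 (by fun_prop)]
    rfl
  rw [e1, M.lintegral_trajLaw_succ hπ hh hg2, stepLaw,
    lintegral_map (f := fun z => ∫⁻ s, g z s ∂(M.P h z))
      (measurable_lintegral_param (M.P h).measurable hg) (measurable_pi_apply _)]
  refine lintegral_congr fun τ => ?_
  have hgz : Measurable (g (τ (Fin.last h))) := hg.comp measurable_prodMk_left
  simp only [Fin.snoc_castSucc, Fin.snoc_last]
  rw [nextLaw, Measure.lintegral_bind (M.measurable_actLaw (M.isReward_r _)).aemeasurable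
    (f := fun z => g (τ (Fin.last h)) z.1) (hgz.comp measurable_fst).aemeasurable]
  refine lintegral_congr fun s => ?_
  have := M.isProbabilityMeasure_quantalResponse (π := π (h + 1)) (M.isReward_r (h + 1)) s
  rw [M.lintegral_actLaw_response s (g := fun s _ => g (τ (Fin.last h)) s)
    (hgz.comp measurable_fst)]
  simp

theorem lintegral_stepLaw_response {h : ℕ} (hh : h < H) {g : S → B → ℝ≥0∞}
    (hg : Measurable fun p : S × B => g p.1 p.2) :
    ∫⁻ z, g z.1 z.2.2 ∂(M.stepLaw π h) =
      ∫⁻ s, ∫⁻ b, g s b ∂(M.quantalResponse (M.r h) (π h) s) ∂(M.stateMarg π h) := by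
  have := hπ h hh
  have hg' : Measurable fun z : S × A × B => g z.1 z.2.2 :=
    hg.comp (by fun_prop : Measurable fun z : S × A × B => (z.1, z.2.2))
  rw [M.stepLaw_eq hπ hh, Measure.lintegral_bind
    (M.measurable_actLaw (M.isReward_r _)).aemeasurable hg'.aemeasurable]
  exact lintegral_congr fun s => M.lintegral_actLaw_response s hg

theorem integral_stepLaw {h : ℕ} (hh : h < H) {f : S × A × B → ℝ} (hf : Measurable f)
    {c : ℝ} (hc : ∀ z, |f z| ≤ c) :
    ∫ z, f z ∂(M.stepLaw π h) = ∫ s, M.evalOp (M.r h) (π h) f s ∂(M.stateMarg π h) := by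
  have := hπ h hh
  have := M.isProbabilityMeasure_stateMarg hπ hh.le
  have := M.isProbabilityMeasure_actLaw (π := π h) (M.isReward_r h)
  rw [M.stepLaw_eq hπ hh, integral_bind (M.measurable_actLaw (M.isReward_r h)) hf hc]
  exact integral_congr_ae (.of_forall fun s => M.integral_actLaw (M.isReward_r h) s hf hc)

theorem J_eq_sum : M.J H π = ∑ h ∈ Finset.range H, ∫ z, M.u h z ∂(M.stepLaw π h) := by
  have := M.isProbabilityMeasure_trajLaw hπ le_rfl
  have hu : ∀ (h : ℕ) (z : S × A × B), |M.u h z| ≤ 1 := fun h z =>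
    abs_le.2 ⟨by linarith [(M.u_mem h z).1], (M.u_mem h z).2⟩
  rw [J, integral_finsetSum, ← Fin.sum_univ_eq_sum_range
    (fun h => ∫ z, M.u h z ∂(M.stepLaw π h)) H]
  · refine Finset.sum_congr rfl fun h _ => ?_
    rw [← M.map_apply_trajLaw hπ h.2, integral_map (measurable_pi_apply _).aemeasurable
      (M.measurable_u h).aestronglyMeasurable]
  · intro h _
    exact integrable_of_bounded ((M.measurable_u h).comp (measurable_pi_apply h)) fun _ => hu _ _

theorem J_mem_Icc : M.J H π ∈ Set.Icc (0 : ℝ) H := by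
  have := M.isProbabilityMeasure_trajLaw hπ le_rfl
  refine integral_mem_Icc ?_ fun τ => ⟨Finset.sum_nonneg fun h _ => (M.u_mem h _).1, ?_⟩
  · exact Finset.measurable_sum _ fun h _ => (M.measurable_u h).comp (measurable_pi_apply h)
  · calc ∑ h : Fin H, M.u h (τ h) ≤ ∑ _h : Fin H, (1 : ℝ) :=
        Finset.sum_le_sum fun h _ => (M.u_mem h _).2
      _ = H := by simp

/-- Telescoping of the Bellman errors of value functions `U`, `V` along the steps of an episode. -/
theorem integral_sub_J_eq {U : ℕ → S × A × B → ℝ} {V : ℕ → S → ℝ} {c : ℝ}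
    (hU : ∀ h < H, Measurable (U h)) (hUc : ∀ h < H, ∀ z, |U h z| ≤ c)
    (hV : ∀ h ≤ H, Measurable (V h)) (hVc : ∀ h ≤ H, ∀ s, |V h s| ≤ c) (hVH : V H = 0) :
    ∫ s, V 0 s ∂M.ρ₀ - M.J H π =
      ∑ h ∈ Finset.range H,
          ∫ z, (U h z - (M.u h z + ∫ s, V (h + 1) s ∂(M.P h z))) ∂(M.stepLaw π h) +
        ∑ h ∈ Finset.range H,
          ∫ s, (V h s - M.evalOp (M.r h) (π h) (U h) s) ∂(M.stateMarg π h) := by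
  have key : ∀ h ∈ Finset.range H,
      ∫ z, (U h z - (M.u h z + ∫ s, V (h + 1) s ∂(M.P h z))) ∂(M.stepLaw π h) +
        ∫ s, (V h s - M.evalOp (M.r h) (π h) (U h) s) ∂(M.stateMarg π h) =
      (∫ s, V h s ∂(M.stateMarg π h) - ∫ s, V (h + 1) s ∂(M.stateMarg π (h + 1))) -
        ∫ z, M.u h z ∂(M.stepLaw π h) := by
    intro h hh
    have hh := Finset.mem_range.1 hh
    have := hπ h hh
    have := M.isProbabilityMeasure_stepLaw hπ hh
    have := M.isProbabilityMeasure_stateMarg hπ hh.le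
    have hPV : Measurable fun z => ∫ s, V (h + 1) s ∂(M.P h z) :=
      measurable_integral_param (M.P h).measurable ((hV (h + 1) hh).comp measurable_snd)
    have i1 : Integrable (U h) (M.stepLaw π h) := integrable_of_bounded (hU h hh) (hUc h hh)
    have i2 : Integrable (M.u h) (M.stepLaw π h) := integrable_of_bounded (c := 1)
      (M.measurable_u h) fun z =>
        abs_le.2 ⟨by linarith [(M.u_mem h z).1], (M.u_mem h z).2⟩
    have i3 : Integrable (fun z => ∫ s, V (h + 1) s ∂(M.P h z)) (M.stepLaw π h) :=
      integrable_of_bounded hPV fun z => abs_integral_le_of_bounded (hVc (h + 1) hh)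
    have i4 : Integrable (V h) (M.stateMarg π h) :=
      integrable_of_bounded (hV h hh.le) (hVc h hh.le)
    have i5 : Integrable (M.evalOp (M.r h) (π h) (U h)) (M.stateMarg π h) :=
      integrable_of_bounded (M.measurable_evalOp (M.isReward_r h) (hU h hh) (hUc h hh))
        fun s => M.abs_evalOp_le (M.isReward_r h) s (hUc h hh)
    have e1 : ∫ z, (U h z - (M.u h z + ∫ s, V (h + 1) s ∂(M.P h z))) ∂(M.stepLaw π h) =
        ∫ z, U h z ∂(M.stepLaw π h) - ∫ z, (M.u h z + ∫ s, V (h + 1) s ∂(M.P h z))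
          ∂(M.stepLaw π h) := integral_sub i1 (i2.add i3)
    rw [e1, integral_add i2 i3, integral_sub i4 i5,
      ← M.integral_stepLaw hπ hh (hU h hh) (hUc h hh), M.stateMarg_succ,
      integral_bind (M.P h).measurable (hV (h + 1) hh) (hVc (h + 1) hh)]
    ring
  rw [← Finset.sum_add_distrib, Finset.sum_congr rfl key, Finset.sum_sub_distrib,
    Finset.sum_range_sub', M.J_eq_sum hπ, M.stateMarg_zero, hVH]
  simp

end Single

/-- The law of a step depends measurably on a parameter of the policy. -/
theorem measurable_stepLaw_param {H : ℕ} {π : X → ℕ → Kernel (S × B) A}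
    (hπ : ∀ h < H, IsPolicyFamily fun x => π x h) {h : ℕ} (hh : h < H) :
    Measurable fun x => M.stepLaw (π x) h :=
  (Measure.measurable_map _ (measurable_pi_apply _)).comp (M.trajLaw_param hπ (h + 1) hh).1

end Game

end Laws

/-! ### Exponential moment bounds -/

section Moments

variable {Ω : Type*} [MeasurableSpace Ω] {μ : Measure Ω}

theorem exp_neg_le_one_sub_half {x : ℝ} (h0 : 0 ≤ x) (h1 : x ≤ 1) : Real.exp (-x) ≤ 1 - x / 2 := by
  have hx : 1 + x ≤ Real.exp x := by linarith [Real.add_one_le_exp x]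
  rw [Real.exp_neg]
  refine (inv_anti₀ (by linarith) hx).trans ?_
  rw [inv_le_iff_one_le_mul₀ (by linarith)]
  nlinarith

theorem exp_le_one_add_two_mul {x : ℝ} (h0 : 0 ≤ x) (h1 : x ≤ 1) : Real.exp x ≤ 1 + 2 * x := by
  have h := (abs_le.1 (Real.abs_exp_sub_one_sub_id_le (abs_le.2 ⟨by linarith, h1⟩))).2
  nlinarith

theorem sq_div_le_one_sub_exp_sq {x y : ℝ} (hy : 0 ≤ y) (hx : -y ≤ x) :
    (x / (1 + y)) ^ 2 ≤ (1 - Real.exp x) ^ 2 := by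
  rcases le_total 0 x with h | h
  · have h1 : x / (1 + y) ≤ x := div_le_self h (by linarith)
    have h2 : 0 ≤ x / (1 + y) := by positivity
    nlinarith [Real.add_one_le_exp x]
  · -- `exp (-t) ≤ 1 / (1 + t)` for `t = -x ≤ y`
    have h1 : Real.exp x ≤ 1 / (1 - x) := by
      rw [le_div_iff₀ (by linarith)]
      have := Real.add_one_le_exp (-x)
      have h3 : Real.exp x * Real.exp (-x) = 1 := by rw [← Real.exp_add]; simp
      nlinarith [Real.exp_pos x]
    have h2 : -x / (1 + y) ≤ 1 - 1 / (1 - x) := by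
      have h0 : 1 - x ≠ 0 := by linarith
      have : 1 - 1 / (1 - x) = -x / (1 - x) := by field_simp; ring
      rw [this]
      gcongr
      · linarith
      · linarith
      · linarith
    have h3 : 0 ≤ -x / (1 + y) := div_nonneg (by linarith) (by linarith)
    have h4 : (x / (1 + y)) ^ 2 = (-x / (1 + y)) ^ 2 := by rw [neg_div, neg_sq]
    rw [h4]
    nlinarith

theorem exp_sub_one_sub_id_mem (x : ℝ) {c : ℝ} (hx : |x| ≤ c) :
    Real.exp x - 1 - x ∈ Set.Icc 0 (x ^ 2 * Real.exp c) := by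
  refine ⟨by linarith [Real.add_one_le_exp x], ?_⟩
  have hc : 1 ≤ Real.exp c := Real.one_le_exp ((abs_nonneg x).trans hx)
  have h1 := Real.add_one_le_exp (-x)
  have h2 : Real.exp x * Real.exp (-x) = 1 := by rw [← Real.exp_add]; simp
  have h3 : Real.exp x ≤ Real.exp c := Real.exp_le_exp.2 ((le_abs_self x).trans hx)
  have h4 : Real.exp x - 1 ≤ x * Real.exp x := by nlinarith [Real.exp_pos x]
  rcases le_total 0 x with h | h
  · nlinarith [mul_nonneg h h]
  · nlinarith [Real.add_one_le_exp x, sq_nonneg x]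

theorem integrable_exp_of_bounded [IsFiniteMeasure μ] {X : Ω → ℝ} (hX : Measurable X) {c : ℝ}
    (hc : ∀ ω, |X ω| ≤ c) : Integrable (fun ω => Real.exp (X ω)) μ :=
  integrable_of_bounded (c := Real.exp c) hX.exp fun ω => by
    rw [abs_of_pos (Real.exp_pos _)]
    exact Real.exp_le_exp.2 ((le_abs_self _).trans (hc ω))

variable [IsProbabilityMeasure μ]

theorem abs_le_of_mem_Icc_zero {x c : ℝ} (h : x ∈ Set.Icc 0 c) : |x| ≤ c :=
  abs_le.2 ⟨by linarith [h.1, h.2], h.2⟩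

theorem integral_exp_neg_le {X : Ω → ℝ} (hX : Measurable X) (h : ∀ ω, X ω ∈ Set.Icc (0 : ℝ) 1) :
    ∫ ω, Real.exp (-X ω) ∂μ ≤ Real.exp (-(∫ ω, X ω ∂μ) / 2) := by
  have hi : Integrable X μ := integrable_of_bounded hX fun ω => abs_le_of_mem_Icc_zero (h ω)
  calc ∫ ω, Real.exp (-X ω) ∂μ ≤ ∫ ω, (1 - X ω / 2) ∂μ :=
        integral_mono (integrable_exp_of_bounded (X := fun ω => -X ω) hX.neg fun ω => by
          rw [abs_neg]; exact abs_le_of_mem_Icc_zero (h ω))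
          ((integrable_const _).sub (hi.div_const _))
          fun ω => exp_neg_le_one_sub_half (h ω).1 (h ω).2
    _ = 1 - (∫ ω, X ω ∂μ) / 2 := by
        rw [integral_sub (integrable_const _) (hi.div_const _), integral_div]; simp
    _ ≤ _ := by linarith [Real.add_one_le_exp (-(∫ ω, X ω ∂μ) / 2)]

theorem integral_exp_le {X : Ω → ℝ} (hX : Measurable X) (h : ∀ ω, X ω ∈ Set.Icc (0 : ℝ) 1) :
    ∫ ω, Real.exp (X ω) ∂μ ≤ Real.exp (2 * ∫ ω, X ω ∂μ) := by
  have hi : Integrable X μ := integrable_of_bounded hX fun ω => abs_le_of_mem_Icc_zero (h ω)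
  calc ∫ ω, Real.exp (X ω) ∂μ ≤ ∫ ω, (1 + 2 * X ω) ∂μ :=
        integral_mono (integrable_exp_of_bounded hX fun ω => abs_le_of_mem_Icc_zero (h ω))
          ((integrable_const _).add (hi.const_mul _))
          fun ω => exp_le_one_add_two_mul (h ω).1 (h ω).2
    _ = 1 + 2 * ∫ ω, X ω ∂μ := by
        rw [integral_add (integrable_const _) (hi.const_mul _), integral_const_mul]; simp
    _ ≤ _ := by linarith [Real.add_one_le_exp (2 * ∫ ω, X ω ∂μ)]

/-- One step of a least squares comparison: with target `y = w + V`, of mean `m`, the exponential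
moment of the difference of the squared losses of `m` and of any other prediction `v` is controlled
by the excess risk `(v - m)²`. -/
theorem integral_exp_sq_loss_le {V : Ω → ℝ} (hV : Measurable V) {c : ℝ} (hc : 0 < c)
    (hVc : ∀ ω, |V ω| ≤ c) (v w : ℝ) :
    ∫ ω, Real.exp (-(((v - w - V ω) ^ 2 - ((w + ∫ ω, V ω ∂μ) - w - V ω) ^ 2) / (8 * c ^ 2))) ∂μ ≤
      Real.exp (-(v - (w + ∫ ω, V ω ∂μ)) ^ 2 / (16 * c ^ 2)) := by
  set m := ∫ ω, V ω ∂μ with hm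
  set D := v - (w + m) with hD
  have hs := (hasSubgaussianMGF_of_mem_Icc (μ := μ) hV.aemeasurable
    (.of_forall fun ω => ⟨(abs_le.1 (hVc ω)).1, (abs_le.1 (hVc ω)).2⟩)).mgf_le (D / (4 * c ^ 2))
  have hn : ((‖c - -c‖₊ / 2) ^ 2 : NNReal) = (⟨c ^ 2, by positivity⟩ : NNReal) := by
    apply NNReal.eq
    push_cast
    rw [Real.norm_eq_abs, abs_of_pos (by linarith)]
    change ((c - -c) / 2) ^ 2 = c ^ 2
    ring
  rw [hn] at hs
  change mgf _ μ _ ≤ Real.exp (c ^ 2 * _ / 2) at hs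
  have e : ∀ ω, Real.exp (-(((v - w - V ω) ^ 2 - ((w + m) - w - V ω) ^ 2) / (8 * c ^ 2))) =
      Real.exp (-(D ^ 2) / (8 * c ^ 2)) * Real.exp (D / (4 * c ^ 2) * (V ω - m)) := fun ω => by
    rw [← Real.exp_add]
    congr 1
    rw [hD]
    field_simp
    ring
  simp_rw [e]
  rw [integral_const_mul]
  calc _ ≤ Real.exp (-(D ^ 2) / (8 * c ^ 2)) * Real.exp (c ^ 2 * (D / (4 * c ^ 2)) ^ 2 / 2) :=
        mul_le_mul_of_nonneg_left hs (Real.exp_pos _).le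
    _ ≤ _ := by
        rw [← Real.exp_add]
        refine Real.exp_le_exp.2 ?_
        have : -(D ^ 2) / (8 * c ^ 2) + c ^ 2 * (D / (4 * c ^ 2)) ^ 2 / 2 =
            -(D ^ 2) / (16 * c ^ 2) - D ^ 2 / (32 * c ^ 2) := by field_simp; ring
        rw [this]
        have : 0 ≤ D ^ 2 / (32 * c ^ 2) := by positivity
        linarith

end Moments

/-! ### Exponential tilts of a probability measure -/

section Tilt

variable {Ω : Type*} [MeasurableSpace Ω] {ν : Measure Ω} [IsProbabilityMeasure ν]
  {f Y : Ω → ℝ} {η K : ℝ}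

theorem abs_sub_integral_le {f : Ω → ℝ} (hfc : ∀ ω, |f ω| ≤ 1) (ω : Ω) :
    |f ω - ∫ ω, f ω ∂ν| ≤ 2 := by
  have h1 := abs_integral_le_of_bounded (μ := ν) hfc
  have h2 := abs_sub (f ω) (∫ ω, f ω ∂ν)
  linarith [hfc ω]

variable (hη : 0 < η) (hf : Measurable f) (hfc : ∀ ω, |f ω| ≤ 1)
  (hY : ∀ ω, Y ω = η * f ω - K) (hY1 : ∫ ω, Real.exp (Y ω) ∂ν = 1)
include hη hf hfc hY hY1

theorem abs_log_normalizer_le : |K| ≤ η := by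
  have hm : Measurable fun ω => η * f ω := hf.const_mul η
  have hc : ∀ ω, |η * f ω| ≤ η := fun ω => by
    rw [abs_mul, abs_of_pos hη]; nlinarith [hfc ω]
  have h1 : ∫ ω, Real.exp (η * f ω) ∂ν = Real.exp K := by
    have e : ∀ ω, Real.exp (Y ω) = Real.exp (η * f ω) * Real.exp (-K) := fun ω => by
      rw [hY, sub_eq_add_neg, Real.exp_add]
    simp_rw [e] at hY1
    rw [integral_mul_const, Real.exp_neg] at hY1
    field_simp at hY1
    exact hY1
  have h2 : ∀ ω, Real.exp (η * f ω) ∈ Set.Icc (Real.exp (-η)) (Real.exp η) := fun ω =>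
    ⟨Real.exp_le_exp.2 (abs_le.1 (hc ω)).1, Real.exp_le_exp.2 (abs_le.1 (hc ω)).2⟩
  have h3 := integral_mem_Icc (μ := ν) hm.exp h2
  rw [h1] at h3
  exact abs_le.2 ⟨Real.exp_le_exp.1 h3.1, Real.exp_le_exp.1 h3.2⟩

theorem abs_log_density_le (ω : Ω) : |Y ω| ≤ 2 * η := by
  have h1 := abs_log_normalizer_le hη hf hfc hY hY1
  rw [hY]
  have h2 := abs_sub (η * f ω) K
  rw [abs_mul, abs_of_pos hη] at h2
  nlinarith [hfc ω]

/-- The squared Hellinger distance to an exponential tilt dominates the variance of the tilting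
function. -/
theorem variance_le_hellinger_tilt :
    η ^ 2 / (8 * (1 + η) ^ 2) * ∫ ω, (f ω - ∫ ω, f ω ∂ν) ^ 2 ∂ν ≤
      1 - ∫ ω, Real.exp (Y ω / 2) ∂ν := by
  set m := ∫ ω, f ω ∂ν with hm
  have hYm : Measurable Y := by
    rw [funext hY]; exact (hf.const_mul η).sub_const K
  have hYc := abs_log_density_le hη hf hfc hY hY1
  have i1 : Integrable (fun ω => Real.exp (Y ω)) ν := integrable_exp_of_bounded hYm hYc
  have i2 : Integrable (fun ω => Real.exp (Y ω / 2)) ν :=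
    integrable_exp_of_bounded (c := η) (hYm.div_const 2) fun ω => by
      rw [abs_div, abs_two]; linarith [hYc ω]
  have hΔ : Measurable fun ω => f ω - m := hf.sub_const m
  have hΔc : ∀ ω, |f ω - m| ≤ 2 := abs_sub_integral_le hfc
  have i3 : Integrable (fun ω => f ω - m) ν := integrable_of_bounded hΔ hΔc
  have i4 : Integrable (fun ω => (f ω - m) ^ 2) ν :=
    integrable_of_bounded (c := 4) (hΔ.pow_const 2) fun ω => by
      rw [abs_pow]; nlinarith [hΔc ω, abs_nonneg (f ω - m)]
  have h0 : ∫ ω, (f ω - m) ∂ν = 0 := by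
    rw [integral_sub (integrable_of_bounded hf hfc) (integrable_const _)]; simp [hm]
  have e1 : ∫ ω, (1 - Real.exp (Y ω / 2)) ^ 2 ∂ν = 2 * (1 - ∫ ω, Real.exp (Y ω / 2) ∂ν) := by
    have e : ∀ ω, (1 - Real.exp (Y ω / 2)) ^ 2 =
        1 - 2 * Real.exp (Y ω / 2) + Real.exp (Y ω) := fun ω => by
      have : Real.exp (Y ω) = Real.exp (Y ω / 2) ^ 2 := by
        rw [sq, ← Real.exp_add]; ring_nf
      rw [this]; ring
    have i6 : Integrable (fun ω => 1 - 2 * Real.exp (Y ω / 2)) ν :=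
      (integrable_const _).sub (i2.const_mul 2)
    simp_rw [e]
    rw [integral_add i6 i1, integral_sub (integrable_const _) (i2.const_mul 2),
      integral_const_mul, hY1]
    simp; ring
  have i5 : Integrable (fun ω => (1 - Real.exp (Y ω / 2)) ^ 2) ν := by
    refine integrable_of_bounded (c := (1 + Real.exp η) ^ 2)
      ((measurable_const.sub (hYm.div_const 2).exp).pow_const 2) fun ω => ?_
    rw [abs_pow]
    have h1 := abs_sub 1 (Real.exp (Y ω / 2))
    rw [abs_one, abs_of_pos (Real.exp_pos _)] at h1
    have h2 : Real.exp (Y ω / 2) ≤ Real.exp η :=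
      Real.exp_le_exp.2 (by linarith [(abs_le.1 (hYc ω)).2])
    exact pow_le_pow_left₀ (abs_nonneg _) (by linarith) 2
  -- the mean of `Y` only adds to its second moment
  have h2 : ∀ ω, η ^ 2 / (4 * (1 + η) ^ 2) * (f ω - m) ^ 2 +
      η * (η * m - K) / (2 * (1 + η) ^ 2) * (f ω - m) ≤ (1 - Real.exp (Y ω / 2)) ^ 2 := fun ω => by
    refine le_trans ?_ (sq_div_le_one_sub_exp_sq (x := Y ω / 2) hη.le
      (by linarith [(abs_le.1 (hYc ω)).1]))
    have : (Y ω / 2 / (1 + η)) ^ 2 = η ^ 2 / (4 * (1 + η) ^ 2) * (f ω - m) ^ 2 +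
        η * (η * m - K) / (2 * (1 + η) ^ 2) * (f ω - m) +
        (η * m - K) ^ 2 / (4 * (1 + η) ^ 2) := by
      rw [hY]; field_simp; ring
    rw [this]
    have : 0 ≤ (η * m - K) ^ 2 / (4 * (1 + η) ^ 2) := by positivity
    linarith
  have h3 := integral_mono ((i4.const_mul _).add (i3.const_mul _)) i5 h2
  rw [integral_add' (i4.const_mul _) (i3.const_mul _), integral_const_mul, integral_const_mul, h0,
    e1] at h3
  have h4 : η ^ 2 / (4 * (1 + η) ^ 2) = 2 * (η ^ 2 / (8 * (1 + η) ^ 2)) := by field_simp; norm_num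
  rw [h4] at h3
  linarith

/-- Exponential moment of a log-likelihood ratio together with the squared centred tilting function:
the average of two exponential supermartingale increments. -/
theorem integral_exp_log_likelihood_le :
    ∫ ω, Real.exp (Y ω / 4 + η ^ 2 / (32 * (1 + η) ^ 2) * (f ω - ∫ ω, f ω ∂ν) ^ 2) ∂ν ≤ 1 := by
  have hvar := variance_le_hellinger_tilt hη hf hfc hY hY1
  set m := ∫ ω, f ω ∂ν with hm
  set D := 1 - ∫ ω, Real.exp (Y ω / 2) ∂ν with hD
  set k := η ^ 2 / (16 * (1 + η) ^ 2) with hk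
  set v := ∫ ω, (f ω - m) ^ 2 ∂ν with hv
  have hk0 : 0 ≤ k := by positivity
  have hk1 : k ≤ 1 / 4 := by
    rw [hk, div_le_div_iff₀ (by positivity) (by norm_num)]; nlinarith
  have hYm : Measurable Y := by
    rw [funext hY]; exact (hf.const_mul η).sub_const K
  have hYc := abs_log_density_le hη hf hfc hY hY1
  have hΔ : Measurable fun ω => f ω - m := hf.sub_const m
  have hΔc : ∀ ω, |f ω - m| ≤ 2 := abs_sub_integral_le hfc
  have hΔ2 : ∀ ω, (f ω - m) ^ 2 ≤ 4 := fun ω => by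
    rw [← sq_abs]; nlinarith [hΔc ω, abs_nonneg (f ω - m)]
  have hkΔ : ∀ ω, k * (f ω - m) ^ 2 ∈ Set.Icc (0 : ℝ) 1 := fun ω =>
    ⟨by positivity, by nlinarith [hΔ2 ω, sq_nonneg (f ω - m)]⟩
  have hkm : Measurable fun ω => k * (f ω - m) ^ 2 := (hΔ.pow_const 2).const_mul k
  have i2 : Integrable (fun ω => Real.exp (Y ω / 2)) ν :=
    integrable_exp_of_bounded (c := η) (hYm.div_const 2) fun ω => by
      rw [abs_div, abs_two]; linarith [hYc ω]
  have i3 : Integrable (fun ω => Real.exp (k * (f ω - m) ^ 2)) ν :=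
    integrable_exp_of_bounded hkm fun ω => abs_le_of_mem_Icc_zero (hkΔ ω)
  have h1 : Real.exp D * ∫ ω, Real.exp (Y ω / 2) ∂ν ≤ 1 := by
    have h : ∫ ω, Real.exp (Y ω / 2) ∂ν = 1 - D := by rw [hD]; ring
    rw [h]
    calc Real.exp D * (1 - D) ≤ Real.exp D * Real.exp (-D) :=
          mul_le_mul_of_nonneg_left (by linarith [Real.add_one_le_exp (-D)]) (Real.exp_pos _).le
      _ = 1 := by rw [← Real.exp_add]; simp
  have h2 : Real.exp (-D) * ∫ ω, Real.exp (k * (f ω - m) ^ 2) ∂ν ≤ 1 := by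
    have h3 : 2 * ∫ ω, k * (f ω - m) ^ 2 ∂ν ≤ D := by
      rw [integral_const_mul]
      refine le_trans (le_of_eq ?_) hvar
      rw [hk, ← hv]; field_simp; ring
    calc _ ≤ Real.exp (-D) * Real.exp D := by
          refine mul_le_mul_of_nonneg_left ((integral_exp_le hkm hkΔ).trans
            (Real.exp_le_exp.2 h3)) (Real.exp_pos _).le
      _ = 1 := by rw [← Real.exp_add]; simp
  have h3 : ∀ ω, Real.exp (Y ω / 4 + η ^ 2 / (32 * (1 + η) ^ 2) * (f ω - m) ^ 2) ≤
      (Real.exp D / 2) * Real.exp (Y ω / 2) +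
        (Real.exp (-D) / 2) * Real.exp (k * (f ω - m) ^ 2) := fun ω => by
    set a := (D + Y ω / 2) / 2 with ha
    set b := (-D + k * (f ω - m) ^ 2) / 2 with hb
    have e1 : Real.exp D / 2 * Real.exp (Y ω / 2) = Real.exp a ^ 2 / 2 := by
      rw [sq, ← Real.exp_add, ha, add_halves, Real.exp_add]; ring
    have e2 : Real.exp (-D) / 2 * Real.exp (k * (f ω - m) ^ 2) = Real.exp b ^ 2 / 2 := by
      rw [sq (Real.exp b), ← Real.exp_add, hb, add_halves, Real.exp_add]; ring
    have e3 : Real.exp (Y ω / 4 + η ^ 2 / (32 * (1 + η) ^ 2) * (f ω - m) ^ 2) =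
        Real.exp a * Real.exp b := by
      rw [← Real.exp_add, ha, hb, hk]
      congr 1
      field_simp
      ring
    rw [e1, e2, e3]
    nlinarith [sq_nonneg (Real.exp a - Real.exp b)]
  have h4 := integral_mono_of_nonneg (μ := ν) (.of_forall fun ω => (Real.exp_pos _).le)
    ((i2.const_mul (Real.exp D / 2)).add (i3.const_mul (Real.exp (-D) / 2))) (.of_forall h3)
  rw [integral_add' (i2.const_mul _) (i3.const_mul _), integral_const_mul, integral_const_mul] at h4
  linarith

/-- Total variation of an exponential tilt: first order in the centred tilting function, up to a
second order remainder. -/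
theorem integral_abs_tilt_sub_one_le :
    ∫ ω, |Real.exp (Y ω) - 1| ∂ν ≤ η * ∫ ω, |f ω - ∫ ω, f ω ∂ν| ∂ν +
      2 * η ^ 2 * Real.exp (2 * η) * ∫ ω, (f ω - ∫ ω, f ω ∂ν) ^ 2 ∂ν := by
  set m := ∫ ω, f ω ∂ν with hm
  set L := K - η * m with hL
  have hYm : Measurable Y := by
    rw [funext hY]; exact (hf.const_mul η).sub_const K
  have hYc := abs_log_density_le hη hf hfc hY hY1
  have hΔ : Measurable fun ω => f ω - m := hf.sub_const m
  have hΔc : ∀ ω, |f ω - m| ≤ 2 := abs_sub_integral_le hfc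
  have hηΔ : ∀ ω, |η * (f ω - m)| ≤ 2 * η := fun ω => by
    rw [abs_mul, abs_of_pos hη]; nlinarith [hΔc ω]
  have i1 : Integrable (fun ω => Real.exp (Y ω)) ν := integrable_exp_of_bounded hYm hYc
  have i2 : Integrable (fun ω => Real.exp (η * (f ω - m))) ν :=
    integrable_exp_of_bounded (hΔ.const_mul η) hηΔ
  have i3 : Integrable (fun ω => f ω - m) ν := integrable_of_bounded hΔ hΔc
  have i4 : Integrable (fun ω => (f ω - m) ^ 2) ν :=
    integrable_of_bounded (c := 4) (hΔ.pow_const 2) fun ω => by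
      rw [abs_pow]; nlinarith [hΔc ω, abs_nonneg (f ω - m)]
  have h0 : ∫ ω, (f ω - m) ∂ν = 0 := by
    rw [integral_sub (integrable_of_bounded hf hfc) (integrable_const _)]; simp [hm]
  have hYL : ∀ ω, Y ω = η * (f ω - m) - L := fun ω => by rw [hY, hL]; ring
  have hrem : ∀ ω, Real.exp (η * (f ω - m)) - 1 - η * (f ω - m) ∈
      Set.Icc 0 (η ^ 2 * Real.exp (2 * η) * (f ω - m) ^ 2) := fun ω => by
    have := exp_sub_one_sub_id_mem _ (hηΔ ω)
    refine ⟨this.1, this.2.trans (le_of_eq (by ring))⟩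
  have e1 : ∫ ω, (Real.exp (η * (f ω - m)) - 1 - η * (f ω - m)) ∂ν =
      ∫ ω, Real.exp (η * (f ω - m)) ∂ν - 1 := by
    have i6 : Integrable (fun ω => Real.exp (η * (f ω - m)) - 1) ν :=
      i2.sub (integrable_const _)
    rw [integral_sub i6 (i3.const_mul η),
      integral_sub i2 (integrable_const _), integral_const_mul, h0]
    simp
  have i5 : Integrable (fun ω => Real.exp (η * (f ω - m)) - 1 - η * (f ω - m)) ν :=
    (i2.sub (integrable_const _)).sub (i3.const_mul η)
  have h1 : 1 ≤ ∫ ω, Real.exp (η * (f ω - m)) ∂ν := by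
    have := integral_nonneg (μ := ν) (f := fun ω => Real.exp (η * (f ω - m)) - 1 - η * (f ω - m))
      fun ω => (hrem ω).1
    rw [e1] at this
    linarith
  have h2 : ∫ ω, Real.exp (η * (f ω - m)) ∂ν - 1 ≤
      η ^ 2 * Real.exp (2 * η) * ∫ ω, (f ω - m) ^ 2 ∂ν := by
    rw [← e1, ← integral_const_mul]
    exact integral_mono i5 (i4.const_mul _) fun ω => (hrem ω).2
  -- by Jensen's inequality the normaliser of the centred tilt is at least one
  have hL0 : 0 ≤ L := by
    have : ∫ ω, Real.exp (η * (f ω - m)) ∂ν = Real.exp L := by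
      have e : ∀ ω, Real.exp (η * (f ω - m)) = Real.exp (Y ω) * Real.exp L := fun ω => by
        rw [← Real.exp_add, hYL]; ring_nf
      simp_rw [e]
      rw [integral_mul_const, hY1, one_mul]
    rw [this] at h1
    exact Real.one_le_exp_iff.1 h1
  have h3 : ∀ ω, |Real.exp (Y ω) - 1| ≤ (Real.exp (η * (f ω - m)) - Real.exp (Y ω)) +
      (η * |f ω - m| + η ^ 2 * Real.exp (2 * η) * (f ω - m) ^ 2) := fun ω => by
    have a1 : Real.exp (Y ω) ≤ Real.exp (η * (f ω - m)) :=
      Real.exp_le_exp.2 (by rw [hYL]; linarith)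
    have a2 : |Real.exp (η * (f ω - m)) - 1| ≤
        η * |f ω - m| + η ^ 2 * Real.exp (2 * η) * (f ω - m) ^ 2 := by
      have := abs_add_le (Real.exp (η * (f ω - m)) - 1 - η * (f ω - m)) (η * (f ω - m))
      rw [sub_add_cancel, abs_of_nonneg (hrem ω).1, abs_mul, abs_of_pos hη] at this
      linarith [(hrem ω).2]
    have a3 := abs_le.1 a2
    rw [abs_le]
    constructor <;> linarith
  calc ∫ ω, |Real.exp (Y ω) - 1| ∂ν ≤ ∫ ω, ((Real.exp (η * (f ω - m)) - Real.exp (Y ω)) +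
      (η * |f ω - m| + η ^ 2 * Real.exp (2 * η) * (f ω - m) ^ 2)) ∂ν :=
        integral_mono (i1.sub (integrable_const _)).abs
          ((i2.sub i1).add ((i3.abs.const_mul η).add (i4.const_mul _))) h3
    _ = (∫ ω, Real.exp (η * (f ω - m)) ∂ν - 1) + (η * ∫ ω, |f ω - m| ∂ν +
        η ^ 2 * Real.exp (2 * η) * ∫ ω, (f ω - m) ^ 2 ∂ν) := by
        have i6 : Integrable (fun ω => Real.exp (η * (f ω - m)) - Real.exp (Y ω)) ν := i2.sub i1
        have i7 : Integrable (fun ω => η * |f ω - m| +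
            η ^ 2 * Real.exp (2 * η) * (f ω - m) ^ 2) ν :=
          (i3.abs.const_mul η).add (i4.const_mul _)
        rw [integral_add i6 i7, integral_sub i2 i1, integral_add (i3.abs.const_mul η) (i4.const_mul _),
          integral_const_mul, integral_const_mul, hY1]
    _ ≤ _ := by linarith

end Tilt

/-! ### The eluder dimension argument -/

section Eluder

/-- Elements of `range T` with `ε < |m t t|` can be distributed over `⌈b / ε²⌉` classes so that,
within its class, each of them is `ε`-independent of its predecessors: an element that fits in no
class would have second moment above `b` over its predecessors. -/
theorem exists_independent_coloring {T : ℕ} {m : ℕ → ℕ → ℝ} {ε b : ℝ} (hε : 0 < ε) (hb : 0 < b)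
    (hsum : ∀ t < T, ∑ i ∈ Finset.range t, m t i ^ 2 ≤ b) (n : ℕ) (hn : n ≤ T) :
    ∃ c : ℕ → Fin ⌈b / ε ^ 2⌉₊, ∀ t < n, ε < |m t t| →
      ∑ i ∈ (Finset.range t).filter (fun i => ε < |m i i| ∧ c i = c t), m t i ^ 2 ≤ ε ^ 2 := by
  classical
  have hK : 0 < ⌈b / ε ^ 2⌉₊ := Nat.ceil_pos.2 (by positivity)
  induction n with
  | zero => exact ⟨fun _ => ⟨0, hK⟩, by simp⟩
  | succ n ih =>
    obtain ⟨c, hc⟩ := ih (by omega)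
    have hj : ∃ j, ∑ i ∈ (Finset.range n).filter (fun i => ε < |m i i| ∧ c i = j),
        m n i ^ 2 ≤ ε ^ 2 := by
      by_contra! h
      have h1 : ∑ j, ∑ i ∈ (Finset.range n).filter (fun i => ε < |m i i| ∧ c i = j), m n i ^ 2 ≤
          b := by
        refine le_trans ?_ (hsum n (by omega))
        rw [← Finset.sum_fiberwise (Finset.range n) c (fun i => m n i ^ 2)]
        refine Finset.sum_le_sum fun j _ => ?_
        refine Finset.sum_le_sum_of_subset_of_nonneg ?_ fun i _ _ => sq_nonneg _
        intro i hi
        rw [Finset.mem_filter] at hi ⊢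
        exact ⟨hi.1, hi.2.2⟩
      have h2 : ∑ _j : Fin ⌈b / ε ^ 2⌉₊, ε ^ 2 <
          ∑ j, ∑ i ∈ (Finset.range n).filter (fun i => ε < |m i i| ∧ c i = j), m n i ^ 2 :=
        Finset.sum_lt_sum_of_nonempty ⟨⟨0, hK⟩, Finset.mem_univ _⟩ fun j _ => h j
      have h3 := Nat.le_ceil (b / ε ^ 2)
      rw [div_le_iff₀ (by positivity)] at h3
      simp at h2
      linarith
    obtain ⟨j, hj⟩ := hj
    refine ⟨Function.update c n j, fun t ht hQ => ?_⟩
    rcases Nat.lt_succ_iff_lt_or_eq.1 ht with h | rfl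
    · have := hc t h hQ
      convert this using 2
      refine Finset.filter_congr fun i hi => ?_
      have hi := Finset.mem_range.1 hi
      rw [Function.update_of_ne (by omega), Function.update_of_ne (by omega)]
    · convert hj using 2
      refine Finset.filter_congr fun i hi => ?_
      have hi := Finset.mem_range.1 hi
      rw [Function.update_of_ne (by omega), Function.update_self]

theorem card_le_of_independent {T d : ℕ} {m : ℕ → ℕ → ℝ} {ε b : ℝ} (hε : 0 < ε) (hb : 0 < b)
    (hsum : ∀ t < T, ∑ i ∈ Finset.range t, m t i ^ 2 ≤ b)
    (hd : ∀ s ⊆ Finset.range T, (∀ t ∈ s, ε < |m t t| ∧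
      ∑ i ∈ s.filter (fun i => i < t), m t i ^ 2 ≤ ε ^ 2) → s.card ≤ d) :
    (((Finset.range T).filter fun t => ε < |m t t|).card : ℝ) ≤ (b / ε ^ 2 + 1) * d := by
  classical
  obtain ⟨c, hc⟩ := exists_independent_coloring hε hb hsum T le_rfl
  set Q := (Finset.range T).filter fun t => ε < |m t t| with hQ
  have h1 : ∀ j, (Q.filter fun t => c t = j).card ≤ d := fun j => by
    refine hd _ ((Finset.filter_subset _ _).trans (Finset.filter_subset _ _)) fun t ht => ?_
    simp only [hQ, Finset.mem_filter, Finset.mem_range] at ht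
    refine ⟨ht.1.2, ?_⟩
    refine le_trans (le_of_eq ?_) (hc t ht.1.1 ht.1.2)
    refine Finset.sum_congr ?_ fun _ _ => rfl
    ext i
    simp only [hQ, Finset.mem_filter, Finset.mem_range, ht.2]
    constructor
    · rintro ⟨⟨⟨_, h2⟩, h3⟩, h4⟩; exact ⟨h4, h2, h3⟩
    · rintro ⟨h4, h2, h3⟩; exact ⟨⟨⟨by omega, h2⟩, h3⟩, h4⟩
  have h2 : Q.card ≤ ⌈b / ε ^ 2⌉₊ * d := by
    rw [Finset.card_eq_sum_card_fiberwise (f := c) (t := Finset.univ) fun _ _ => Finset.mem_univ _]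
    refine (Finset.sum_le_card_nsmul _ _ d fun j _ => h1 j).trans ?_
    simp
  calc (Q.card : ℝ) ≤ (⌈b / ε ^ 2⌉₊ : ℝ) * d := by exact_mod_cast h2
    _ ≤ _ := mul_le_mul_of_nonneg_right (Nat.ceil_lt_add_one (by positivity)).le (by positivity)

/-- Layer-cake bound: if at most `c / y` of the values `v` exceed `y`, for each `y ≥ τ`, then the
`j`-th largest value is at most `max τ (c / j)`. -/
theorem sum_le_of_card_lt_le {ι : Type*} {v : ι → ℝ} {φ : ℝ → ℝ} (hφ : Monotone φ) {c τ : ℝ}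
    (hτ : 0 < τ) (n : ℕ) (s : Finset ι) (hs : s.card = n)
    (h : ∀ y, τ ≤ y → ((s.filter fun i => y < v i).card : ℝ) ≤ c / y) :
    ∑ i ∈ s, φ (v i) ≤ ∑ j ∈ Finset.range n, φ (max τ (c / (j + 1))) := by
  classical
  induction n generalizing s with
  | zero => rw [Finset.card_eq_zero.1 hs]; simp
  | succ n ih =>
    obtain ⟨i, hi, hmin⟩ := Finset.exists_min_image s v
      (Finset.card_pos.1 (by omega))
    rw [← Finset.sum_erase_add _ _ hi, Finset.sum_range_succ]
    refine add_le_add (ih _ (by rw [Finset.card_erase_of_mem hi, hs]; rfl) fun y hy => ?_)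
      (hφ ?_)
    · refine le_trans ?_ (h y hy)
      exact_mod_cast Finset.card_le_card
        (Finset.filter_subset_filter _ (Finset.erase_subset _ _))
    · refine le_of_forall_lt fun y hy => ?_
      by_contra! hle
      -- a level between `max τ (c / (n + 1))` and the minimum is exceeded by all of `s`
      obtain ⟨w, hw1, hw2⟩ := exists_between (lt_of_le_of_lt hle hy)
      have hwτ : τ ≤ w := (le_max_left _ _).trans hw1.le
      have h1 := h w hwτ
      rw [Finset.filter_true_of_mem fun k hk => lt_of_lt_of_le hw2 (hmin k hk), hs,
        le_div_iff₀ (by linarith)] at h1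
      have h2 := (le_max_right τ (c / (n + 1))).trans_lt hw1
      rw [div_lt_iff₀ (by positivity)] at h2
      push_cast at h1
      linarith

theorem sum_inv_sqrt_le (n : ℕ) : ∑ j ∈ Finset.range n, 1 / Real.sqrt (j + 1) ≤
    2 * Real.sqrt n := by
  induction n with
  | zero => simp
  | succ n ih =>
    rw [Finset.sum_range_succ]
    have h1 : 0 < Real.sqrt (n + 1) := Real.sqrt_pos.2 (by positivity)
    have h2 : 0 ≤ Real.sqrt n := Real.sqrt_nonneg _
    have h3 : Real.sqrt (n + 1) ^ 2 = n + 1 := Real.sq_sqrt (by positivity)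
    have h4 : Real.sqrt n ^ 2 = n := Real.sq_sqrt (by positivity)
    have h5 : 1 / Real.sqrt (n + 1) ≤ 2 * Real.sqrt (n + 1) - 2 * Real.sqrt n := by
      rw [div_le_iff₀ h1]
      nlinarith [sq_nonneg (Real.sqrt (n + 1) - Real.sqrt n)]
    push_cast
    linarith

/-- Regret bounds from the eluder dimension: if each test function has second moment at most `b`
over the earlier measures, then its absolute values and its squares on the current measure
have sums controlled by the dimension. -/
theorem eluder_sum_le {X : Type*} [MeasurableSpace X] {G : Set (X → ℝ)}
    {P : Set (SignedMeasure X)} {T d : ℕ} (hT : 1 ≤ T)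
    (hd : dimDE G P (1 / Real.sqrt T) ≤ d) {g : ℕ → X → ℝ} {ρ : ℕ → SignedMeasure X}
    (hg : ∀ t < T, g t ∈ G) (hρ : ∀ t < T, ρ t ∈ P) {m : ℕ → ℕ → ℝ}
    (hm : ∀ t < T, ∀ i < T,
      (ρ i).integral (g t) (ContinuousLinearMap.lsmul ℝ ℝ) = m t i) {b : ℝ} (hb : 0 < b)
    (hsum : ∀ t < T, ∑ i ∈ Finset.range t, m t i ^ 2 ≤ b) (hbd : ∀ t < T, m t t ^ 2 ≤ b) :
    ∑ t ∈ Finset.range T, |m t t| ≤ 2 * Real.sqrt (2 * b * d * T) + Real.sqrt T ∧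
      ∑ t ∈ Finset.range T, m t t ^ 2 ≤ 2 * b * d * (1 + Real.log T) + 1 := by
  classical
  have hT0 : (0 : ℝ) < T := by exact_mod_cast hT
  have hcard : ∀ ε, 1 / Real.sqrt T ≤ ε →
      (((Finset.range T).filter fun t => ε < |m t t|).card : ℝ) ≤ (b / ε ^ 2 + 1) * d := by
    intro ε hε
    have hε0 : 0 < ε := lt_of_lt_of_le (by positivity) hε
    refine card_le_of_independent hε0 hb hsum fun s hs hind => ?_
    have hsT : ∀ t ∈ s, t < T := fun t ht => Finset.mem_range.1 (hs ht)
    let e := s.orderEmbOfFin rfl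
    have he : ∀ i, e i ∈ s := fun i => Finset.orderEmbOfFin_mem s rfl i
    have : (s.card : ℕ∞) ≤ dimDE G P (1 / Real.sqrt T) := by
      refine le_iSup₂_of_le s.card ⟨ε, hε, fun i => ρ (e i), fun i => hρ _ (hsT _ (he i)),
        fun k => ⟨g (e k), hg _ (hsT _ (he k)), ?_, ?_⟩⟩ le_rfl
      · rw [Real.sqrt_le_left hε0.le]
        refine le_trans (le_of_eq ?_) (hind (e k) (he k)).2
        rw [Finset.sum_congr rfl fun i _ => by rw [hm _ (hsT _ (he k)) _ (hsT _ (he i))]]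
        refine Finset.sum_bij (fun i _ => e i) (fun i hi => ?_) (fun i _ j _ h => e.injective h)
          (fun t ht => ?_) fun _ _ => rfl
        · exact Finset.mem_filter.2 ⟨he i, e.lt_iff_lt.2 (Finset.mem_Iio.1 hi)⟩
        · obtain ⟨h1, h2⟩ := Finset.mem_filter.1 ht
          have : t ∈ Set.range e := by rw [Finset.range_orderEmbOfFin]; exact h1
          obtain ⟨i, rfl⟩ := this
          exact ⟨i, Finset.mem_Iio.2 (e.lt_iff_lt.1 h2), rfl⟩
      · rw [hm _ (hsT _ (he k)) _ (hsT _ (he k))]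
        exact (hind (e k) (he k)).1
    exact_mod_cast this.trans hd
  have hlevel : ∀ y, (1 : ℝ) / T ≤ y →
      (((Finset.range T).filter fun t => y < m t t ^ 2).card : ℝ) ≤ 2 * b * d / y := by
    intro y hy
    have hy0 : 0 < y := lt_of_lt_of_le (by positivity) hy
    rcases lt_or_ge y b with hyb | hyb
    · have h1 := hcard (Real.sqrt y) (by
        rw [← Real.sqrt_one, ← Real.sqrt_div' _ hT0.le]
        exact Real.sqrt_le_sqrt hy)
      rw [Real.sq_sqrt hy0.le] at h1
      have h2 : ((Finset.range T).filter fun t => y < m t t ^ 2) =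
          (Finset.range T).filter fun t => Real.sqrt y < |m t t| := by
        refine Finset.filter_congr fun t _ => ?_
        rw [← Real.sqrt_sq_eq_abs, Real.sqrt_lt_sqrt_iff hy0.le]
      rw [h2]
      refine h1.trans ?_
      have h3 : 1 ≤ b / y := by rw [le_div_iff₀ hy0]; linarith
      calc (b / y + 1) * d ≤ (b / y + b / y) * d := by gcongr
        _ = 2 * b * d / y := by ring
    · rw [Finset.filter_false_of_mem fun t ht => not_lt.2
        ((hbd t (Finset.mem_range.1 ht)).trans hyb)]
      simp only [Finset.card_empty, Nat.cast_zero]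
      positivity
  have hc0 : 0 ≤ 2 * b * d := by positivity
  constructor
  · have h := sum_le_of_card_lt_le (fun _ _ h => Real.sqrt_le_sqrt h) (by positivity) T
      (Finset.range T) (Finset.card_range T) hlevel
    simp_rw [Real.sqrt_sq_eq_abs] at h
    refine h.trans ?_
    have h1 : ∀ j : ℕ, Real.sqrt (max (1 / T) (2 * b * d / (j + 1))) ≤
        1 / Real.sqrt T + Real.sqrt (2 * b * d) * (1 / Real.sqrt (j + 1)) := fun j => by
      have e1 : Real.sqrt (1 / T) = 1 / Real.sqrt T := by
        rw [Real.sqrt_div' _ hT0.le, Real.sqrt_one]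
      have e2 : Real.sqrt (2 * b * d / (j + 1)) = Real.sqrt (2 * b * d) * (1 / Real.sqrt (j + 1)) := by
        rw [Real.sqrt_div' _ (by positivity)]; ring
      rcases max_cases (1 / (T : ℝ)) (2 * b * d / (j + 1)) with ⟨h, _⟩ | ⟨h, _⟩
      · rw [h, e1]; linarith [(by positivity : 0 ≤ Real.sqrt (2 * b * d) * (1 / Real.sqrt (j + 1)))]
      · rw [h, e2]; linarith [(by positivity : 0 ≤ 1 / Real.sqrt T)]
    refine (Finset.sum_le_sum fun j _ => h1 j).trans ?_
    rw [Finset.sum_add_distrib, ← Finset.mul_sum, Finset.sum_const, Finset.card_range, nsmul_eq_mul]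
    have h2 : (T : ℝ) * (1 / Real.sqrt T) = Real.sqrt T := by
      rw [mul_one_div, Real.div_sqrt]
    have h3 : Real.sqrt (2 * b * d * T) = Real.sqrt (2 * b * d) * Real.sqrt T :=
      Real.sqrt_mul hc0 _
    rw [h2, h3]
    nlinarith [mul_le_mul_of_nonneg_left (sum_inv_sqrt_le T) (Real.sqrt_nonneg (2 * b * d))]
  · have h := sum_le_of_card_lt_le monotone_id (by positivity) T
      (Finset.range T) (Finset.card_range T) hlevel
    simp only [id] at h
    refine h.trans ?_
    have h1 : ∀ j : ℕ, max (1 / (T : ℝ)) (2 * b * d / (j + 1)) ≤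
        1 / T + 2 * b * d * ((j : ℝ) + 1)⁻¹ := fun j => by
      rw [← div_eq_mul_inv]
      exact max_le (by linarith [(by positivity : 0 ≤ 2 * b * d / ((j : ℝ) + 1))])
        (by linarith [(by positivity : 0 ≤ 1 / (T : ℝ))])
    refine (Finset.sum_le_sum fun j _ => h1 j).trans ?_
    rw [Finset.sum_add_distrib, ← Finset.mul_sum, Finset.sum_const, Finset.card_range, nsmul_eq_mul]
    have h2 : (T : ℝ) * (1 / T) = 1 := by field_simp
    have h3 := harmonic_le_one_add_log T
    rw [harmonic] at h3
    push_cast at h3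
    rw [h2]
    nlinarith [mul_le_mul_of_nonneg_left h3 hc0]

end Eluder

/-! ### Laws of the data and exponential supermartingales -/

section Data

variable {S A B Par : Type*}

/-- `∑_i W_i(x_{<i}, x_i)`, for increments that depend on an episode and on the data before it. -/
def Hist.additive {H n : ℕ} (W : (t : ℕ) → Hist S A B H t → (Fin H → S × A × B) → ℝ)
    (x : Hist S A B H n) : ℝ :=
  ∑ i : Fin n, W i (x.before i) (x i)

theorem Hist.additive_snoc {H n : ℕ} (W : (t : ℕ) → Hist S A B H t → (Fin H → S × A × B) → ℝ)
    (x : Hist S A B H n) (τ : Fin H → S × A × B) :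
    Hist.additive W (Fin.snoc (α := fun _ => Fin H → S × A × B) x τ : Hist S A B H (n + 1)) =
      Hist.additive W x + W n x τ := by
  rw [Hist.additive, Fin.sum_univ_castSucc, Hist.additive]
  have h1 : ∀ i : Fin n,
      Hist.before (Fin.snoc (α := fun _ => Fin H → S × A × B) x τ : Hist S A B H (n + 1))
        i.castSucc = x.before i := fun i => funext fun j =>
    Fin.snoc_castSucc (α := fun _ => Fin H → S × A × B) τ x ⟨j, j.2.trans i.2⟩
  have h2 : Hist.before (Fin.snoc (α := fun _ => Fin H → S × A × B) x τ : Hist S A B H (n + 1))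
      (Fin.last n) = x := funext fun j =>
    Fin.snoc_castSucc (α := fun _ => Fin H → S × A × B) τ x j
  congr 1
  · refine Finset.sum_congr rfl fun i _ => ?_
    have h3 : (Fin.snoc (α := fun _ => Fin H → S × A × B) x τ : Hist S A B H (n + 1)) i.castSucc =
        x i := Fin.snoc_castSucc (α := fun _ => Fin H → S × A × B) τ x i
    rw [h3]
    exact congrArg (fun y => W i y (x i)) (h1 i)
  · have h3 : (Fin.snoc (α := fun _ => Fin H → S × A × B) x τ : Hist S A B H (n + 1)) (Fin.last n) =
        τ := Fin.snoc_last (α := fun _ => Fin H → S × A × B) τ x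
    rw [h3]
    exact congrArg (fun y => W n y τ) h2

variable [MeasurableSpace S] [MeasurableSpace A] [MeasurableSpace B]

theorem Hist.measurable_before {H n : ℕ} (i : Fin n) :
    Measurable fun x : Hist S A B H n => x.before i :=
  measurable_pi_iff.2 fun _ => measurable_pi_apply _

theorem Hist.measurable_additive {H n : ℕ}
    {W : (t : ℕ) → Hist S A B H t → (Fin H → S × A × B) → ℝ}
    (hW : ∀ t < n, Measurable fun p : Hist S A B H t × (Fin H → S × A × B) => W t p.1 p.2) :
    Measurable fun x : Hist S A B H n => x.additive W := by
  refine Finset.measurable_sum _ fun i _ => ?_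
  have h1 : Measurable fun x : Hist S A B H n => (x.before i, x i) :=
    (Hist.measurable_before i).prodMk (measurable_pi_apply i)
  exact (hW i i.2).comp h1

namespace Learner

variable {H T : ℕ} (M : Game S A B) (L : Learner S A B Par H)
  (hpol : ∀ t < T, ∀ h < H, IsPolicyFamily fun x : Hist S A B H t => L.policyAt t x h)
include hpol

theorem measurable_trajLaw_policyAt {n : ℕ} (hn : n < T) :
    Measurable fun x => M.trajLaw (L.policyAt n x) H :=
  (M.trajLaw_param (hpol n hn) H le_rfl).1

theorem isProbabilityMeasure_trajLaw_policyAt {n : ℕ} (hn : n < T) (x : Hist S A B H n) :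
    IsProbabilityMeasure (M.trajLaw (L.policyAt n x) H) :=
  (M.trajLaw_param (hpol n hn) H le_rfl).2 x

theorem measurable_map_snoc_trajLaw {n : ℕ} (hn : n < T) :
    Measurable fun x : Hist S A B H n => (M.trajLaw (L.policyAt n x) H).map fun τ =>
      (Fin.snoc (α := fun _ => Fin H → S × A × B) x τ : Hist S A B H (n + 1)) := by
  have := L.isProbabilityMeasure_trajLaw_policyAt M hpol hn
  have h := L.measurable_trajLaw_policyAt M hpol hn
  exact measurable_map_param h measurable_snoc

theorem isProbabilityMeasure_law {n : ℕ} (hn : n ≤ T) : IsProbabilityMeasure (L.law M n) := by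
  induction n with
  | zero => rw [law]; infer_instance
  | succ n ih =>
    have := ih (by omega)
    have := L.isProbabilityMeasure_trajLaw_policyAt M hpol (n := n) hn
    have : ∀ x : Hist S A B H n, IsProbabilityMeasure ((M.trajLaw (L.policyAt n x) H).map fun τ =>
      (Fin.snoc (α := fun _ => Fin H → S × A × B) x τ : Hist S A B H (n + 1))) := fun x =>
        Measure.isProbabilityMeasure_map (measurable_snoc_right x).aemeasurable
    exact isProbabilityMeasure_bind (L.measurable_map_snoc_trajLaw M hpol hn)

theorem lintegral_law_succ {n : ℕ} (hn : n < T) {g : Hist S A B H (n + 1) → ℝ≥0∞}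
    (hg : Measurable g) : ∫⁻ x, g x ∂(L.law M (n + 1)) =
      ∫⁻ x, ∫⁻ τ, g (Fin.snoc (α := fun _ => Fin H → S × A × B) x τ)
        ∂(M.trajLaw (L.policyAt n x) H) ∂(L.law M n) := by
  rw [law, Measure.lintegral_bind (L.measurable_map_snoc_trajLaw M hpol hn).aemeasurable
    hg.aemeasurable]
  refine lintegral_congr fun x => ?_
  rw [lintegral_map hg (measurable_snoc_right x)]

/-- The data of the first `k` of `n` episodes are distributed as the data of `k` episodes. -/
theorem map_castLE_law {k n : ℕ} (hk : k ≤ n) (hn : n ≤ T) :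
    (L.law M n).map (fun x (i : Fin k) => x (Fin.castLE hk i)) = L.law M k := by
  induction n, hk using Nat.le_induction with
  | base => exact Measure.map_id
  | succ n hk ih =>
    rw [← ih (by omega)]
    ext E hE
    have h1 : Measurable fun (x : Hist S A B H (n + 1)) (i : Fin k) =>
        x (Fin.castLE (by omega) i) := by fun_prop
    have h2 : Measurable fun (x : Hist S A B H n) (i : Fin k) =>
        x (Fin.castLE (by omega) i) := by fun_prop
    rw [Measure.map_apply h1 hE, Measure.map_apply h2 hE, ← lintegral_indicator_one (h1 hE),
      ← lintegral_indicator_one (h2 hE),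
      L.lintegral_law_succ M hpol (by omega) (measurable_one.indicator (h1 hE))]
    refine lintegral_congr fun x => ?_
    have := L.isProbabilityMeasure_trajLaw_policyAt M hpol (n := n) (by omega) x
    have h3 : ∀ τ : Fin H → S × A × B, (fun i : Fin k =>
        (Fin.snoc (α := fun _ => Fin H → S × A × B) x τ : Hist S A B H (n + 1))
          (Fin.castLE (by omega) i)) = fun i => x (Fin.castLE (by omega) i) := fun τ =>
      funext fun i =>
        Fin.snoc_castSucc (α := fun _ => Fin H → S × A × B) τ x (Fin.castLE (by omega) i)
    have h4 : ∀ τ : Fin H → S × A × B,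
        Set.indicator ((fun (x : Hist S A B H (n + 1)) (i : Fin k) =>
          x (Fin.castLE (by omega) i)) ⁻¹' E) (1 : Hist S A B H (n + 1) → ℝ≥0∞)
          (Fin.snoc (α := fun _ => Fin H → S × A × B) x τ) =
        Set.indicator ((fun (x : Hist S A B H n) (i : Fin k) =>
          x (Fin.castLE (by omega) i)) ⁻¹' E) 1 x := fun τ => by
      classical
      rw [Set.indicator_apply, Set.indicator_apply, Set.mem_preimage, Set.mem_preimage, h3]
      rfl
    simp_rw [h4]
    simp

/-- Increments with conditional exponential moment at most one sum to an exponential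
supermartingale. -/
theorem lintegral_exp_additive_le {W : (t : ℕ) → Hist S A B H t → (Fin H → S × A × B) → ℝ}
    (hW : ∀ t < T, Measurable fun p : Hist S A B H t × (Fin H → S × A × B) => W t p.1 p.2)
    (hW1 : ∀ t < T, ∀ x, ∫⁻ τ, ENNReal.ofReal (Real.exp (W t x τ))
      ∂(M.trajLaw (L.policyAt t x) H) ≤ 1) {n : ℕ} (hn : n ≤ T) :
    ∫⁻ x, ENNReal.ofReal (Real.exp (x.additive W)) ∂(L.law M n) ≤ 1 := by
  induction n with
  | zero =>
    have := L.isProbabilityMeasure_law M hpol hn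
    simp [Hist.additive]
  | succ n ih =>
    refine le_trans ?_ (ih (by omega))
    rw [L.lintegral_law_succ M hpol (by omega)
      (Hist.measurable_additive fun t ht => hW t (by omega)).exp.ennreal_ofReal]
    refine lintegral_mono fun x => ?_
    have e : ∀ τ, ENNReal.ofReal (Real.exp (Hist.additive W
        (Fin.snoc (α := fun _ => Fin H → S × A × B) x τ : Hist S A B H (n + 1)))) =
        ENNReal.ofReal (Real.exp (x.additive W)) * ENNReal.ofReal (Real.exp (W n x τ)) := fun τ => by
      rw [Hist.additive_snoc, Real.exp_add, ENNReal.ofReal_mul (Real.exp_pos _).le]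
    simp_rw [e]
    have hWx : Measurable (W n x) := (hW n (by omega)).comp measurable_prodMk_left
    rw [lintegral_const_mul _ hWx.exp.ennreal_ofReal]
    exact mul_le_of_le_one_right' (hW1 n (by omega) x)

theorem law_additive_gt_le {W : (t : ℕ) → Hist S A B H t → (Fin H → S × A × B) → ℝ}
    (hW : ∀ t < T, Measurable fun p : Hist S A B H t × (Fin H → S × A × B) => W t p.1 p.2)
    (hW1 : ∀ t < T, ∀ x, ∫⁻ τ, ENNReal.ofReal (Real.exp (W t x τ))
      ∂(M.trajLaw (L.policyAt t x) H) ≤ 1) (c : ℝ) :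
    L.law M T {x | c < x.additive W} ≤ ENNReal.ofReal (Real.exp (-c)) := by
  have hm : Measurable fun x : Hist S A B H T => ENNReal.ofReal (Real.exp (x.additive W)) :=
    (Hist.measurable_additive hW).exp.ennreal_ofReal
  have hpos : 0 < Real.exp c := Real.exp_pos c
  calc L.law M T {x | c < x.additive W}
      ≤ L.law M T {x | ENNReal.ofReal (Real.exp c) ≤
          ENNReal.ofReal (Real.exp (x.additive W))} :=
        measure_mono fun x hx => ENNReal.ofReal_le_ofReal (Real.exp_le_exp.2 (le_of_lt hx))
    _ ≤ (∫⁻ x, ENNReal.ofReal (Real.exp (x.additive W)) ∂(L.law M T)) /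
          ENNReal.ofReal (Real.exp c) :=
        meas_ge_le_lintegral_div hm.aemeasurable (ENNReal.ofReal_pos.2 hpos).ne'
          ENNReal.ofReal_ne_top
    _ ≤ 1 / ENNReal.ofReal (Real.exp c) :=
        ENNReal.div_le_div_right (L.lintegral_exp_additive_le M hpol hW hW1 le_rfl) _
    _ = ENNReal.ofReal (Real.exp (-c)) := by
        rw [Real.exp_neg, ENNReal.ofReal_inv_of_pos hpos, one_div]

theorem law_additive_before_gt_le {W : (t : ℕ) → Hist S A B H t → (Fin H → S × A × B) → ℝ}
    (hW : ∀ t < T, Measurable fun p : Hist S A B H t × (Fin H → S × A × B) => W t p.1 p.2)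
    (hW1 : ∀ t < T, ∀ x, ∫⁻ τ, ENNReal.ofReal (Real.exp (W t x τ))
      ∂(M.trajLaw (L.policyAt t x) H) ≤ 1) (c : ℝ) (t : Fin T) :
    L.law M T {x | c < (x.before t).additive W} ≤ ENNReal.ofReal (Real.exp (-c)) := by
  have h1 := L.law_additive_gt_le M (T := t) (fun n hn => hpol n (hn.trans t.2))
    (fun n hn => hW n (hn.trans t.2)) (fun n hn => hW1 n (hn.trans t.2)) c
  have hm : Measurable fun x : Hist S A B H t => x.additive W :=
    Hist.measurable_additive fun n hn => hW n (hn.trans t.2)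
  rw [← L.map_castLE_law M hpol t.2.le le_rfl, Measure.map_apply (by fun_prop)
    (measurableSet_lt measurable_const hm)] at h1
  exact h1

end Learner

end Data

/-! ### Exponential moments along one episode -/

section Lintegral

variable {Ω : Type*} [MeasurableSpace Ω] {μ : Measure Ω} [IsProbabilityMeasure μ]

theorem lintegral_exp_le_of_integral_exp_le {X : Ω → ℝ} (hX : Measurable X) {c a : ℝ}
    (hc : ∀ ω, |X ω| ≤ c) (h : ∫ ω, Real.exp (X ω) ∂μ ≤ a) :
    ∫⁻ ω, ENNReal.ofReal (Real.exp (X ω)) ∂μ ≤ ENNReal.ofReal a := by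
  rw [← ofReal_integral_eq_lintegral_ofReal (integrable_exp_of_bounded hX hc)
    (.of_forall fun _ => (Real.exp_pos _).le)]
  exact ENNReal.ofReal_le_ofReal h

theorem lintegral_exp_sq_loss_le {V : Ω → ℝ} (hV : Measurable V) {c : ℝ} (hc : 0 < c)
    (hVc : ∀ ω, |V ω| ≤ c) (v w : ℝ) :
    ∫⁻ ω, ENNReal.ofReal (Real.exp
      (-(((v - w - V ω) ^ 2 - ((w + ∫ ω, V ω ∂μ) - w - V ω) ^ 2) / (8 * c ^ 2)))) ∂μ ≤
      ENNReal.ofReal (Real.exp (-((v - (w + ∫ ω, V ω ∂μ)) ^ 2 / (16 * c ^ 2)))) := by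
  have hb : ∀ x : ℝ, ∀ ω, (x - w - V ω) ^ 2 ≤ (|x - w| + c) ^ 2 := fun x ω => by
    rw [← sq_abs]
    exact pow_le_pow_left₀ (abs_nonneg _)
      ((abs_sub _ _).trans (by linarith [hVc ω])) 2
  refine lintegral_exp_le_of_integral_exp_le (by fun_prop)
    (c := ((|v - w| + c) ^ 2 + (|(w + ∫ ω, V ω ∂μ) - w| + c) ^ 2) / (8 * c ^ 2)) (fun ω => ?_) ?_
  · rw [abs_neg, abs_div, abs_of_pos (by positivity : 0 < 8 * c ^ 2)]
    refine div_le_div_of_nonneg_right ?_ (by positivity)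
    refine (abs_sub _ _).trans ?_
    rw [abs_of_nonneg (sq_nonneg _), abs_of_nonneg (sq_nonneg _)]
    exact add_le_add (hb _ ω) (hb _ ω)
  · rw [← neg_div]
    exact integral_exp_sq_loss_le hV hc hVc v w

end Lintegral

section Episode

variable {S A B X : Type*} [MeasurableSpace S] [MeasurableSpace A] [MeasurableSpace B]
  [MeasurableSpace X]

namespace Game

variable (M : Game S A B)

/-- The quantal response error `⟨π, r' - r⟩(s, b) - ⟨π ⊗ ν^{π, r}, r' - r⟩(s)` of the reward `r'`
when the true reward is `r`. -/
noncomputable def respError (r' r : S × A × B → ℝ) (π : Kernel (S × B) A) (s : S) (b : B) : ℝ :=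
  avg (fun z => r' z - r z) π s b -
    ∫ b', avg (fun z => r' z - r z) π s b' ∂(M.quantalResponse r π s)

theorem measurable_respError_param {π : X → Kernel (S × B) A} (hπ : IsPolicyFamily π)
    {r : S × A × B → ℝ} (hr : IsReward r) {f : X → S × A × B → ℝ}
    (hf : Measurable fun p : X × (S × A × B) => f p.1 p.2) :
    Measurable fun p : X × S × B => M.respError (f p.1) r (π p.1) p.2.1 p.2.2 := by
  have := hπ.isMarkov
  have hg : Measurable fun p : X × S × B =>
      avg (fun z => f p.1 z - r z) (π p.1) p.2.1 p.2.2 :=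
    measurable_avg_param hπ (f := fun x z => f x z - r z)
      (hf.sub (hr.measurable.comp measurable_snd))
  refine hg.sub ?_
  have hq : ∀ p : X × S, IsProbabilityMeasure (M.quantalResponse r (π p.1) p.2) := fun p =>
    M.isProbabilityMeasure_quantalResponse hr p.2
  have hm : Measurable fun p : X × S => M.quantalResponse r (π p.1) p.2 :=
    M.measurable_quantalResponse_param hπ (f := fun _ => r) (hr.measurable.comp measurable_snd)
  have h := measurable_integral_param hm
    (f := fun p b' => avg (fun z => f p.1 z - r z) (π p.1) p.2 b')
    (hg.comp (by fun_prop : Measurable fun q : (X × S) × B => (q.1.1, q.1.2, q.2)))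
  have h' := h.comp (by fun_prop : Measurable fun p : X × S × B => (p.1, p.2.1))
  exact h'

section Single

variable {H : ℕ} {π : ℕ → Kernel (S × B) A} (hπ : ∀ h < H, IsMarkovKernel (π h))

theorem _root_.QSE.IsReward.abs_sub_le {r r' : S × A × B → ℝ} (hr : IsReward r)
    (hr' : IsReward r') (z : S × A × B) : |r' z - r z| ≤ 1 := by
  rw [abs_le]
  constructor <;> linarith [(hr.mem z).1, (hr.mem z).2, (hr'.mem z).1, (hr'.mem z).2]

section OneStep

variable {r r' : S × A × B → ℝ} {κ : Kernel (S × B) A} [IsMarkovKernel κ]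

theorem avg_sub_reward (hr : IsReward r) (hr' : IsReward r') (s : S) (b : B) :
    avg (fun z => r' z - r z) κ s b = avg r' κ s b - avg r κ s b :=
  avg_sub hr'.measurable hr.measurable hr'.abs_apply_le hr.abs_apply_le s b

theorem eta_mul_adv_sub (hr : IsReward r) (hr' : IsReward r') (s : S) (b : B) :
    M.η * M.adv r' κ s b - M.η * M.adv r κ s b =
      M.η * avg (fun z => r' z - r z) κ s b -
        (Real.log (M.partition r' κ s) - Real.log (M.partition r κ s)) := by
  rw [M.eta_mul_adv, M.eta_mul_adv, avg_sub_reward hr hr']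
  ring

theorem integral_exp_adv_sub (hr : IsReward r) (hr' : IsReward r') (s : S) :
    ∫ b, Real.exp (M.η * M.adv r' κ s b - M.η * M.adv r κ s b) ∂(M.quantalResponse r κ s) = 1 := by
  have := M.isProbabilityMeasure_quantalResponse (π := κ) hr' s
  have h := M.integral_quantalResponse_change (π := κ) hr hr' s (fun _ => 1)
  simpa using h.symm

theorem abs_avg_sub_le (hr : IsReward r) (hr' : IsReward r') (s : S) (b : B) :
    |avg (fun z => r' z - r z) κ s b| ≤ 1 :=
  abs_avg_le (hr.abs_sub_le hr') s b

theorem measurable_avg_sub (hr : IsReward r) (hr' : IsReward r') (s : S) :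
    Measurable fun b => avg (fun z => r' z - r z) κ s b :=
  measurable_avg_right (hr'.measurable.sub hr.measurable) s

theorem abs_respError_le (hr : IsReward r) (hr' : IsReward r') (s : S) (b : B) :
    |M.respError r' r κ s b| ≤ 2 := by
  have := M.isProbabilityMeasure_quantalResponse (π := κ) hr s
  exact abs_sub_integral_le (ν := M.quantalResponse r κ s)
    (f := fun b => avg (fun z => r' z - r z) κ s b) (abs_avg_sub_le hr hr' s) b

/-- The error in evaluating `f` against the response to `r'` instead of `r` is of first order in the
quantal response error, up to a second order remainder. -/
theorem abs_evalOp_sub_le (hr : IsReward r) (hr' : IsReward r') {f : S × A × B → ℝ}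
    (hf : Measurable f) {c : ℝ} (hc : ∀ z, |f z| ≤ c) (s : S) :
    |M.evalOp r' κ f s - M.evalOp r κ f s| ≤ c * (∫ b, (M.η * |M.respError r' r κ s b| +
      2 * M.η ^ 2 * Real.exp (2 * M.η) * M.respError r' r κ s b ^ 2)
        ∂(M.quantalResponse r κ s)) := by
  have := M.isProbabilityMeasure_quantalResponse (π := κ) hr s
  set ν := M.quantalResponse r κ s with hν
  set Y : B → ℝ := fun b => M.η * M.adv r' κ s b - M.η * M.adv r κ s b with hY
  have hg := measurable_avg_sub (κ := κ) hr hr' s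
  have hgc := abs_avg_sub_le (κ := κ) hr hr' s
  have hYe : ∀ b, Y b = M.η * avg (fun z => r' z - r z) κ s b -
        (Real.log (M.partition r' κ s) - Real.log (M.partition r κ s)) :=
    M.eta_mul_adv_sub hr hr' s
  have hY1 : ∫ b, Real.exp (Y b) ∂ν = 1 := M.integral_exp_adv_sub hr hr' s
  have hYc := abs_log_density_le M.η_pos hg hgc hYe hY1
  have hYm : Measurable Y := ((M.measurable_adv_right hr'.measurable s).const_mul _).sub
    ((M.measurable_adv_right hr.measurable s).const_mul _)
  have hfm : Measurable fun b => avg f κ s b := measurable_avg_right hf s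
  have i1 : Integrable (fun b => Real.exp (Y b) - 1) ν :=
    (integrable_exp_of_bounded hYm hYc).sub (integrable_const _)
  have i2 : Integrable (fun b => avg f κ s b) ν := integrable_of_bounded hfm (abs_avg_le hc s)
  have i3 : Integrable (fun b => Real.exp (Y b) * avg f κ s b) ν :=
    (integrable_exp_of_bounded hYm hYc).mul_bdd (c := c) hfm.aestronglyMeasurable
      (.of_forall fun b => abs_avg_le hc s b)
  have hE : ∀ b, M.respError r' r κ s b = avg (fun z => r' z - r z) κ s b -
      ∫ b', avg (fun z => r' z - r z) κ s b' ∂ν := fun b => rfl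
  have hEm : Measurable fun b => M.respError r' r κ s b := by
    simp_rw [hE]; exact hg.sub_const _
  have hEc := M.abs_respError_le (κ := κ) hr hr' s
  have i4 : Integrable (fun b => M.respError r' r κ s b) ν := integrable_of_bounded hEm hEc
  have i5 : Integrable (fun b => M.respError r' r κ s b ^ 2) ν :=
    integrable_of_bounded (c := 4) (hEm.pow_const 2) fun b => by
      rw [abs_pow]; nlinarith [hEc b, abs_nonneg (M.respError r' r κ s b)]
  have h1 : M.evalOp r' κ f s - M.evalOp r κ f s =
      ∫ b, (Real.exp (Y b) - 1) * avg f κ s b ∂ν := by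
    rw [evalOp, evalOp, M.integral_quantalResponse_change hr hr', ← hν, ← integral_sub i3 i2]
    exact integral_congr_ae (.of_forall fun b => by simp only [hY]; ring)
  have hc0 : 0 ≤ c ∨ IsEmpty B := by
    rcases isEmpty_or_nonempty B with h | ⟨⟨b⟩⟩
    · exact .inr h
    · exact .inl ((abs_nonneg _).trans (abs_avg_le (π := κ) hc s b))
  rw [h1]
  calc |∫ b, (Real.exp (Y b) - 1) * avg f κ s b ∂ν|
      ≤ ∫ b, |(Real.exp (Y b) - 1) * avg f κ s b| ∂ν := abs_integral_le_integral_abs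
    _ ≤ ∫ b, c * |Real.exp (Y b) - 1| ∂ν := by
        refine integral_mono_of_nonneg (.of_forall fun b => abs_nonneg _)
          (i1.abs.const_mul c) (.of_forall fun b => ?_)
        simp only
        rw [abs_mul, mul_comm]
        exact mul_le_mul_of_nonneg_right (abs_avg_le hc s b) (abs_nonneg _)
    _ = c * ∫ b, |Real.exp (Y b) - 1| ∂ν := integral_const_mul _ _
    _ ≤ _ := by
        rw [integral_add (i4.abs.const_mul _) (i5.const_mul _), integral_const_mul,
          integral_const_mul]
        rcases hc0 with hc0 | hB
        · exact mul_le_mul_of_nonneg_left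
            (integral_abs_tilt_sub_one_le M.η_pos hg hgc hYe hY1) hc0
        · simp [Measure.eq_zero_of_isEmpty]

end OneStep

include hπ

theorem lintegral_trajLaw_apply {h : ℕ} (hh : h < H) {g : S × A × B → ℝ≥0∞} (hg : Measurable g) :
    ∫⁻ τ, g (τ ⟨h, hh⟩) ∂(M.trajLaw π H) = ∫⁻ z, g z ∂(M.stepLaw π h) := by
  rw [← M.map_apply_trajLaw hπ hh, lintegral_map hg (measurable_pi_apply _)]

/-- The next state integrates out; after the last step the regression target has no random part. -/
theorem lintegral_trajLaw_target {h : ℕ} (hh : h < H) {V : S → ℝ} (hV : Measurable V)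
    (hVH : h + 1 = H → V = 0) {F : S × A × B → ℝ → ℝ≥0∞}
    (hF : Measurable fun p : (S × A × B) × ℝ => F p.1 p.2) :
    ∫⁻ τ, F (τ ⟨h, hh⟩) (if hh : h + 1 < H then V (τ ⟨h + 1, hh⟩).1 else 0) ∂(M.trajLaw π H) =
      ∫⁻ z, ∫⁻ s, F z (V s) ∂(M.P h z) ∂(M.stepLaw π h) := by
  have hg : Measurable fun p : (S × A × B) × S => F p.1 (V p.2) :=
    hF.comp (measurable_fst.prodMk (hV.comp measurable_snd))
  by_cases hlast : h + 1 < H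
  · simp only [dif_pos hlast]
    exact M.lintegral_trajLaw_transition hπ hlast (g := fun z s => F z (V s)) hg
  · have hV0 : V = 0 := hVH (by omega)
    simp only [dif_neg hlast]
    have hF0 : Measurable fun z => F z 0 := hF.comp (measurable_id.prodMk measurable_const)
    rw [M.lintegral_trajLaw_apply hπ hh hF0]
    refine lintegral_congr fun z => ?_
    simp [hV0]

/-- Exponential moment of the excess squared loss of a value function `f` over the Bellman backup of
`V`, along one episode. -/
theorem lintegral_exp_bellman_le {h : ℕ} (hh : h < H) {f : S × A × B → ℝ} {V : S → ℝ}
    (hf : Measurable f) (hfc : ∀ z, |f z| ≤ H) (hV : Measurable V) (hVc : ∀ s, |V s| ≤ H)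
    (hVH : h + 1 = H → V = 0) {q : S × A × B → ℝ}
    (hq : ∀ z, q z = M.u h z + ∫ s, V s ∂(M.P h z)) :
    ∫⁻ τ, ENNReal.ofReal (Real.exp (
      -(((f (τ ⟨h, hh⟩) - M.u h (τ ⟨h, hh⟩) -
          (if hh : h + 1 < H then V (τ ⟨h + 1, hh⟩).1 else 0)) ^ 2 -
        (q (τ ⟨h, hh⟩) - M.u h (τ ⟨h, hh⟩) -
          (if hh : h + 1 < H then V (τ ⟨h + 1, hh⟩).1 else 0)) ^ 2) / (8 * (H : ℝ) ^ 2)) +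
      (∫ z, (f z - q z) ^ 2 ∂(M.stepLaw π h)) / (32 * (H : ℝ) ^ 2))) ∂(M.trajLaw π H) ≤ 1 := by
  have hH1 : (1 : ℝ) ≤ H := by exact_mod_cast (by omega : 1 ≤ H)
  have hH0 : (0 : ℝ) < H := by linarith
  have := M.isProbabilityMeasure_stepLaw hπ hh
  have := M.isProbabilityMeasure_trajLaw hπ le_rfl
  have hqm : Measurable q := by
    rw [funext hq]
    exact (M.measurable_u h).add
      (measurable_integral_param (M.P h).measurable (hV.comp measurable_snd))
  have hD : ∀ z, |f z - q z| ≤ 3 * H := fun z => by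
    have h1 := abs_le.1 (abs_integral_le_of_bounded (μ := M.P h z) hVc)
    have h2 := M.u_mem h z
    have h3 := abs_le.1 (hfc z)
    rw [hq, abs_le]
    constructor <;> linarith [h2.1, h2.2]
  set F : S × A × B → ℝ → ℝ≥0∞ := fun z y => ENNReal.ofReal (Real.exp
    (-(((f z - M.u h z - y) ^ 2 - (q z - M.u h z - y) ^ 2) / (8 * (H : ℝ) ^ 2)))) with hF
  have hFm : Measurable fun p : (S × A × B) × ℝ => F p.1 p.2 := by
    have hu := M.measurable_u h
    simp only [hF]
    fun_prop
  have e1 := M.lintegral_trajLaw_target hπ hh hV hVH hFm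
  have e2 : ∀ z, ∫⁻ s, F z (V s) ∂(M.P h z) ≤
      ENNReal.ofReal (Real.exp (-((f z - q z) ^ 2 / (16 * (H : ℝ) ^ 2)))) := fun z => by
    have h1 := lintegral_exp_sq_loss_le (μ := M.P h z) hV hH0 hVc (f z) (M.u h z)
    rw [← hq z] at h1
    exact h1
  have hXm : Measurable fun z => (f z - q z) ^ 2 / (16 * (H : ℝ) ^ 2) :=
    ((hf.sub hqm).pow_const 2).div_const _
  have hXI : ∀ z, (f z - q z) ^ 2 / (16 * (H : ℝ) ^ 2) ∈ Set.Icc (0 : ℝ) 1 := fun z => by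
    refine ⟨by positivity, ?_⟩
    rw [div_le_one (by positivity), ← sq_abs]
    nlinarith [hD z, abs_nonneg (f z - q z)]
  have e3 : ∫⁻ z, ENNReal.ofReal (Real.exp (-((f z - q z) ^ 2 / (16 * (H : ℝ) ^ 2))))
      ∂(M.stepLaw π h) ≤ ENNReal.ofReal (Real.exp
        (-((∫ z, (f z - q z) ^ 2 ∂(M.stepLaw π h)) / (32 * (H : ℝ) ^ 2)))) := by
    refine lintegral_exp_le_of_integral_exp_le hXm.neg (c := 1) (fun z => ?_)
      ((integral_exp_neg_le hXm hXI).trans (le_of_eq ?_))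
    · rw [Pi.neg_apply, abs_neg]
      exact abs_le_of_mem_Icc_zero (hXI z)
    · rw [integral_div]
      congr 1
      field_simp
      ring
  simp_rw [Real.exp_add, ENNReal.ofReal_mul (Real.exp_pos _).le]
  rw [lintegral_mul_const' _ _ ENNReal.ofReal_ne_top]
  refine le_trans (mul_le_mul_left (le_of_eq e1) _) ?_
  calc _ ≤ ENNReal.ofReal (Real.exp
        (-((∫ z, (f z - q z) ^ 2 ∂(M.stepLaw π h)) / (32 * (H : ℝ) ^ 2)))) *
        ENNReal.ofReal (Real.exp
          ((∫ z, (f z - q z) ^ 2 ∂(M.stepLaw π h)) / (32 * (H : ℝ) ^ 2))) := by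
        gcongr
        exact (lintegral_mono e2).trans e3
    _ = 1 := by
        rw [← ENNReal.ofReal_mul (Real.exp_pos _).le, ← Real.exp_add]
        simp

/-- Exponential moment of the follower's log-likelihood ratio and squared response error, along one
episode. -/
theorem lintegral_exp_likelihood_le {h : ℕ} (hh : h < H) {r' : S × A × B → ℝ}
    (hr' : IsReward r') :
    ∫⁻ τ, ENNReal.ofReal (Real.exp (
      (M.η * M.adv r' (π h) (τ ⟨h, hh⟩).1 (τ ⟨h, hh⟩).2.2 -
        M.η * M.adv (M.r h) (π h) (τ ⟨h, hh⟩).1 (τ ⟨h, hh⟩).2.2) / 4 +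
      M.η ^ 2 / (32 * (1 + M.η) ^ 2) *
        M.respError r' (M.r h) (π h) (τ ⟨h, hh⟩).1 (τ ⟨h, hh⟩).2.2 ^ 2)) ∂(M.trajLaw π H) ≤ 1 := by
  have := hπ h hh
  have hr := M.isReward_r h
  set g : S → B → ℝ≥0∞ := fun s b => ENNReal.ofReal (Real.exp (
      (M.η * M.adv r' (π h) s b - M.η * M.adv (M.r h) (π h) s b) / 4 +
      M.η ^ 2 / (32 * (1 + M.η) ^ 2) * M.respError r' (M.r h) (π h) s b ^ 2)) with hg
  have hEm : Measurable fun p : S × B => M.respError r' (M.r h) (π h) p.1 p.2 := by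
    have h1 : Measurable fun p : Unit × S × B => M.respError r' (M.r h) (π h) p.2.1 p.2.2 :=
      M.measurable_respError_param (IsPolicyFamily.const (X := Unit) (π h)) hr (f := fun _ => r')
        (hr'.measurable.comp measurable_snd)
    have h2 := h1.comp (by fun_prop : Measurable fun p : S × B => ((), p))
    exact h2
  have hgm : Measurable fun p : S × B => g p.1 p.2 := by
    have h1 := M.measurable_adv (π := π h) hr'.measurable
    have h2 := M.measurable_adv (π := π h) hr.measurable
    simp only [hg]
    exact (((((h1.const_mul _).sub (h2.const_mul _)).div_const 4).add
      ((hEm.pow_const 2).const_mul _)).exp).ennreal_ofReal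
  have hgz : Measurable fun z : S × A × B => g z.1 z.2.2 := by
    have h1 := hgm.comp (by fun_prop : Measurable fun z : S × A × B => (z.1, z.2.2))
    exact h1
  refine le_trans (le_of_eq (M.lintegral_trajLaw_apply hπ hh hgz)) ?_
  rw [M.lintegral_stepLaw_response hπ hh hgm]
  have := M.isProbabilityMeasure_stateMarg hπ hh.le
  refine (lintegral_mono (g := fun _ => 1) fun s => ?_).trans (by simp)
  have := M.isProbabilityMeasure_quantalResponse (π := π h) hr s
  set Y : B → ℝ := fun b => M.η * M.adv r' (π h) s b - M.η * M.adv (M.r h) (π h) s b with hY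
  have ha := measurable_avg_sub (κ := π h) hr hr' s
  have hac := abs_avg_sub_le (κ := π h) hr hr' s
  have hYe := M.eta_mul_adv_sub (κ := π h) hr hr' s
  have hY1 : ∫ b, Real.exp (Y b) ∂(M.quantalResponse (M.r h) (π h) s) = 1 :=
    M.integral_exp_adv_sub hr hr' s
  have hYc := abs_log_density_le M.η_pos ha hac hYe hY1
  have hYm : Measurable Y := ((M.measurable_adv_right hr'.measurable s).const_mul _).sub
    ((M.measurable_adv_right hr.measurable s).const_mul _)
  have key := integral_exp_log_likelihood_le M.η_pos ha hac hYe hY1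
  simp only [hg]
  rw [← ENNReal.ofReal_one]
  refine lintegral_exp_le_of_integral_exp_le (c := M.η + M.η ^ 2 / (32 * (1 + M.η) ^ 2) * 4)
      ((hYm.div_const 4).add (((hEm.comp measurable_prodMk_left).pow_const 2).const_mul _))
      (fun b => ?_) key
  have h1 := hYc b
  have h2 := M.abs_respError_le (κ := π h) hr hr' s b
  have h3 : M.respError r' (M.r h) (π h) s b ^ 2 ≤ 4 := by
    rw [← sq_abs]; nlinarith [abs_nonneg (M.respError r' (M.r h) (π h) s b)]
  have h4 : 0 ≤ M.η ^ 2 / (32 * (1 + M.η) ^ 2) := by positivity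
  refine (abs_add_le _ _).trans (add_le_add ?_ ?_)
  · rw [abs_div, abs_of_pos (by norm_num : (0 : ℝ) < 4)]
    linarith [M.η_pos]
  · rw [abs_of_nonneg (mul_nonneg h4 (sq_nonneg _))]
    exact mul_le_mul_of_nonneg_left h3 h4

/-- Multiplicative concentration of a `[0, 1]`-valued function of one step around its mean. -/
theorem lintegral_exp_neg_add_mean_le {h : ℕ} (hh : h < H) {f : S × A × B → ℝ} (hf : Measurable f)
    (hf1 : ∀ z, f z ∈ Set.Icc (0 : ℝ) 1) :
    ∫⁻ τ, ENNReal.ofReal (Real.exp (-f (τ ⟨h, hh⟩) + (∫ z, f z ∂(M.stepLaw π h)) / 2))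
      ∂(M.trajLaw π H) ≤ 1 := by
  have := M.isProbabilityMeasure_stepLaw hπ hh
  have hm : Measurable fun z => ENNReal.ofReal
      (Real.exp (-f z + (∫ z, f z ∂(M.stepLaw π h)) / 2)) := by fun_prop
  rw [M.lintegral_trajLaw_apply hπ hh hm, ← ENNReal.ofReal_one]
  refine lintegral_exp_le_of_integral_exp_le (hf.neg.add_const _)
    (c := 1 + |∫ z, f z ∂(M.stepLaw π h)| / 2) (fun z => ?_) ?_
  · refine (abs_add_le _ _).trans (add_le_add ?_ ?_)
    · rw [Pi.neg_apply, abs_neg]; exact abs_le_of_mem_Icc_zero (hf1 z)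
    · rw [abs_div, abs_two]
  · simp_rw [Real.exp_add]
    rw [integral_mul_const]
    calc _ ≤ Real.exp (-(∫ z, f z ∂(M.stepLaw π h)) / 2) *
          Real.exp ((∫ z, f z ∂(M.stepLaw π h)) / 2) :=
          mul_le_mul_of_nonneg_right (integral_exp_neg_le hf hf1) (Real.exp_pos _).le
      _ = 1 := by rw [← Real.exp_add]; simp [neg_div]

end Single

end Game

end Episode

/-! ### Regularity of the classes -/

section Classes

theorem exists_finset_cover {X : Type*} {ρ : X → X → ℝ≥0∞} {s : Set X} {ε : ℝ≥0∞} {N : ℕ}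
    (h : coveringNumber ρ s ε ≤ N) :
    ∃ C : Finset X, (∀ y ∈ C, y ∈ s) ∧ (∀ x ∈ s, ∃ y ∈ C, ρ x y ≤ ε) ∧ C.card ≤ N := by
  classical
  have h1 : coveringNumber ρ s ε < (N + 1 : ℕ) :=
    lt_of_le_of_lt h (by exact_mod_cast Nat.lt_succ_self N)
  simp only [coveringNumber, iInf_lt_iff] at h1
  obtain ⟨C, hC, hcov, hlt⟩ := h1
  have hfin : C.Finite := Set.encard_lt_top_iff.1 (lt_of_lt_of_le hlt le_top)
  refine ⟨hfin.toFinset, fun y hy => hC (hfin.mem_toFinset.1 hy), fun x hx => ?_, ?_⟩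
  · obtain ⟨y, hy, hxy⟩ := hcov x hx
    exact ⟨y, hfin.mem_toFinset.2 hy, hxy⟩
  · rw [hfin.encard_eq_coe_toFinset_card] at hlt
    have : hfin.toFinset.card < N + 1 := by exact_mod_cast hlt
    omega

theorem le_of_iSup_ofReal_le {X : Type*} {f : X → ℝ} {T : ℕ} (hT : 1 ≤ T)
    (h : ⨆ x, ENNReal.ofReal (f x) ≤ (T : ℝ≥0∞)⁻¹) (x : X) : f x ≤ 1 / T := by
  have h1 := (le_iSup (fun x => ENNReal.ofReal (f x)) x).trans h
  have hT0 : (0 : ℝ) < T := by exact_mod_cast hT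
  rw [← ENNReal.ofReal_natCast, ← ENNReal.ofReal_inv_of_pos hT0] at h1
  rw [one_div]
  exact (ENNReal.ofReal_le_ofReal_iff (by positivity)).1 h1

variable {S A B Par : Type*} [MeasurableSpace S] [MeasurableSpace A] [MeasurableSpace B]
  {M : Game S A B} {K : Classes S A B Par} {H : ℕ}

namespace Classes

theorem Regular.isReward (hR : K.Regular H) {h : ℕ} (hh : h < H) {θ : Par} (hθ : θ ∈ K.Θ h) :
    IsReward (K.rew h θ) :=
  ⟨hR.measurable_rew h hh θ hθ, hR.rew_mem h hh θ hθ⟩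

theorem Topt_end (hR : K.Regular H) {U : ℕ → S × A × B → ℝ} (hU : U ∈ K.U) (θ : ℕ → Par) :
    K.Topt M H θ (U H) = 0 := by
  funext s
  rw [hR.U_end U hU H le_rfl]
  simp [Topt, Game.optOp, Game.evalOp, avg]

theorem measurable_Topt (hR : K.Regular H) (hA : K.MaxAttained M H)
    {U : ℕ → S × A × B → ℝ} (hU : U ∈ K.U) {θ : ℕ → Par} (hθ : θ ∈ K.params H) {h : ℕ}
    (hh : h ≤ H) : Measurable (K.Topt M h θ (U h)) := by
  rcases hh.lt_or_eq with hh | rfl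
  · obtain ⟨π, hπ, he⟩ := hA U hU θ hθ h hh
    have := hR.isMarkov h hh π hπ
    rw [← funext he]
    exact M.measurable_evalOp (hR.isReward hh (hθ h hh)) (hR.measurable_U U hU h) (hR.U_le U hU h)
  · rw [Topt_end hR hU]
    exact measurable_const

theorem abs_Topt_le (hR : K.Regular H) (hA : K.MaxAttained M H)
    {U : ℕ → S × A × B → ℝ} (hU : U ∈ K.U) {θ : ℕ → Par} (hθ : θ ∈ K.params H) {h : ℕ}
    (hh : h ≤ H) (s : S) : |K.Topt M h θ (U h) s| ≤ H := by
  rcases hh.lt_or_eq with hh | rfl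
  · obtain ⟨π, hπ, he⟩ := hA U hU θ hθ h hh
    have := hR.isMarkov h hh π hπ
    rw [← he s]
    exact M.abs_evalOp_le (hR.isReward hh (hθ h hh)) s (hR.U_le U hU h)
  · rw [Topt_end hR hU]
    simp

theorem evalOp_le_Topt (hR : K.Regular H) {U : ℕ → S × A × B → ℝ} (hU : U ∈ K.U) {θ : ℕ → Par}
    (hθ : θ ∈ K.params H) {h : ℕ} (hh : h < H) {π : Kernel (S × B) A} (hπ : π ∈ K.Pol h) (s : S) :
    M.evalOp (K.rew h (θ h)) π (U h) s ≤ K.Topt M h θ (U h) s := by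
  have hb : BddAbove (Set.range fun π : K.Pol h => M.evalOp (K.rew h (θ h)) π.1 (U h) s) := by
    refine ⟨H, ?_⟩
    rintro _ ⟨π, rfl⟩
    have := hR.isMarkov h hh π.1 π.2
    exact (le_abs_self _).trans
      (M.abs_evalOp_le (hR.isReward hh (hθ h hh)) s (hR.U_le U hU h))
  exact le_ciSup hb ⟨π, hπ⟩

theorem measurable_bellmanOpt (hR : K.Regular H) (hA : K.MaxAttained M H)
    {U : ℕ → S × A × B → ℝ} (hU : U ∈ K.U) {θ : ℕ → Par} (hθ : θ ∈ K.params H) {h : ℕ}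
    (hh : h < H) : Measurable (K.bellmanOpt M h θ (U (h + 1))) :=
  (M.measurable_u h).add (measurable_integral_param (M.P h).measurable
    ((measurable_Topt hR hA hU hθ hh).comp measurable_snd))

theorem abs_sub_bellmanOpt_le (hR : K.Regular H) (hA : K.MaxAttained M H)
    {U U' : ℕ → S × A × B → ℝ} (hU : U ∈ K.U) (hU' : U' ∈ K.U) {θ : ℕ → Par}
    (hθ : θ ∈ K.params H) {h : ℕ} (hh : h < H) (z : S × A × B) :
    |U h z - K.bellmanOpt M h θ (U' (h + 1)) z| ≤ 3 * H := by
  have hH1 : (1 : ℝ) ≤ H := by exact_mod_cast (by omega : 1 ≤ H)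
  have h1 := abs_le.1 (abs_integral_le_of_bounded (μ := M.P h z)
    (abs_Topt_le hR hA hU' hθ (h := h + 1) hh))
  have h2 := M.u_mem h z
  have h3 := abs_le.1 (hR.U_le U hU h z)
  rw [bellmanOpt, abs_le]
  constructor <;> linarith [h2.1, h2.2]

end Classes

end Classes

/-! ### Stability of the losses under perturbations of the parameters -/

section Stability

variable {S A B : Type*} [MeasurableSpace S] [MeasurableSpace A] [MeasurableSpace B]
  (M : Game S A B)

theorem abs_sq_sub_sq_le {x y c d : ℝ} (hx : |x| ≤ c) (hy : |y| ≤ c) (hxy : |x - y| ≤ d) :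
    |x ^ 2 - y ^ 2| ≤ d * (2 * c) := by
  have e : x ^ 2 - y ^ 2 = (x - y) * (x + y) := by ring
  rw [e, abs_mul]
  exact mul_le_mul hxy ((abs_add_le x y).trans (by linarith)) (abs_nonneg _)
    ((abs_nonneg _).trans hxy)

variable {r r₁ r₂ : S × A × B → ℝ} {κ : Kernel (S × B) A} [IsMarkovKernel κ]

theorem abs_avg_sub_avg_le (h₁ : IsReward r₁) (h₂ : IsReward r₂) {ε : ℝ}
    (hε : ∀ z, |r₁ z - r₂ z| ≤ ε) (s : S) (b : B) : |avg r₁ κ s b - avg r₂ κ s b| ≤ ε := by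
  rw [← Game.avg_sub_reward h₂ h₁]
  exact abs_avg_le hε s b

theorem Game.log_partition_le (h₁ : IsReward r₁) (h₂ : IsReward r₂) {ε : ℝ}
    (hε : ∀ z, |r₁ z - r₂ z| ≤ ε) (s : S) :
    Real.log (M.partition r₁ κ s) ≤ Real.log (M.partition r₂ κ s) + M.η * ε := by
  have h : M.partition r₁ κ s ≤ M.partition r₂ κ s * Real.exp (M.η * ε) := by
    rw [partition, partition, ← integral_mul_const]
    refine integral_mono (M.integrable_exp_avg h₁ s) ((M.integrable_exp_avg h₂ s).mul_const _)
      fun b => ?_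
    simp only
    rw [← Real.exp_add]
    refine Real.exp_le_exp.2 ?_
    have := (abs_le.1 (abs_avg_sub_avg_le (κ := κ) h₁ h₂ hε s b)).2
    nlinarith [M.η_pos]
  calc Real.log (M.partition r₁ κ s)
      ≤ Real.log (M.partition r₂ κ s * Real.exp (M.η * ε)) :=
        Real.log_le_log (M.partition_pos h₁ s) h
    _ = _ := by
        rw [Real.log_mul (M.partition_pos h₂ s).ne' (Real.exp_pos _).ne', Real.log_exp]

theorem Game.abs_eta_adv_sub_le (h₁ : IsReward r₁) (h₂ : IsReward r₂) {ε : ℝ}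
    (hε : ∀ z, |r₁ z - r₂ z| ≤ ε) (s : S) (b : B) :
    |M.η * M.adv r₁ κ s b - M.η * M.adv r₂ κ s b| ≤ 2 * (M.η * ε) := by
  have hε' : ∀ z, |r₂ z - r₁ z| ≤ ε := fun z => by rw [abs_sub_comm]; exact hε z
  have h3 := M.log_partition_le (κ := κ) h₁ h₂ hε s
  have h4 := M.log_partition_le (κ := κ) h₂ h₁ hε' s
  have h5 := abs_le.1 (abs_avg_sub_avg_le (κ := κ) h₁ h₂ hε s b)
  rw [M.eta_mul_adv, M.eta_mul_adv, abs_le]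
  constructor <;> nlinarith [M.η_pos]

theorem Game.abs_respError_sub_le (hr : IsReward r) (h₁ : IsReward r₁) (h₂ : IsReward r₂) {ε : ℝ}
    (hε : ∀ z, |r₁ z - r₂ z| ≤ ε) (s : S) (b : B) :
    |M.respError r₁ r κ s b - M.respError r₂ r κ s b| ≤ 2 * ε := by
  have := M.isProbabilityMeasure_quantalResponse (π := κ) hr s
  have hd : ∀ b, |avg (fun z => r₁ z - r z) κ s b - avg (fun z => r₂ z - r z) κ s b| ≤ ε :=
    fun b => by
      rw [avg_sub_reward hr h₁, avg_sub_reward hr h₂, sub_sub_sub_cancel_right]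
      exact abs_avg_sub_avg_le h₁ h₂ hε s b
  have h3 : |∫ b, avg (fun z => r₁ z - r z) κ s b ∂(M.quantalResponse r κ s) -
      ∫ b, avg (fun z => r₂ z - r z) κ s b ∂(M.quantalResponse r κ s)| ≤ ε := by
    rw [← integral_sub (integrable_of_bounded (measurable_avg_sub hr h₁ s)
      (abs_avg_sub_le hr h₁ s)) (integrable_of_bounded (measurable_avg_sub hr h₂ s)
      (abs_avg_sub_le hr h₂ s))]
    exact abs_integral_le_of_bounded hd
  have h4 := abs_le.1 h3
  have h5 := abs_le.1 (hd b)
  rw [respError, respError, abs_le]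
  constructor <;> linarith

end Stability

/-! ### The event on which all confidence bounds hold -/

section Event

variable {S A B Par : Type*} [MeasurableSpace S] [MeasurableSpace A] [MeasurableSpace B]

namespace Learner

variable {H : ℕ} (M : Game S A B) (K : Classes S A B Par) (L : Learner S A B Par H)

/-- The random part `V(s_{h+1})` of the regression target at step `h`, absent at the last step. -/
noncomputable def nextValue (V : S → ℝ) (h : Fin H) (τ : Fin H → S × A × B) : ℝ :=
  if hh : (h : ℕ) + 1 < H then V (τ ⟨h + 1, hh⟩).1 else 0

/-- Exponential supermartingale increment for the excess Bellman loss of `U_h` over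
`𝕋_h^{*, θ} U'_{h+1}`, for a triple `(U, U', θ)`. -/
noncomputable def bellmanIncr (h : Fin H)
    (p : (ℕ → S × A × B → ℝ) × (ℕ → S × A × B → ℝ) × (ℕ → Par)) (t : ℕ) (x : Hist S A B H t)
    (τ : Fin H → S × A × B) : ℝ :=
  -(((p.1 h (τ h) - M.u h (τ h) - nextValue (K.Topt M (h + 1) p.2.2 (p.2.1 (h + 1))) h τ) ^ 2 -
      (K.bellmanOpt M h p.2.2 (p.2.1 (h + 1)) (τ h) - M.u h (τ h) -
        nextValue (K.Topt M (h + 1) p.2.2 (p.2.1 (h + 1))) h τ) ^ 2) / (8 * (H : ℝ) ^ 2)) +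
    (∫ z, (p.1 h z - K.bellmanOpt M h p.2.2 (p.2.1 (h + 1)) z) ^ 2
      ∂(M.stepLaw (L.policyAt t x) h)) / (32 * (H : ℝ) ^ 2)

/-- Cumulative mean squared Bellman error of the triple `(U, U', θ)` at step `h` under the policies
announced so far. -/
noncomputable def bellmanRisk (h : Fin H)
    (p : (ℕ → S × A × B → ℝ) × (ℕ → S × A × B → ℝ) × (ℕ → Par)) {t : ℕ} (x : Hist S A B H t) : ℝ :=
  ∑ i : Fin t, ∫ z, (p.1 h z - K.bellmanOpt M h p.2.2 (p.2.1 (h + 1)) z) ^ 2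
    ∂(M.stepLaw (L.policyAt i (x.before i)) h)

theorem additive_bellmanIncr (h : Fin H)
    (p : (ℕ → S × A × B → ℝ) × (ℕ → S × A × B → ℝ) × (ℕ → Par)) {t : ℕ} (x : Hist S A B H t) :
    x.additive (L.bellmanIncr M K h p) =
      -((bellmanLoss M K x h (p.1 h) (p.2.1 (h + 1)) p.2.2 -
        bellmanLoss M K x h (K.bellmanOpt M h p.2.2 (p.2.1 (h + 1))) (p.2.1 (h + 1)) p.2.2) /
          (8 * (H : ℝ) ^ 2)) + L.bellmanRisk M K h p x / (32 * (H : ℝ) ^ 2) := by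
  simp only [Hist.additive, bellmanIncr, bellmanRisk, bellmanLoss, nextValue,
    Finset.sum_add_distrib, Finset.sum_neg_distrib, ← Finset.sum_div, Finset.sum_sub_distrib]

/-- Exponential supermartingale increment for the log-likelihood ratio of the parameter `θ` and its
squared response error. -/
noncomputable def likelihoodIncr (h : Fin H) (θ : Par) (t : ℕ) (x : Hist S A B H t)
    (τ : Fin H → S × A × B) : ℝ :=
  (M.η * M.adv (K.rew h θ) (L.policyAt t x h) (τ h).1 (τ h).2.2 -
      M.η * M.adv (M.r h) (L.policyAt t x h) (τ h).1 (τ h).2.2) / 4 +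
    M.η ^ 2 / (32 * (1 + M.η) ^ 2) *
      M.respError (K.rew h θ) (M.r h) (L.policyAt t x h) (τ h).1 (τ h).2.2 ^ 2

/-- Cumulative squared response error of `θ` on the data. -/
noncomputable def responseRisk (h : Fin H) (θ : Par) {t : ℕ} (x : Hist S A B H t) : ℝ :=
  ∑ i : Fin t, M.respError (K.rew h θ) (M.r h) (L.policyAt i (x.before i) h) (x i h).1
    (x i h).2.2 ^ 2

theorem additive_likelihoodIncr (h : Fin H) {θs : Par} (hθs : K.rew h θs = M.r h) (θ : Par) {t : ℕ}
    (x : Hist S A B H t) : x.additive (L.likelihoodIncr M K h θ) =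
      (L.negLogLik M K x h θs - L.negLogLik M K x h θ) / 4 +
        M.η ^ 2 / (32 * (1 + M.η) ^ 2) * L.responseRisk M K h θ x := by
  simp only [Hist.additive, likelihoodIncr, responseRisk, negLogLik, hθs,
    Finset.sum_add_distrib, ← Finset.sum_div, Finset.sum_sub_distrib, ← Finset.mul_sum]
  ring

/-- Response error of the estimated reward, clipped at its largest possible value `2` so as to be
bounded on all data. -/
noncomputable def estimateError (h : Fin H) (t : ℕ) (x : Hist S A B H t) (z : S × A × B) : ℝ :=
  min |M.respError (K.rew h (L.θhat t x h)) (M.r h) (L.policyAt t x h) z.1 z.2.2| 2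

/-- The function `η e + 2 η² exp(2 η) e²` that bounds the error of the estimated response in terms
of the response error `e`. -/
noncomputable def _root_.QSE.Game.responseBound (M : Game S A B) (e : ℝ) : ℝ :=
  M.η * e + 2 * M.η ^ 2 * Real.exp (2 * M.η) * e ^ 2

theorem _root_.QSE.Game.responseBound_two_pos : 0 < M.responseBound 2 := by
  have := M.η_pos
  rw [Game.responseBound]
  positivity

theorem _root_.QSE.Game.responseBound_mono {e e' : ℝ} (h0 : 0 ≤ e) (h : e ≤ e') :
    M.responseBound e ≤ M.responseBound e' := by
  have := M.η_pos
  rw [Game.responseBound, Game.responseBound]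
  gcongr

/-- Bound on the error of the estimated response, normalised to `[0, 1]`. -/
noncomputable def predictionError (h : Fin H) (t : ℕ) (x : Hist S A B H t) (z : S × A × B) : ℝ :=
  M.responseBound (L.estimateError M K h t x z) / M.responseBound 2

theorem predictionError_mem (h : Fin H) (t : ℕ) (x : Hist S A B H t) (z : S × A × B) :
    L.predictionError M K h t x z ∈ Set.Icc (0 : ℝ) 1 := by
  have h0 : 0 ≤ L.estimateError M K h t x z := le_min (abs_nonneg _) (by norm_num)
  have h2 : L.estimateError M K h t x z ≤ 2 := min_le_right _ _
  have h3 : 0 ≤ M.responseBound (L.estimateError M K h t x z) := by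
    have := M.η_pos
    rw [Game.responseBound]
    positivity
  exact ⟨div_nonneg h3 M.responseBound_two_pos.le,
    (div_le_one M.responseBound_two_pos).2 (M.responseBound_mono h0 h2)⟩

/-- Exponential supermartingale increment comparing the error of the estimated response to its
conditional mean. -/
noncomputable def predictionIncr (h : Fin H) (t : ℕ) (x : Hist S A B H t)
    (τ : Fin H → S × A × B) : ℝ :=
  -L.predictionError M K h t x (τ h) +
    (∫ z, L.predictionError M K h t x z ∂(M.stepLaw (L.policyAt t x) h)) / 2

variable {M K L}

section Increments

variable {T : ℕ} (hR : K.Regular H)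
  (hpol : ∀ t < T, ∀ h < H, IsPolicyFamily fun x : Hist S A B H t => L.policyAt t x h)

theorem measurable_integral_stepLaw {Y : Type*} [MeasurableSpace Y] {π : Y → ℕ → Kernel (S × B) A}
    (hπ : ∀ h < H, IsPolicyFamily fun x => π x h) {h : ℕ} (hh : h < H) {f : Y → S × A × B → ℝ}
    (hf : Measurable fun p : Y × (S × A × B) => f p.1 p.2) :
    Measurable fun x => ∫ z, f x z ∂(M.stepLaw (π x) h) := by
  have : ∀ x, IsProbabilityMeasure (M.stepLaw (π x) h) := fun x =>
    M.isProbabilityMeasure_stepLaw (fun h hh => (hπ h hh).isMarkov x) hh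
  have h1 := M.measurable_stepLaw_param hπ hh
  exact measurable_integral_param h1 hf

include hR hpol

theorem measurable_bellmanIncr (hA : K.MaxAttained M H) (h : Fin H)
    {p : (ℕ → S × A × B → ℝ) × (ℕ → S × A × B → ℝ) × (ℕ → Par)}
    (hp : p ∈ K.U ×ˢ K.U ×ˢ K.params H) (t : ℕ) (ht : t < T) :
    Measurable fun q : Hist S A B H t × (Fin H → S × A × B) =>
      L.bellmanIncr M K h p t q.1 q.2 := by
  obtain ⟨hU, hU', hθ⟩ := hp
  have h1 := hR.measurable_U _ hU h
  have h2 := M.measurable_u h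
  have h3 := Classes.measurable_bellmanOpt hR hA hU' hθ h.2
  have h4 := Classes.measurable_Topt hR hA hU' hθ (h := h + 1) h.2
  have h5 : Measurable fun τ : Fin H → S × A × B =>
      nextValue (K.Topt M (h + 1) p.2.2 (p.2.1 (h + 1))) h τ := by
    unfold nextValue
    split_ifs with hh
    · exact h4.comp (measurable_fst.comp (measurable_pi_apply _))
    · exact measurable_const
  have h6 : Measurable fun x : Hist S A B H t =>
      ∫ z, (p.1 h z - K.bellmanOpt M h p.2.2 (p.2.1 (h + 1)) z) ^ 2
        ∂(M.stepLaw (L.policyAt t x) h) :=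
    measurable_integral_stepLaw (hpol t ht) h.2
      (((h1.sub h3).pow_const 2).comp measurable_snd)
  have h7 : Measurable fun τ : Fin H → S × A × B =>
      ((p.1 h (τ h) - M.u h (τ h) - nextValue (K.Topt M (h + 1) p.2.2 (p.2.1 (h + 1))) h τ) ^ 2 -
      (K.bellmanOpt M h p.2.2 (p.2.1 (h + 1)) (τ h) - M.u h (τ h) -
        nextValue (K.Topt M (h + 1) p.2.2 (p.2.1 (h + 1))) h τ) ^ 2) / (8 * (H : ℝ) ^ 2) := by
    have hτ : Measurable fun τ : Fin H → S × A × B => τ h := measurable_pi_apply h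
    exact (((((h1.comp hτ).sub (h2.comp hτ)).sub h5).pow_const 2).sub
      ((((h3.comp hτ).sub (h2.comp hτ)).sub h5).pow_const 2)).div_const _
  exact (h7.comp measurable_snd).neg.add ((h6.comp measurable_fst).div_const _)

theorem lintegral_exp_bellmanIncr_le (hA : K.MaxAttained M H) (h : Fin H)
    {p : (ℕ → S × A × B → ℝ) × (ℕ → S × A × B → ℝ) × (ℕ → Par)}
    (hp : p ∈ K.U ×ˢ K.U ×ˢ K.params H) (t : ℕ) (ht : t < T) (x : Hist S A B H t) :
    ∫⁻ τ, ENNReal.ofReal (Real.exp (L.bellmanIncr M K h p t x τ))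
      ∂(M.trajLaw (L.policyAt t x) H) ≤ 1 := by
  obtain ⟨hU, hU', hθ⟩ := hp
  refine M.lintegral_exp_bellman_le (fun k hk => (hpol t ht k hk).isMarkov x) h.2
    (hR.measurable_U _ hU h) (hR.U_le _ hU h) (Classes.measurable_Topt hR hA hU' hθ (h := h + 1) h.2)
    (Classes.abs_Topt_le hR hA hU' hθ (h := h + 1) h.2) (fun hH => ?_) (fun z => rfl)
  rw [hH]
  exact Classes.Topt_end hR hU' _

theorem measurable_likelihoodIncr (h : Fin H) {θ : Par} (hθ : θ ∈ K.Θ h) (t : ℕ) (ht : t < T) :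
    Measurable fun q : Hist S A B H t × (Fin H → S × A × B) =>
      L.likelihoodIncr M K h θ t q.1 q.2 := by
  have hr := hR.isReward h.2 hθ
  have hproj : Measurable fun q : Hist S A B H t × (Fin H → S × A × B) =>
      (q.1, (q.2 h).1, (q.2 h).2.2) := by fun_prop
  have h1 := (M.measurable_adv_param (hpol t ht h h.2) (f := fun _ => K.rew h θ)
    (hr.measurable.comp measurable_snd)).comp hproj
  have h2 := (M.measurable_adv_param (hpol t ht h h.2) (f := fun _ => M.r h)
    ((M.measurable_r h).comp measurable_snd)).comp hproj
  have h3 := (M.measurable_respError_param (hpol t ht h h.2) (M.isReward_r h)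
    (f := fun _ => K.rew h θ) (hr.measurable.comp measurable_snd)).comp hproj
  have h4 := (((h1.const_mul M.η).sub (h2.const_mul M.η)).div_const 4).add
    ((h3.pow_const 2).const_mul (M.η ^ 2 / (32 * (1 + M.η) ^ 2)))
  exact h4

theorem lintegral_exp_likelihoodIncr_le (h : Fin H) {θ : Par} (hθ : θ ∈ K.Θ h) (t : ℕ)
    (ht : t < T) (x : Hist S A B H t) :
    ∫⁻ τ, ENNReal.ofReal (Real.exp (L.likelihoodIncr M K h θ t x τ))
      ∂(M.trajLaw (L.policyAt t x) H) ≤ 1 :=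
  M.lintegral_exp_likelihood_le (fun k hk => (hpol t ht k hk).isMarkov x) h.2
    (hR.isReward h.2 hθ)

omit hR

theorem measurable_predictionError (hrew : ∀ t < T, ∀ h < H,
      Measurable fun p : Hist S A B H t × (S × A × B) => K.rew h (L.θhat t p.1 h) p.2)
    (h : Fin H) (t : ℕ) (ht : t < T) :
    Measurable fun q : Hist S A B H t × (S × A × B) => L.predictionError M K h t q.1 q.2 := by
  have h0 := M.measurable_respError_param (hpol t ht h h.2) (M.isReward_r h)
    (f := fun x => K.rew h (L.θhat t x h)) (hrew t ht h h.2)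
  have hproj : Measurable fun q : Hist S A B H t × (S × A × B) => (q.1, q.2.1, q.2.2.2) := by
    fun_prop
  have h1 := h0.comp hproj
  have h2 : Measurable fun q : Hist S A B H t × (S × A × B) => L.estimateError M K h t q.1 q.2 := by
    unfold estimateError
    have h4 := (continuous_abs.measurable.comp h1).min (measurable_const (a := (2 : ℝ)))
    exact h4
  have h3 : Measurable M.responseBound := by
    unfold Game.responseBound
    fun_prop
  unfold predictionError
  have h4 := (h3.comp h2).div_const (M.responseBound 2)
  exact h4

theorem measurable_predictionIncr (hrew : ∀ t < T, ∀ h < H,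
      Measurable fun p : Hist S A B H t × (S × A × B) => K.rew h (L.θhat t p.1 h) p.2)
    (h : Fin H) (t : ℕ) (ht : t < T) :
    Measurable fun q : Hist S A B H t × (Fin H → S × A × B) =>
      L.predictionIncr M K h t q.1 q.2 := by
  have h1 := measurable_predictionError (M := M) hpol hrew h t ht
  have h2 : Measurable fun x : Hist S A B H t => ∫ z, L.predictionError M K h t x z
      ∂(M.stepLaw (L.policyAt t x) h) := measurable_integral_stepLaw (hpol t ht) h.2 h1
  have hproj : Measurable fun q : Hist S A B H t × (Fin H → S × A × B) => (q.1, q.2 h) := by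
    fun_prop
  have h3 := h1.comp hproj
  have h4 := h3.neg.add ((h2.comp measurable_fst).div_const 2)
  exact h4

theorem lintegral_exp_predictionIncr_le (hrew : ∀ t < T, ∀ h < H,
      Measurable fun p : Hist S A B H t × (S × A × B) => K.rew h (L.θhat t p.1 h) p.2)
    (h : Fin H) (t : ℕ) (ht : t < T) (x : Hist S A B H t) :
    ∫⁻ τ, ENNReal.ofReal (Real.exp (L.predictionIncr M K h t x τ))
      ∂(M.trajLaw (L.policyAt t x) H) ≤ 1 := by
  have h1 := measurable_predictionError (M := M) hpol hrew h t ht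
  have h2 : Measurable (L.predictionError M K h t x) := by
    have h3 := h1.comp (measurable_prodMk_left (x := x))
    exact h3
  have h4 := M.lintegral_exp_neg_add_mean_le (fun k hk => (hpol t ht k hk).isMarkov x) h.2 h2
    (L.predictionError_mem M K h t x)
  exact h4

end Increments

end Learner

end Event

section GoodEvent

variable {S A B Par : Type*}

theorem Hist.additive_le_additive_add {H n : ℕ}
    {W W' : (t : ℕ) → Hist S A B H t → (Fin H → S × A × B) → ℝ} {c : ℝ}
    (hW : ∀ t < n, ∀ y τ, W t y τ ≤ W' t y τ + c) (x : Hist S A B H n) :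
    x.additive W ≤ x.additive W' + n * c := by
  have h : x.additive W ≤ ∑ i : Fin n, (W' i (x.before i) (x i) + c) :=
    Finset.sum_le_sum fun i _ => hW i i.2 _ _
  refine h.trans (le_of_eq ?_)
  rw [Finset.sum_add_distrib, Hist.additive]
  simp

variable [MeasurableSpace S] [MeasurableSpace A] [MeasurableSpace B]

namespace Learner

variable {H : ℕ} {M : Game S A B} {K : Classes S A B Par} {L : Learner S A B Par H}

theorem bellmanIncr_le_add (hR : K.Regular H) (hA : K.MaxAttained M H) {T t : ℕ} (hT : 1 ≤ T)
    (h : Fin H) {p p' : (ℕ → S × A × B → ℝ) × (ℕ → S × A × B → ℝ) × (ℕ → Par)}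
    (hp : p ∈ K.U ×ˢ K.U ×ˢ K.params H) (hp' : p' ∈ K.U ×ˢ K.U ×ˢ K.params H)
    (hd : K.distZ M h p p' ≤ (T : ℝ≥0∞)⁻¹) (x : Hist S A B H t)
    (hpol : ∀ k < H, IsMarkovKernel (L.policyAt t x k)) (τ : Fin H → S × A × B) :
    L.bellmanIncr M K h p t x τ ≤ L.bellmanIncr M K h p' t x τ + 4 / T := by
  have hlaw := M.isProbabilityMeasure_stepLaw hpol h.2
  have hH1 : (1 : ℝ) ≤ H := by exact_mod_cast h.pos
  have hT0 : (0 : ℝ) < 1 / T := by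
    have : (0 : ℝ) < T := by exact_mod_cast hT
    positivity
  obtain ⟨hU, hV, hθ⟩ := hp
  obtain ⟨hU', hV', hθ'⟩ := hp'
  set δ : ℝ := 1 / T with hδ
  -- the two components of the distance
  have hd1 : ∀ z, |p.1 h z - p'.1 h z| ≤ δ := le_of_iSup_ofReal_le hT ((le_max_left _ _).trans hd)
  have hd2 : ∀ s, |K.Topt M (h + 1) p.2.2 (p.2.1 (h + 1)) s -
      K.Topt M (h + 1) p'.2.2 (p'.2.1 (h + 1)) s| ≤ δ :=
    le_of_iSup_ofReal_le hT ((le_max_right _ _).trans hd)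
  have hm := Classes.measurable_Topt hR hA hV hθ (h := h + 1) h.2
  have hm' := Classes.measurable_Topt hR hA hV' hθ' (h := h + 1) h.2
  have hb := Classes.abs_Topt_le hR hA hV hθ (h := h + 1) h.2
  have hb' := Classes.abs_Topt_le hR hA hV' hθ' (h := h + 1) h.2
  have hB1 := Classes.abs_sub_bellmanOpt_le (M := M) hR hA hU hV hθ h.2
  have hB1' := Classes.abs_sub_bellmanOpt_le (M := M) hR hA hU' hV' hθ' h.2
  have hmB := Classes.measurable_bellmanOpt (M := M) hR hA hV hθ h.2
  have hmB' := Classes.measurable_bellmanOpt (M := M) hR hA hV' hθ' h.2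
  have hmU := hR.measurable_U _ hU h
  have hmU' := hR.measurable_U _ hU' h
  have hUb := hR.U_le _ hU h
  have hUb' := hR.U_le _ hU' h
  have hd3 : ∀ z, |K.bellmanOpt M h p.2.2 (p.2.1 (h + 1)) z -
      K.bellmanOpt M h p'.2.2 (p'.2.1 (h + 1)) z| ≤ δ := fun z => by
    have := M.isMarkov_P h
    rw [Classes.bellmanOpt, Classes.bellmanOpt, add_sub_add_left_eq_sub,
      ← integral_sub (integrable_of_bounded hm hb) (integrable_of_bounded hm' hb')]
    exact abs_integral_le_of_bounded hd2
  have hBb : ∀ z, |K.bellmanOpt M h p.2.2 (p.2.1 (h + 1)) z - M.u h z| ≤ H := fun z => by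
    rw [Classes.bellmanOpt, add_sub_cancel_left]
    exact abs_integral_le_of_bounded hb
  have hBb' : ∀ z, |K.bellmanOpt M h p'.2.2 (p'.2.1 (h + 1)) z - M.u h z| ≤ H := fun z => by
    rw [Classes.bellmanOpt, add_sub_cancel_left]
    exact abs_integral_le_of_bounded hb'
  set v := nextValue (K.Topt M (h + 1) p.2.2 (p.2.1 (h + 1))) h τ with hv
  set v' := nextValue (K.Topt M (h + 1) p'.2.2 (p'.2.1 (h + 1))) h τ with hv'
  have hvb : |v| ≤ H := by
    rw [hv, nextValue]; split_ifs
    · exact hb _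
    · simp
  have hvb' : |v'| ≤ H := by
    rw [hv', nextValue]; split_ifs
    · exact hb' _
    · simp
  have hvv : |v - v'| ≤ δ := by
    rw [hv, hv', nextValue, nextValue]; split_ifs
    · exact hd2 _
    · simpa using hT0.le
  have hu := M.u_mem h (τ h)
  clear_value v v' δ
  have hUτ := abs_le.1 (hUb (τ h))
  have hUτ' := abs_le.1 (hUb' (τ h))
  have hBτ := abs_le.1 (hBb (τ h))
  have hBτ' := abs_le.1 (hBb' (τ h))
  have hd1τ := abs_le.1 (hd1 (τ h))
  have hd3τ := abs_le.1 (hd3 (τ h))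
  rw [abs_le] at hvb hvb' hvv
  have e1 := abs_sq_sub_sq_le (x := p'.1 h (τ h) - M.u h (τ h) - v')
    (y := p.1 h (τ h) - M.u h (τ h) - v) (c := 3 * H) (d := 2 * δ)
    (by rw [abs_le]; constructor <;> linarith [hu.1, hu.2])
    (by rw [abs_le]; constructor <;> linarith [hu.1, hu.2])
    (by rw [abs_le]; constructor <;> linarith [hu.1, hu.2])
  have e2 := abs_sq_sub_sq_le (x := K.bellmanOpt M h p'.2.2 (p'.2.1 (h + 1)) (τ h) -
      M.u h (τ h) - v')
    (y := K.bellmanOpt M h p.2.2 (p.2.1 (h + 1)) (τ h) - M.u h (τ h) - v) (c := 3 * H) (d := 2 * δ)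
    (by rw [abs_le]; constructor <;> linarith [hu.1, hu.2])
    (by rw [abs_le]; constructor <;> linarith [hu.1, hu.2])
    (by rw [abs_le]; constructor <;> linarith [hu.1, hu.2])
  have e3 : ∀ z, |(p.1 h z - K.bellmanOpt M h p.2.2 (p.2.1 (h + 1)) z) ^ 2 -
      (p'.1 h z - K.bellmanOpt M h p'.2.2 (p'.2.1 (h + 1)) z) ^ 2| ≤ 2 * δ * (2 * (3 * H)) :=
    fun z => abs_sq_sub_sq_le (hB1 z) (hB1' z) (by
      have h1 := abs_le.1 (hd1 z)
      have h2 := abs_le.1 (hd3 z)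
      rw [abs_le]; constructor <;> linarith)
  have sq : ∀ {y c : ℝ}, |y| ≤ c → |y ^ 2| ≤ c ^ 2 := fun hy => by
    rw [abs_pow]; exact pow_le_pow_left₀ (abs_nonneg _) hy 2
  have e4 := abs_integral_le_of_bounded (μ := M.stepLaw (L.policyAt t x) h) e3
  have i1 : Integrable (fun z => (p.1 h z - K.bellmanOpt M h p.2.2 (p.2.1 (h + 1)) z) ^ 2)
      (M.stepLaw (L.policyAt t x) h) :=
    integrable_of_bounded ((hmU.sub hmB).pow_const 2) fun z => sq (hB1 z)
  have i2 : Integrable (fun z => (p'.1 h z - K.bellmanOpt M h p'.2.2 (p'.2.1 (h + 1)) z) ^ 2)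
      (M.stepLaw (L.policyAt t x) h) :=
    integrable_of_bounded ((hmU'.sub hmB').pow_const 2) fun z => sq (hB1' z)
  rw [integral_sub i1 i2] at e4
  have hH2 : (H : ℝ) ≤ (H : ℝ) ^ 2 := by nlinarith
  have hp2 : (0 : ℝ) < (H : ℝ) ^ 2 := by positivity
  have key : ∀ {a b c : ℝ}, 0 < c → |a - b| ≤ 2 * δ * (2 * (3 * H)) →
      a / (c * (H : ℝ) ^ 2) ≤ b / (c * (H : ℝ) ^ 2) + 12 * δ / c := fun {a b c} hc hab => by
    have h1 := (abs_le.1 hab).2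
    have h2 : 12 * δ / c = 12 * δ * (H : ℝ) ^ 2 / (c * (H : ℝ) ^ 2) := by field_simp
    rw [h2, ← add_div]
    refine div_le_div_of_nonneg_right ?_ (by positivity)
    nlinarith
  have f1 := key (c := 8) (by norm_num) e1
  have f2 := key (c := 8) (by norm_num) (by rw [abs_sub_comm]; exact e2)
  have f3 := key (c := 32) (by norm_num) e4
  have h4 : 4 / (T : ℝ) = 4 * δ := by rw [hδ]; ring
  rw [h4, bellmanIncr, bellmanIncr, ← hv, ← hv', sub_div, sub_div]
  linarith

theorem likelihoodIncr_le_add (hR : K.Regular H) {T t : ℕ} (hT : 1 ≤ T) (h : Fin H) {θ θ' : Par}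
    (hθ : θ ∈ K.Θ h) (hθ' : θ' ∈ K.Θ h) (hd : K.distΘ M h θ θ' ≤ (T : ℝ≥0∞)⁻¹)
    (x : Hist S A B H t) (hpol : ∀ k < H, IsMarkovKernel (L.policyAt t x k))
    (τ : Fin H → S × A × B) :
    L.likelihoodIncr M K h θ t x τ ≤ L.likelihoodIncr M K h θ' t x τ + 1 / T := by
  have := hpol h h.2
  have hη := M.η_pos
  have hr := hR.isReward h.2 hθ
  have hr' := hR.isReward h.2 hθ'
  set ε : ℝ := 1 / T / (1 + M.η) with hε
  have hεT : (1 + M.η) * ε = 1 / T := by rw [hε]; field_simp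
  have hε0 : 0 ≤ ε := by rw [hε]; positivity
  have hdz : ∀ z, |K.rew h θ z - K.rew h θ' z| ≤ ε := fun z => by
    have h1 := le_of_iSup_ofReal_le hT ((le_max_left _ _).trans hd) z
    rw [hε, le_div_iff₀ (by positivity)]
    linarith
  have h1 := (abs_le.1 (M.abs_eta_adv_sub_le (κ := L.policyAt t x h) hr hr' hdz (τ h).1
    (τ h).2.2)).2
  have h2 := (abs_le.1 (abs_sq_sub_sq_le (M.abs_respError_le (M.isReward_r h) hr (τ h).1
    (τ h).2.2) (M.abs_respError_le (M.isReward_r h) hr' (τ h).1 (τ h).2.2)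
    (M.abs_respError_sub_le (κ := L.policyAt t x h) (M.isReward_r h) hr hr' hdz (τ h).1
    (τ h).2.2))).2
  have hk0 : 0 ≤ M.η ^ 2 / (32 * (1 + M.η) ^ 2) := by positivity
  have hk : M.η ^ 2 / (32 * (1 + M.η) ^ 2) ≤ 1 / 32 := by
    rw [div_le_div_iff₀ (by positivity) (by norm_num)]
    nlinarith
  have h3 := mul_le_mul_of_nonneg_left h2 hk0
  have h4 : M.η ^ 2 / (32 * (1 + M.η) ^ 2) * (2 * ε * (2 * 2)) ≤ 1 / 32 * (2 * ε * (2 * 2)) :=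
    mul_le_mul_of_nonneg_right hk (by positivity)
  rw [mul_sub] at h3
  rw [likelihoodIncr, likelihoodIncr]
  nlinarith [mul_nonneg hη.le hε0]

variable (M K L)

/-- All confidence bounds hold on the data `x`: the exponential supermartingales of the Bellman
losses, of the likelihood ratios and of the prediction errors stay below multiples of `ι`. -/
structure IsGood (ι : ℝ) {T : ℕ} (x : Hist S A B H T) : Prop where
  bellman : ∀ (h : Fin H) (t : Fin T), ∀ p ∈ K.U ×ˢ K.U ×ˢ K.params H,
    (x.before t).additive (L.bellmanIncr M K h p) ≤ 6 * ι
  likelihood : ∀ (h : Fin H) (t : Fin T), ∀ θ ∈ K.Θ h,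
    (x.before t).additive (L.likelihoodIncr M K h θ) ≤ 3 * ι
  prediction : ∀ h : Fin H, x.additive (L.predictionIncr M K h) ≤ 2 * ι

variable {M K L}

theorem measure_exists_mem_finset_le {X Y : Type*} [MeasurableSpace X] {μ : Measure X} {T N : ℕ}
    {C : Finset Y} (hC : C.card ≤ N) {E : Fin T → Y → Set X} {e : ℝ≥0∞}
    (hE : ∀ t, ∀ y ∈ C, μ (E t y) ≤ e) :
    μ (⋃ t, ⋃ y ∈ C, E t y) ≤ T * (N * e) := by
  refine (measure_iUnion_fintype_le _ _).trans ?_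
  have h1 : ∀ t : Fin T, μ (⋃ y ∈ C, E t y) ≤ N * e := fun t => by
    refine (measure_biUnion_finset_le C _).trans ((Finset.sum_le_card_nsmul C _ e (hE t)).trans ?_)
    rw [nsmul_eq_mul]
    gcongr
  refine (Finset.sum_le_sum fun t _ => h1 t).trans (le_of_eq ?_)
  simp

theorem law_not_isGood_le (hR : K.Regular H) (hA : K.MaxAttained M H) {T N : ℕ} (hH : 1 ≤ H)
    (hT : 1 ≤ T) (hN : 1 ≤ N) {δ : ℝ} (hδ : 0 < δ) (hδ1 : δ < 1)
    (hpol : ∀ t < T, ∀ h < H, IsPolicyFamily fun x : Hist S A B H t => L.policyAt t x h)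
    (hrew : ∀ t < T, ∀ h < H,
      Measurable fun p : Hist S A B H t × (S × A × B) => K.rew h (L.θhat t p.1 h) p.2)
    (hΘ : K.coverΘ M H (T : ℝ≥0∞)⁻¹ ≤ N) (hZ : K.coverZ M H (T : ℝ≥0∞)⁻¹ ≤ N) :
    L.law M T {x | ¬ L.IsGood M K (Real.log (Real.exp 1 * H * T * N / δ)) x} ≤
      ENNReal.ofReal δ := by
  have hH0 : (1 : ℝ) ≤ H := by exact_mod_cast hH
  have hT0 : (1 : ℝ) ≤ T := by exact_mod_cast hT
  have hN0 : (1 : ℝ) ≤ N := by exact_mod_cast hN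
  set ι := Real.log (Real.exp 1 * H * T * N / δ) with hι
  set c := Real.log (3 * (H * T * N) / δ) with hc
  have hHTN : 1 ≤ (H * T * N : ℝ) / δ := by
    rw [le_div_iff₀ hδ]
    have h1 : (1 : ℝ) ≤ H * T * N := by
      have := one_le_mul_of_one_le_of_one_le (one_le_mul_of_one_le_of_one_le hH0 hT0) hN0
      exact this
    linarith
  have hι' : ι = 1 + Real.log (H * T * N / δ) := by
    rw [hι, show Real.exp 1 * H * T * N / δ = Real.exp 1 * (H * T * N / δ) by ring,
      Real.log_mul (Real.exp_pos 1).ne' (by linarith), Real.log_exp]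
  have hι1 : 1 ≤ ι := by linarith [Real.log_nonneg hHTN]
  have hcι : c ≤ 2 * ι := by
    have h3 : Real.log 3 ≤ 2 := by
      have := Real.log_le_sub_one_of_pos (show (0 : ℝ) < 3 by norm_num)
      linarith
    rw [hc, mul_div_assoc, Real.log_mul (by norm_num) (by linarith), hι']
    linarith [Real.log_nonneg hHTN]
  have hexp : Real.exp (-c) = δ / (3 * (H * T * N)) := by
    rw [Real.exp_neg, hc, Real.exp_log (by positivity), inv_div]
  -- finite covers of the two classes at each step
  choose C hCmem hCcov hCcard using fun h : Fin H => exists_finset_cover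
    (le_trans (le_iSup (fun h : Fin H => coveringNumber (K.distΘ M h) (K.Θ h) (T : ℝ≥0∞)⁻¹) h) hΘ)
  choose D hDmem hDcov hDcard using fun h : Fin H => exists_finset_cover
    (le_trans (le_iSup (fun h : Fin H => coveringNumber (K.distZ M h)
      (K.U ×ˢ K.U ×ˢ K.params H) (T : ℝ≥0∞)⁻¹) h) hZ)
  set e : ℝ≥0∞ := ENNReal.ofReal (Real.exp (-c)) with he
  have hbad : {x : Hist S A B H T | ¬ L.IsGood M K ι x} ⊆
      ⋃ h : Fin H, ((⋃ t : Fin T, ⋃ θ ∈ C h,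
        {x | c < (x.before t).additive (L.likelihoodIncr M K h θ)}) ∪
        (⋃ t : Fin T, ⋃ p ∈ D h, {x | c < (x.before t).additive (L.bellmanIncr M K h p)})) ∪
        {x | c < x.additive (L.predictionIncr M K h)} := by
    intro x hx
    by_contra hcon
    simp only [Set.mem_iUnion, Set.mem_union, Set.mem_ofPred_eq, not_exists, not_or, not_lt] at hcon
    refine hx ⟨fun h t p hp => ?_, fun h t θ hθ => ?_, fun h => (hcon h).2.trans hcι⟩
    · obtain ⟨p', hp', hd⟩ := hDcov h p hp
      have h1 := (hcon h).1.2 t p' hp'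
      have h2 := Hist.additive_le_additive_add (fun k hk y τ => bellmanIncr_le_add hR hA hT h hp
        (hDmem h p' hp') hd y (fun j hj => (hpol k (hk.trans t.2) j hj).isMarkov y) τ)
        (x.before t)
      have h3 : (t : ℝ) * (4 / T) ≤ 4 := by
        have : (t : ℝ) ≤ T := by exact_mod_cast t.2.le
        rw [mul_div_assoc', div_le_iff₀ (by linarith)]
        linarith
      linarith
    · obtain ⟨θ', hθ', hd⟩ := hCcov h θ hθ
      have h1 := (hcon h).1.1 t θ' hθ'
      have h2 := Hist.additive_le_additive_add (fun k hk y τ => likelihoodIncr_le_add hR hT h hθ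
        (hCmem h θ' hθ') hd y (fun j hj => (hpol k (hk.trans t.2) j hj).isMarkov y) τ)
        (x.before t)
      have h3 : (t : ℝ) * (1 / T) ≤ 1 := by
        have : (t : ℝ) ≤ T := by exact_mod_cast t.2.le
        rw [mul_div_assoc', div_le_iff₀ (by linarith)]
        linarith
      linarith
  refine (measure_mono hbad).trans ((measure_iUnion_fintype_le _ _).trans ?_)
  have hstep : ∀ h : Fin H, L.law M T (((⋃ t : Fin T, ⋃ θ ∈ C h,
        {x | c < (x.before t).additive (L.likelihoodIncr M K h θ)}) ∪
        (⋃ t : Fin T, ⋃ p ∈ D h, {x | c < (x.before t).additive (L.bellmanIncr M K h p)})) ∪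
        {x | c < x.additive (L.predictionIncr M K h)}) ≤ T * (N * e) + T * (N * e) + e := by
    intro h
    refine (measure_union_le _ _).trans (add_le_add ((measure_union_le _ _).trans (add_le_add
      ?_ ?_)) ?_)
    · exact measure_exists_mem_finset_le (hCcard h) fun t θ hθ =>
        L.law_additive_before_gt_le M hpol
          (fun k hk => measurable_likelihoodIncr hR hpol h (hCmem h θ hθ) k hk)
          (fun k hk => lintegral_exp_likelihoodIncr_le hR hpol h (hCmem h θ hθ) k hk) c t
    · exact measure_exists_mem_finset_le (hDcard h) fun t p hp =>
        L.law_additive_before_gt_le M hpol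
          (fun k hk => measurable_bellmanIncr hR hpol hA h (hDmem h p hp) k hk)
          (fun k hk => lintegral_exp_bellmanIncr_le hR hpol hA h (hDmem h p hp) k hk) c t
    · exact L.law_additive_gt_le M hpol
          (fun k hk => measurable_predictionIncr hpol hrew h k hk)
          (fun k hk => lintegral_exp_predictionIncr_le hpol hrew h k hk) c
  refine (Finset.sum_le_sum fun h _ => hstep h).trans ?_
  have hreal : (T : ℝ≥0∞) * (N * e) + T * (N * e) + e =
      ENNReal.ofReal ((T * N + T * N + 1) * Real.exp (-c)) := by
    rw [ENNReal.ofReal_mul (by positivity), ENNReal.ofReal_add (by positivity) (by norm_num),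
      ENNReal.ofReal_add (by positivity) (by positivity), ENNReal.ofReal_mul (by positivity),
      ENNReal.ofReal_natCast, ENNReal.ofReal_natCast, ENNReal.ofReal_one]
    ring
  rw [Finset.sum_const, Finset.card_univ, Fintype.card_fin, nsmul_eq_mul, hreal,
    ← ENNReal.ofReal_natCast, ← ENNReal.ofReal_mul (by positivity)]
  refine ENNReal.ofReal_le_ofReal ?_
  rw [hexp, mul_div_assoc', mul_div_assoc', div_le_iff₀ (by positivity)]
  have hTN : (1 : ℝ) ≤ T * N := one_le_mul_of_one_le_of_one_le hT0 hN0
  have : (H : ℝ) * ((T * N + T * N + 1) * δ) = (H * δ) * (T * N + T * N + 1) := by ring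
  rw [this, show δ * (3 * (H * T * N : ℝ)) = (H * δ) * (3 * (T * N)) by ring]
  exact mul_le_mul_of_nonneg_left (by linarith) (by positivity)

end Learner

end GoodEvent

/-! ### The two families of signed measures -/

section SignedMeasures

/-- The form of `eluder_sum_le` for sequences indexed by `Fin T`. -/
theorem eluder_sum_fin_le {X : Type*} [MeasurableSpace X] {G : Set (X → ℝ)}
    {P : Set (SignedMeasure X)} {T d : ℕ} (hT : 1 ≤ T)
    (hd : dimDE G P (1 / Real.sqrt T) ≤ d) {g : Fin T → X → ℝ} {ρ : Fin T → SignedMeasure X}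
    (hg : ∀ t, g t ∈ G) (hρ : ∀ t, ρ t ∈ P) {m : Fin T → Fin T → ℝ}
    (hm : ∀ t i, (ρ i).integral (g t) (ContinuousLinearMap.lsmul ℝ ℝ) = m t i) {b : ℝ} (hb : 0 < b)
    (hsum : ∀ t : Fin T, ∑ i : Fin t, m t ⟨i, i.2.trans t.2⟩ ^ 2 ≤ b) (hbd : ∀ t, m t t ^ 2 ≤ b) :
    ∑ t, |m t t| ≤ 2 * Real.sqrt (2 * b * d * T) + Real.sqrt T ∧
      ∑ t, m t t ^ 2 ≤ 2 * b * d * (1 + Real.log T) + 1 := by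
  have : Inhabited (Fin T) := ⟨⟨0, hT⟩⟩
  set e : ℕ → Fin T := fun t => if h : t < T then ⟨t, h⟩ else default with he
  have he1 : ∀ t : Fin T, e t = t := fun t => by simp [he]
  have he2 : ∀ t (ht : t < T), e t = ⟨t, ht⟩ := fun t ht => by simp [he, ht]
  have h := eluder_sum_le hT hd (g := fun t => g (e t)) (ρ := fun t => ρ (e t))
    (m := fun t i => m (e t) (e i)) (fun t _ => hg _) (fun t _ => hρ _) (fun t _ i _ => hm _ _) hb
    (fun t ht => by
      rw [← Fin.sum_univ_eq_sum_range (fun i => m (e t) (e i) ^ 2) t]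
      refine le_trans (le_of_eq (Finset.sum_congr rfl fun i _ => ?_)) (hsum ⟨t, ht⟩)
      rw [he2 t ht, he2 i (i.2.trans ht)])
    (fun t _ => hbd _)
  rw [← Fin.sum_univ_eq_sum_range (fun t => |m (e t) (e t)|) T,
    ← Fin.sum_univ_eq_sum_range (fun t => m (e t) (e t) ^ 2) T] at h
  simpa only [he1] using h

theorem integral_lsmul_toSignedMeasure {X : Type*} [MeasurableSpace X] (μ : Measure X)
    [IsFiniteMeasure μ] (g : X → ℝ) :
    μ.toSignedMeasure.integral g (ContinuousLinearMap.lsmul ℝ ℝ) = ∫ z, g z ∂μ := by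
  have h : (ContinuousLinearMap.lsmul ℝ ℝ : ℝ →L[ℝ] ℝ →L[ℝ] ℝ) =
      (ContinuousLinearMap.lsmul ℝ ℝ).flip := by
    ext
    simp
  rw [h]
  exact VectorMeasure.integral_toSignedMeasure

variable {S A B Par : Type*} [MeasurableSpace S] [MeasurableSpace A] [MeasurableSpace B]
  {M : Game S A B} {K : Classes S A B Par} {H : ℕ}

theorem sq_integral_le {X : Type*} [MeasurableSpace X] {μ : Measure X} [IsProbabilityMeasure μ]
    {f : X → ℝ} (hf : Measurable f) {c : ℝ} (hc : ∀ x, |f x| ≤ c) :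
    (∫ x, f x ∂μ) ^ 2 ≤ ∫ x, f x ^ 2 ∂μ := by
  have h1 : Integrable f μ := integrable_of_bounded hf hc
  have h2 : Integrable (fun x => f x ^ 2) μ :=
    integrable_of_bounded (c := c ^ 2) (hf.pow_const 2) fun x => by
      rw [abs_pow]; exact pow_le_pow_left₀ (abs_nonneg _) (hc x) 2
  set a := ∫ x, f x ∂μ with ha
  have h3 : 0 ≤ ∫ x, (f x ^ 2 - 2 * a * f x + a ^ 2) ∂μ :=
    integral_nonneg fun x => by
      have : f x ^ 2 - 2 * a * f x + a ^ 2 = (f x - a) ^ 2 := by ring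
      simp only [Pi.zero_apply]
      rw [this]
      positivity
  have h4 : Integrable (fun x => f x ^ 2 - 2 * a * f x) μ := h2.sub (h1.const_mul _)
  rw [integral_add h4 (integrable_const _), integral_sub h2 (h1.const_mul _),
    integral_const_mul, ← ha] at h3
  simp at h3
  nlinarith

namespace Classes

/-- Each law of a step under a policy of the class belongs to `measL`, with integral the Bochner
integral. -/
theorem exists_mem_measL {π : ℕ → Kernel (S × B) A} (hπ : π ∈ K.policies H)
    {h : ℕ} [IsFiniteMeasure (M.stepLaw π h)] :
    ∃ ρ ∈ K.measL M H h, ∀ g : S × A × B → ℝ,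
      ρ.integral g (ContinuousLinearMap.lsmul ℝ ℝ) = ∫ z, g z ∂(M.stepLaw π h) := by
  refine ⟨(M.stepLaw π h).toSignedMeasure, ⟨π, hπ, fun E hE => ?_⟩, fun g => ?_⟩
  · rw [Measure.toSignedMeasure_apply_measurable hE]
  · exact integral_lsmul_toSignedMeasure _ g

/-- Each quantal response error is the integral of the reward error against a measure of
`measF`. -/
theorem exists_mem_measF (hR : K.Regular H) {h : ℕ} (hh : h < H) {κ : Kernel (S × B) A}
    (hκ : κ ∈ K.Pol h) (s : S) (b : B) :
    ∃ ρ ∈ K.measF M h, ∀ θ ∈ K.Θ h,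
      ρ.integral (fun z => K.rew h θ z - M.r h z) (ContinuousLinearMap.lsmul ℝ ℝ) =
        M.respError (K.rew h θ) (M.r h) κ s b := by
  have := hR.isMarkov h hh κ hκ
  have h1 := Game.isProbabilityMeasure_map_policy (π := κ) s b
  have h2 := M.isProbabilityMeasure_actLaw (π := κ) (M.isReward_r h) s
  refine ⟨((κ (s, b)).map fun a => (s, a, b)).toSignedMeasure -
    (M.actLaw (M.r h) κ s).toSignedMeasure, ⟨κ, hκ, s, b, fun E hE => ?_⟩, fun θ hθ => ?_⟩
  · rw [sub_apply, Measure.toSignedMeasure_apply_measurable hE,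
      Measure.toSignedMeasure_apply_measurable hE]
    rfl
  · have hr := hR.isReward hh hθ
    have hm : Measurable fun z => K.rew h θ z - M.r h z := hr.measurable.sub (M.measurable_r h)
    have hb := (M.isReward_r h).abs_sub_le hr
    rw [VectorMeasure.integral_sub_vectorMeasure]
    · rw [integral_lsmul_toSignedMeasure, integral_lsmul_toSignedMeasure,
        Game.integral_map_policy s b hm, M.integral_actLaw (M.isReward_r h) s hm hb]
      rfl
    · rw [VectorMeasure.Integrable, Measure.variation_toSignedMeasure]
      exact integrable_of_bounded hm hb
    · rw [VectorMeasure.Integrable, Measure.variation_toSignedMeasure]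
      exact integrable_of_bounded hm hb

end Classes

end SignedMeasures

/-! ### Optimism and the regret of one episode -/

section Optimism

variable {S A B Par : Type*} [MeasurableSpace S] [MeasurableSpace A] [MeasurableSpace B]
  {M : Game S A B} {K : Classes S A B Par} {H : ℕ}

/-- Evaluating `f` against the response to `r'` instead of the true response costs at most the mean
of `responseBound` of the response error. -/
theorem Game.integral_evalOp_sub_le {π : ℕ → Kernel (S × B) A}
    (hπ : ∀ h < H, IsMarkovKernel (π h)) {h : ℕ} (hh : h < H) {r' : S × A × B → ℝ}
    (hr' : IsReward r') {f : S × A × B → ℝ} (hf : Measurable f) {c : ℝ} (hc : ∀ z, |f z| ≤ c) :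
    ∫ s, (M.evalOp r' (π h) f s - M.evalOp (M.r h) (π h) f s) ∂(M.stateMarg π h) ≤
      c * ∫ z, M.responseBound |M.respError r' (M.r h) (π h) z.1 z.2.2| ∂(M.stepLaw π h) := by
  have := hπ h hh
  have hprob := M.isProbabilityMeasure_stateMarg hπ hh.le
  have hr := M.isReward_r h
  have hη := M.η_pos
  set F : S × A × B → ℝ := fun z =>
    M.responseBound |M.respError r' (M.r h) (π h) z.1 z.2.2| with hF
  have hEm : Measurable fun z : S × A × B => M.respError r' (M.r h) (π h) z.1 z.2.2 := by
    have h1 := M.measurable_respError_param (X := Unit) (IsPolicyFamily.const (π h)) hr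
      (f := fun _ => r') (hr'.measurable.comp measurable_snd)
    have hp : Measurable fun z : S × A × B => (((), z.1, z.2.2) : Unit × S × B) := by fun_prop
    have h2 := h1.comp hp
    exact h2
  have hFm : Measurable F := by
    rw [hF]
    unfold Game.responseBound
    have h1 := continuous_abs.measurable.comp hEm
    have h2 := (h1.const_mul M.η).add ((h1.pow_const 2).const_mul
      (2 * M.η ^ 2 * Real.exp (2 * M.η)))
    exact h2
  have hFb : ∀ z, |F z| ≤ M.responseBound 2 := fun z => by
    have h1 : 0 ≤ F z := by
      rw [hF]
      unfold Game.responseBound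
      positivity
    rw [abs_of_nonneg h1]
    exact M.responseBound_mono (abs_nonneg _) (M.abs_respError_le hr hr' _ _)
  have hFe : ∀ s, M.evalOp (M.r h) (π h) F s =
      ∫ b, (M.η * |M.respError r' (M.r h) (π h) s b| + 2 * M.η ^ 2 * Real.exp (2 * M.η) *
        M.respError r' (M.r h) (π h) s b ^ 2) ∂(M.quantalResponse (M.r h) (π h) s) := fun s => by
    rw [Game.evalOp]
    refine integral_congr_ae (.of_forall fun b => ?_)
    simp only [avg, hF, integral_const, probReal_univ, smul_eq_mul, one_mul, Game.responseBound,
      sq_abs]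
  have hm1 := M.measurable_evalOp (π := π h) hr' hf hc
  have hm2 := M.measurable_evalOp (π := π h) hr hf hc
  have i1 : Integrable (fun s => M.evalOp r' (π h) f s - M.evalOp (M.r h) (π h) f s)
      (M.stateMarg π h) :=
    (integrable_of_bounded hm1 fun s => M.abs_evalOp_le hr' s hc).sub
      (integrable_of_bounded hm2 fun s => M.abs_evalOp_le hr s hc)
  have i2 : Integrable (M.evalOp (M.r h) (π h) F) (M.stateMarg π h) :=
    integrable_of_bounded (M.measurable_evalOp hr hFm hFb) fun s => M.abs_evalOp_le hr s hFb
  rw [M.integral_stepLaw hπ hh hFm hFb, ← integral_const_mul]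
  refine integral_mono i1 (i2.const_mul c) fun s => ?_
  simp only
  rw [hFe s]
  exact (le_abs_self _).trans (M.abs_evalOp_sub_le hr hr' hf hc s)

namespace Learner

variable (hR : K.Regular H) (hA : K.MaxAttained M H) (hH : 1 ≤ H)
include hR hA hH

theorem objective_eq {p : (ℕ → S × A × B → ℝ) × (ℕ → Par)} (hU : p.1 ∈ K.U)
    (hθ : p.2 ∈ K.params H) : objective M K p = ∫ s, K.Topt M 0 p.2 (p.1 0) s ∂M.ρ₀ := by
  obtain ⟨π₀, hπ₀, he⟩ := hA p.1 hU p.2 hθ 0 hH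
  have hne : Nonempty (K.Pol 0) := ⟨⟨π₀, hπ₀⟩⟩
  have hr := hR.isReward hH (hθ 0 hH)
  have hmT := Classes.measurable_Topt hR hA hU hθ (Nat.zero_le H)
  have hbT := Classes.abs_Topt_le hR hA hU hθ (Nat.zero_le H)
  have hle : ∀ π : K.Pol 0, ∫ s, M.evalOp (K.rew 0 (p.2 0)) π.1 (p.1 0) s ∂M.ρ₀ ≤
      ∫ s, K.Topt M 0 p.2 (p.1 0) s ∂M.ρ₀ := fun π => by
    have := hR.isMarkov 0 hH π.1 π.2
    refine integral_mono (integrable_of_bounded (M.measurable_evalOp hr (hR.measurable_U _ hU 0)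
      (hR.U_le _ hU 0)) fun s => M.abs_evalOp_le hr s (hR.U_le _ hU 0))
      (integrable_of_bounded hmT hbT) fun s => Classes.evalOp_le_Topt hR hU hθ hH π.2 s
  refine le_antisymm (ciSup_le hle) ?_
  rw [← funext he]
  exact le_ciSup (f := fun π : K.Pol 0 => ∫ s, M.evalOp (K.rew 0 (p.2 0)) π.1 (p.1 0) s ∂M.ρ₀)
    ⟨_, by rintro _ ⟨π, rfl⟩; exact hle π⟩ ⟨π₀, hπ₀⟩

/-- The objective of the true model bounds the value of every policy. -/
theorem J_le_objective {U : ℕ → S × A × B → ℝ} {θ : ℕ → Par} (hU : U ∈ K.U) (hθ : θ ∈ K.params H)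
    (hθr : ∀ h < H, K.rew h (θ h) = M.r h) (hUθ : ∀ h < H, U h = K.bellmanOpt M h θ (U (h + 1)))
    {π : ℕ → Kernel (S × B) A} (hπ : π ∈ K.policies H) : M.J H π ≤ objective M K (U, θ) := by
  have hM : ∀ h < H, IsMarkovKernel (π h) := fun h hh => hR.isMarkov h hh _ (hπ h hh)
  have key := M.integral_sub_J_eq hM (U := U) (V := fun h => K.Topt M h θ (U h)) (c := H)
    (fun h _ => hR.measurable_U _ hU h) (fun h _ => hR.U_le _ hU h)
    (fun h hh => Classes.measurable_Topt hR hA hU hθ hh)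
    (fun h hh => Classes.abs_Topt_le hR hA hU hθ hh) (Classes.Topt_end hR hU θ)
  have h1 : ∀ h ∈ Finset.range H, ∫ z, (U h z - (M.u h z +
      ∫ s, K.Topt M (h + 1) θ (U (h + 1)) s ∂(M.P h z))) ∂(M.stepLaw π h) = 0 := fun h hh => by
    have e : ∀ z, U h z - (M.u h z + ∫ s, K.Topt M (h + 1) θ (U (h + 1)) s ∂(M.P h z)) = 0 :=
      fun z => sub_eq_zero.2 (congrFun (hUθ h (Finset.mem_range.1 hh)) z)
    simp only [e, integral_zero]
  have h2 : 0 ≤ ∑ h ∈ Finset.range H, ∫ s, (K.Topt M h θ (U h) s -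
      M.evalOp (M.r h) (π h) (U h) s) ∂(M.stateMarg π h) :=
    Finset.sum_nonneg fun h hh => integral_nonneg fun s => by
      have hh := Finset.mem_range.1 hh
      have := Classes.evalOp_le_Topt (M := M) hR hU hθ hh (hπ h hh) s
      rw [hθr h hh] at this
      exact sub_nonneg.2 this
  rw [Finset.sum_eq_zero h1, zero_add] at key
  rw [objective_eq hR hA hH hU hθ]
  linarith

/-- The regret of an episode whose policy is greedy for an optimistic pair `(U, θ)` is at most the
leader's Bellman errors plus the follower's response errors along the episode. -/
theorem objective_sub_J_le {U : ℕ → S × A × B → ℝ} {θ : ℕ → Par} (hU : U ∈ K.U)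
    (hθ : θ ∈ K.params H) {π : ℕ → Kernel (S × B) A} (hπ : π ∈ K.policies H)
    (hgreedy : ∀ h < H, ∀ s, M.evalOp (K.rew h (θ h)) (π h) (U h) s = K.Topt M h θ (U h) s) :
    objective M K (U, θ) - M.J H π ≤
      ∑ h : Fin H, (∫ z, (U h z - K.bellmanOpt M h θ (U (h + 1)) z) ∂(M.stepLaw π h) +
        H * ∫ z, M.responseBound |M.respError (K.rew h (θ h)) (M.r h) (π h) z.1 z.2.2|
          ∂(M.stepLaw π h)) := by
  have hM : ∀ h < H, IsMarkovKernel (π h) := fun h hh => hR.isMarkov h hh _ (hπ h hh)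
  have key := M.integral_sub_J_eq hM (U := U) (V := fun h => K.Topt M h θ (U h)) (c := H)
    (fun h _ => hR.measurable_U _ hU h) (fun h _ => hR.U_le _ hU h)
    (fun h hh => Classes.measurable_Topt hR hA hU hθ hh)
    (fun h hh => Classes.abs_Topt_le hR hA hU hθ hh) (Classes.Topt_end hR hU θ)
  rw [objective_eq hR hA hH hU hθ]
  refine key.le.trans ?_
  rw [← Finset.sum_add_distrib, ← Fin.sum_univ_eq_sum_range (fun h =>
    ∫ z, (U h z - (M.u h z + ∫ s, K.Topt M (h + 1) θ (U (h + 1)) s ∂(M.P h z)))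
      ∂(M.stepLaw π h) +
    ∫ s, (K.Topt M h θ (U h) s - M.evalOp (M.r h) (π h) (U h) s) ∂(M.stateMarg π h)) H]
  refine Finset.sum_le_sum fun h _ => add_le_add le_rfl ?_
  simp only [← hgreedy h h.2]
  exact M.integral_evalOp_sub_le hM h.2 (hR.isReward h.2 (hθ h h.2)) (hR.measurable_U _ hU h)
    (hR.U_le _ hU h)

end Learner

end Optimism

/-! ### The regret on the event where all confidence bounds hold -/

section Regret

variable {S A B Par : Type*} [MeasurableSpace S] [MeasurableSpace A] [MeasurableSpace B]
  {M : Game S A B} {K : Classes S A B Par} {H T : ℕ} {L : Learner S A B Par H}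
  {x : Hist S A B H T} {ι β : ℝ}

/-- Simplification of the first bound of `eluder_sum_le` for second moments at most `10 a² β`. -/
theorem two_mul_sqrt_add_sqrt_le {a d n : ℝ} (ha : 1 ≤ a) (hd : 1 ≤ d) (hβ : 1 ≤ β) (hn : 0 ≤ n) :
    2 * Real.sqrt (2 * (10 * a ^ 2 * β) * d * n) + Real.sqrt n ≤
      10 * a * Real.sqrt (d * β * n) := by
  have hdβ : 1 ≤ d * β := one_le_mul_of_one_le_of_one_le hd hβ
  have h1 : Real.sqrt n ≤ Real.sqrt (d * β * n) := Real.sqrt_le_sqrt (le_mul_of_one_le_left hn hdβ)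
  have h2 : Real.sqrt (2 * (10 * a ^ 2 * β) * d * n) ≤ 9 / 2 * a * Real.sqrt (d * β * n) := by
    refine Real.sqrt_le_iff.2 ⟨by positivity, ?_⟩
    rw [mul_pow, Real.sq_sqrt (by positivity)]
    have : 0 ≤ a ^ 2 * (d * β * n) := by positivity
    nlinarith
  have h3 : Real.sqrt (d * β * n) ≤ a * Real.sqrt (d * β * n) :=
    le_mul_of_one_le_left (Real.sqrt_nonneg _) ha
  linarith

namespace Learner

section Consequences

theorem bellmanRisk_nonneg (h : Fin H)
    (p : (ℕ → S × A × B → ℝ) × (ℕ → S × A × B → ℝ) × (ℕ → Par)) {t : ℕ} (y : Hist S A B H t) :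
    0 ≤ L.bellmanRisk M K h p y :=
  Finset.sum_nonneg fun _ _ => integral_nonneg fun _ => sq_nonneg _

theorem IsGood.bellmanRisk_le (hg : L.IsGood M K ι x) (h : Fin H) (t : Fin T)
    {p : (ℕ → S × A × B → ℝ) × (ℕ → S × A × B → ℝ) × (ℕ → Par)}
    (hp : p ∈ K.U ×ˢ K.U ×ˢ K.params H) :
    L.bellmanRisk M K h p (x.before t) ≤
      4 * (bellmanLoss M K (x.before t) h (p.1 h) (p.2.1 (h + 1)) p.2.2 -
        bellmanLoss M K (x.before t) h (K.bellmanOpt M h p.2.2 (p.2.1 (h + 1))) (p.2.1 (h + 1))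
          p.2.2) + 192 * (H : ℝ) ^ 2 * ι := by
  have hH : (0 : ℝ) < H := by exact_mod_cast h.pos
  have h1 := hg.bellman h t p hp
  rw [additive_bellmanIncr] at h1
  generalize bellmanLoss M K (x.before t) h (p.1 h) (p.2.1 (h + 1)) p.2.2 -
    bellmanLoss M K (x.before t) h (K.bellmanOpt M h p.2.2 (p.2.1 (h + 1))) (p.2.1 (h + 1))
      p.2.2 = D at h1 ⊢
  generalize L.bellmanRisk M K h p (x.before t) = R at h1 ⊢
  have e : -(D / (8 * (H : ℝ) ^ 2)) + R / (32 * (H : ℝ) ^ 2) = (R - 4 * D) / (32 * (H : ℝ) ^ 2) := by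
    field_simp
    ring
  rw [e, div_le_iff₀ (by positivity)] at h1
  linarith

theorem IsGood.bellmanLoss_bellmanOpt_le (hg : L.IsGood M K ι x) (h : Fin H) (t : Fin T)
    {p : (ℕ → S × A × B → ℝ) × (ℕ → S × A × B → ℝ) × (ℕ → Par)}
    (hp : p ∈ K.U ×ˢ K.U ×ˢ K.params H) :
    bellmanLoss M K (x.before t) h (K.bellmanOpt M h p.2.2 (p.2.1 (h + 1))) (p.2.1 (h + 1))
      p.2.2 ≤ bellmanLoss M K (x.before t) h (p.1 h) (p.2.1 (h + 1)) p.2.2 +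
        48 * (H : ℝ) ^ 2 * ι := by
  have h1 := hg.bellmanRisk_le h t hp
  have h2 := L.bellmanRisk_nonneg (M := M) (K := K) h p (x.before t)
  linarith

theorem IsGood.responseRisk_le (hg : L.IsGood M K ι x) (h : Fin H) (t : Fin T) {θs θ : Par}
    (hθs : K.rew h θs = M.r h) (hθ : θ ∈ K.Θ h) :
    L.responseRisk M K h θ (x.before t) ≤ 32 * ((1 + M.η) / M.η) ^ 2 *
      ((L.negLogLik M K (x.before t) h θ - L.negLogLik M K (x.before t) h θs) / 4 + 3 * ι) := by
  have hη := M.η_pos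
  have h1 := hg.likelihood h t θ hθ
  rw [L.additive_likelihoodIncr M K h hθs] at h1
  have h2 := mul_le_mul_of_nonneg_left h1
    (show 0 ≤ 32 * ((1 + M.η) / M.η) ^ 2 by positivity)
  have e : 32 * ((1 + M.η) / M.η) ^ 2 * (M.η ^ 2 / (32 * (1 + M.η) ^ 2)) = 1 := by
    field_simp
  rw [mul_add, ← mul_assoc, e, one_mul] at h2
  nlinarith [h2]

theorem IsGood.negLogLik_le (hg : L.IsGood M K ι x) (h : Fin H) (t : Fin T) {θs θ : Par}
    (hθs : K.rew h θs = M.r h) (hθ : θ ∈ K.Θ h) :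
    L.negLogLik M K (x.before t) h θs ≤ L.negLogLik M K (x.before t) h θ + 12 * ι := by
  have h1 := hg.likelihood h t θ hθ
  rw [L.additive_likelihoodIncr M K h hθs] at h1
  have h2 : 0 ≤ M.η ^ 2 / (32 * (1 + M.η) ^ 2) * L.responseRisk M K h θ (x.before t) :=
    mul_nonneg (by positivity) (Finset.sum_nonneg fun _ _ => sq_nonneg _)
  linarith

/-- On the good event, the optimal value function of the true model lies in the confidence sets. -/
theorem IsGood.mem_confSet (hg : L.IsGood M K ι x) (hι : 0 ≤ ι) (hβ : 48 * ι ≤ β) (t : Fin T)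
    {U : ℕ → S × A × B → ℝ} {θ : ℕ → Par} (hU : U ∈ K.U) (hθ : θ ∈ K.params H)
    (hθr : ∀ h < H, K.rew h (θ h) = M.r h)
    (hUθ : ∀ h < H, U h = K.bellmanOpt M h θ (U (h + 1))) :
    (U, θ) ∈ L.confSet M K β (x.before t) := by
  refine ⟨hU, hθ, fun h => ⟨fun θ' hθ' => ?_, fun V hV => ?_⟩⟩
  · have := hg.negLogLik_le h t (hθr h h.2) hθ'
    dsimp only
    linarith
  · have h1 := hg.bellmanLoss_bellmanOpt_le h t (p := (V, U, θ)) ⟨hV, hU, hθ⟩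
    simp only [← hUθ h h.2] at h1
    have h2 : (H : ℝ) ^ 2 * (48 * ι) ≤ (H : ℝ) ^ 2 * β := by gcongr
    dsimp only
    linarith

end Consequences

variable (hR : K.Regular H) (hg : L.IsGood M K ι x) (hι : 1 ≤ ι) (hβ : 48 * ι ≤ β)
  (hconf : ∀ t : Fin T, (L.Uhat t (x.before t), L.θhat t (x.before t)) ∈
    L.confSet M K β (x.before t))
  (hpol : ∀ t : Fin T, L.policyAt t (x.before t) ∈ K.policies H)
include hR hg hι hβ hconf hpol

/-- The Bellman errors of the estimates, each on the law of its own episode, have a sum controlled by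
the eluder dimension. -/
theorem IsGood.sum_bellman_le (hA : K.MaxAttained M H) (hC : K.Complete M H) (hT : 1 ≤ T)
    (h : Fin H) {d : ℕ} (hd1 : 1 ≤ d)
    (hd : dimDE (K.classL M H h) (K.measL M H h) (1 / Real.sqrt T) ≤ d) :
    ∑ t : Fin T, |∫ z, (L.Uhat t (x.before t) h z - K.bellmanOpt M h (L.θhat t (x.before t))
      (L.Uhat t (x.before t) (h + 1)) z) ∂(M.stepLaw (L.policyAt t (x.before t)) h)| ≤
      10 * H * Real.sqrt (d * β * T) := by
  have hβ1 : 1 ≤ β := by linarith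
  have hH1 : (1 : ℝ) ≤ H := by exact_mod_cast h.pos
  have hprob : ∀ t : Fin T, IsProbabilityMeasure (M.stepLaw (L.policyAt t (x.before t)) h) :=
    fun t => M.isProbabilityMeasure_stepLaw (fun k hk => hR.isMarkov k hk _ (hpol t k hk)) h.2
  set g : Fin T → S × A × B → ℝ := fun t z => L.Uhat t (x.before t) h z -
    K.bellmanOpt M h (L.θhat t (x.before t)) (L.Uhat t (x.before t) (h + 1)) z with hgdef
  have hgm : ∀ t, Measurable (g t) := fun t => (hR.measurable_U _ (hconf t).1 h).sub
    (Classes.measurable_bellmanOpt hR hA (hconf t).1 (hconf t).2.1 h.2)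
  have hgb : ∀ t z, |g t z| ≤ 3 * H := fun t z =>
    Classes.abs_sub_bellmanOpt_le hR hA (hconf t).1 (hconf t).1 (hconf t).2.1 h.2 z
  choose ρ hρ hρi using fun t : Fin T => Classes.exists_mem_measL (M := M) (hpol t) (h := h)
  refine (eluder_sum_fin_le hT hd (g := g) (ρ := ρ)
    (m := fun t i => ∫ z, g t z ∂(M.stepLaw (L.policyAt i (x.before i)) h))
    (fun t => ⟨_, (hconf t).1, _, (hconf t).2.1, rfl⟩) hρ (fun t i => hρi i _)
    (b := 10 * (H : ℝ) ^ 2 * β) (by positivity) (fun t => ?_) (fun t => ?_)).1.trans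
    (two_mul_sqrt_add_sqrt_le hH1 (by exact_mod_cast hd1) hβ1 (by positivity))
  · obtain ⟨U', hU', he⟩ := hC _ (hconf t).1 _ (hconf t).2.1 h h.2
    have h1 := hg.bellmanRisk_le h t (p := (L.Uhat t (x.before t), L.Uhat t (x.before t),
      L.θhat t (x.before t))) ⟨(hconf t).1, (hconf t).1, (hconf t).2.1⟩
    have h2 := ((hconf t).2.2 h).2 U' hU'
    rw [he] at h2
    dsimp only at h1 h2
    have h3 : ∑ i : Fin t, (∫ z, g t z ∂(M.stepLaw (L.policyAt (i : ℕ)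
        (x.before ⟨i, i.2.trans t.2⟩)) h)) ^ 2 ≤
        L.bellmanRisk M K h (L.Uhat t (x.before t), L.Uhat t (x.before t),
          L.θhat t (x.before t)) (x.before t) :=
      Finset.sum_le_sum fun i _ => by
        have := hprob ⟨i, i.2.trans t.2⟩
        exact sq_integral_le (hgm t) (hgb t)
    have h4 : (H : ℝ) ^ 2 * (48 * ι) ≤ (H : ℝ) ^ 2 * β := by gcongr
    have h5 : 0 ≤ (H : ℝ) ^ 2 * β := by positivity
    refine h3.trans ?_
    linarith
  · have h1 := abs_integral_le_of_bounded (μ := M.stepLaw (L.policyAt t (x.before t)) h) (hgb t)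
    rw [← sq_abs]
    refine (pow_le_pow_left₀ (abs_nonneg _) h1 2).trans ?_
    have : (H : ℝ) ^ 2 * 1 ≤ (H : ℝ) ^ 2 * β := by gcongr
    nlinarith

/-- The response errors of the estimated rewards, each on the data of its own episode, have sums
controlled by the eluder dimension. -/
theorem IsGood.sum_response_le (hT : 1 ≤ T) (h : Fin H) {θs : Par} (hθs : θs ∈ K.Θ h)
    (hθr : K.rew h θs = M.r h) {d : ℕ} (hd1 : 1 ≤ d)
    (hd : dimDE (K.classF M h) (K.measF M h) (1 / Real.sqrt T) ≤ d) :
    ∑ t : Fin T, |M.respError (K.rew h (L.θhat t (x.before t) h)) (M.r h)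
        (L.policyAt t (x.before t) h) (x t h).1 (x t h).2.2| ≤
      10 * ((1 + M.η) / M.η) * Real.sqrt (d * β * T) ∧
    ∑ t : Fin T, M.respError (K.rew h (L.θhat t (x.before t) h)) (M.r h)
        (L.policyAt t (x.before t) h) (x t h).1 (x t h).2.2 ^ 2 ≤
      21 * ((1 + M.η) / M.η) ^ 2 * β * d * (1 + Real.log T) := by
  have hη := M.η_pos
  have hβ1 : 1 ≤ β := by linarith
  have hd1' : (1 : ℝ) ≤ d := by exact_mod_cast hd1
  have hT1 : (1 : ℝ) ≤ T := by exact_mod_cast hT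
  have hlog : 0 ≤ Real.log T := Real.log_nonneg hT1
  have ha : 1 ≤ (1 + M.η) / M.η := by
    rw [le_div_iff₀ hη]
    linarith
  have hθ : ∀ t : Fin T, L.θhat t (x.before t) h ∈ K.Θ h := fun t => (hconf t).2.1 h h.2
  choose ρ hρ hρi using fun t : Fin T => Classes.exists_mem_measF (M := M) hR h.2 (hpol t h h.2)
    (x t h).1 (x t h).2.2
  have key := eluder_sum_fin_le hT hd
    (g := fun t z => K.rew h (L.θhat t (x.before t) h) z - M.r h z) (ρ := ρ)
    (m := fun t i => M.respError (K.rew h (L.θhat t (x.before t) h)) (M.r h)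
      (L.policyAt i (x.before i) h) (x i h).1 (x i h).2.2)
    (fun t => ⟨_, hθ t, rfl⟩) hρ (fun t i => hρi i _ (hθ t))
    (b := 10 * ((1 + M.η) / M.η) ^ 2 * β) (by positivity) (fun t => ?_) (fun t => ?_)
  · refine ⟨key.1.trans (two_mul_sqrt_add_sqrt_le ha hd1' hβ1 (by positivity)), key.2.trans ?_⟩
    have h1 : 1 ≤ ((1 + M.η) / M.η) ^ 2 * β * d * (1 + Real.log T) :=
      one_le_mul_of_one_le_of_one_le (one_le_mul_of_one_le_of_one_le
        (one_le_mul_of_one_le_of_one_le (one_le_pow₀ ha) hβ1) hd1') (by linarith)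
    linarith
  · have h1 := hg.responseRisk_le h t hθr (hθ t)
    have h2 := ((hconf t).2.2 h).1 θs hθs
    dsimp only at h2
    refine le_trans (le_refl (L.responseRisk M K h (L.θhat t (x.before t) h) (x.before t)))
      (h1.trans ?_)
    have h3 : (L.negLogLik M K (x.before t) h (L.θhat t (x.before t) h) -
        L.negLogLik M K (x.before t) h θs) / 4 + 3 * ι ≤ 5 / 16 * β := by linarith
    calc _ ≤ 32 * ((1 + M.η) / M.η) ^ 2 * (5 / 16 * β) := by gcongr
      _ = _ := by ring
  · have := hR.isMarkov h h.2 _ (hpol t h h.2)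
    have h1 := M.abs_respError_le (κ := L.policyAt t (x.before t) h) (M.isReward_r h)
      (hR.isReward h.2 (hθ t)) (x t h).1 (x t h).2.2
    rw [← sq_abs]
    refine (pow_le_pow_left₀ (abs_nonneg _) h1 2).trans ?_
    have : 1 ≤ ((1 + M.η) / M.η) ^ 2 * β := one_le_mul_of_one_le_of_one_le (one_le_pow₀ ha) hβ1
    linarith

omit hι hβ in
/-- The conditional means of the response error bounds are controlled by their values on the
data. -/
theorem IsGood.sum_integral_responseBound_le (h : Fin H) :
    ∑ t : Fin T, ∫ z, M.responseBound |M.respError (K.rew h (L.θhat t (x.before t) h)) (M.r h)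
        (L.policyAt t (x.before t) h) z.1 z.2.2| ∂(M.stepLaw (L.policyAt t (x.before t)) h) ≤
      2 * ∑ t : Fin T, M.responseBound |M.respError (K.rew h (L.θhat t (x.before t) h)) (M.r h)
        (L.policyAt t (x.before t) h) (x t h).1 (x t h).2.2| + 4 * ι * M.responseBound 2 := by
  have hpos := M.responseBound_two_pos
  -- clipping at `2` is without effect, as the estimates lie in the class
  have he : ∀ (t : Fin T) z, L.predictionError M K h t (x.before t) z =
      M.responseBound |M.respError (K.rew h (L.θhat t (x.before t) h)) (M.r h)
        (L.policyAt t (x.before t) h) z.1 z.2.2| / M.responseBound 2 := fun t z => by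
    have := hR.isMarkov h h.2 _ (hpol t h h.2)
    rw [predictionError, estimateError, min_eq_left (M.abs_respError_le (M.isReward_r h)
      (hR.isReward h.2 ((hconf t).2.1 h h.2)) _ _)]
  have h1 := hg.prediction h
  simp only [Hist.additive, predictionIncr, Finset.sum_add_distrib, Finset.sum_neg_distrib,
    ← Finset.sum_div, he, integral_div] at h1
  generalize ∑ t : Fin T, ∫ z, M.responseBound |M.respError (K.rew h (L.θhat t (x.before t) h))
    (M.r h) (L.policyAt t (x.before t) h) z.1 z.2.2| ∂(M.stepLaw (L.policyAt t (x.before t)) h) =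
      m at h1 ⊢
  generalize ∑ t : Fin T, M.responseBound |M.respError (K.rew h (L.θhat t (x.before t) h)) (M.r h)
    (L.policyAt t (x.before t) h) (x t h).1 (x t h).2.2| = q at h1 ⊢
  have e : -(q / M.responseBound 2) + m / M.responseBound 2 / 2 =
      (m - 2 * q) / (2 * M.responseBound 2) := by
    field_simp
    ring
  rw [e, div_le_iff₀ (by positivity)] at h1
  linarith

theorem IsGood.sum_integral_responseBound_le_log (hT : 2 ≤ T) (h : Fin H) {θs : Par}
    (hθs : θs ∈ K.Θ h) (hθr : K.rew h θs = M.r h) {d : ℕ} (hd1 : 1 ≤ d)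
    (hd : dimDE (K.classF M h) (K.measF M h) (1 / Real.sqrt T) ≤ d) :
    ∑ t : Fin T, ∫ z, M.responseBound |M.respError (K.rew h (L.θhat t (x.before t) h)) (M.r h)
        (L.policyAt t (x.before t) h) z.1 z.2.2| ∂(M.stepLaw (L.policyAt t (x.before t)) h) ≤
      20 * (1 + M.η) * Real.sqrt (d * β * T) +
        211 * ((1 + M.η) ^ 2 * Real.exp (2 * M.η)) * (d * β * Real.log T) := by
  have hη := M.η_pos
  have hβ1 : 1 ≤ β := by linarith
  have hd1' : (1 : ℝ) ≤ d := by exact_mod_cast hd1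
  obtain ⟨h1, h2⟩ := hg.sum_response_le hR hι hβ hconf hpol (by omega) h hθs hθr hd1 hd
  refine (hg.sum_integral_responseBound_le hR hconf hpol h).trans ?_
  simp only [Game.responseBound, Finset.sum_add_distrib, ← Finset.mul_sum, sq_abs]
  have hlog : 2 / 3 ≤ Real.log T := by
    have h3 : Real.log 2 ≤ Real.log T := Real.log_le_log (by norm_num) (by exact_mod_cast hT)
    linarith [Real.log_two_gt_d9]
  set e := Real.exp (2 * M.η) with he
  have he1 : 1 ≤ e := Real.one_le_exp (by positivity)
  set Q := (1 + M.η) ^ 2 * e with hQ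
  set w := (d : ℝ) * β * Real.log T with hw
  have hβw : β ≤ 3 / 2 * w := by
    have : β * 1 ≤ β * (d * (3 / 2 * Real.log T)) := by
      gcongr
      exact one_le_mul_of_one_le_of_one_le hd1' (by linarith)
    rw [hw]
    linarith
  have f1 := mul_le_mul_of_nonneg_left h1 hη.le
  have f2 := mul_le_mul_of_nonneg_left h2 (show 0 ≤ 2 * M.η ^ 2 * e by positivity)
  have g1 : M.η * (10 * ((1 + M.η) / M.η) * Real.sqrt (d * β * T)) =
      10 * (1 + M.η) * Real.sqrt (d * β * T) := by field_simp
  have g2 : 2 * M.η ^ 2 * e * (21 * ((1 + M.η) / M.η) ^ 2 * β * d * (1 + Real.log T)) =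
      42 * Q * (β * d * (1 + Real.log T)) := by
    rw [hQ]
    field_simp
    ring
  have g3 : β * d * (1 + Real.log T) ≤ 5 / 2 * w := by
    have : β * d * (1 + Real.log T) ≤ β * d * (5 / 2 * Real.log T) := by
      gcongr
      linarith
    rw [hw]
    linarith
  have hQ0 : 0 ≤ Q := by positivity
  have g4 : 42 * Q * (β * d * (1 + Real.log T)) ≤ 42 * Q * (5 / 2 * w) := by gcongr
  have g5 : M.η * 2 + 2 * M.η ^ 2 * e * 2 ^ 2 ≤ 8 * Q := by
    rw [hQ]
    nlinarith [mul_nonneg hη.le (by linarith : 0 ≤ e - 1)]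
  have g6 : 4 * ι * (M.η * 2 + 2 * M.η ^ 2 * e * 2 ^ 2) ≤ 1 / 8 * w * (8 * Q) := by
    refine mul_le_mul (by linarith) g5 (by positivity) ?_
    rw [hw]
    positivity
  rw [g1] at f1
  rw [g2] at f2
  linarith

/-- The regret on the good event: the leader's errors enter at first order, the follower's at first
order and, from the remainder in `responseBound`, at second order. -/
theorem IsGood.regret_le (hA : K.MaxAttained M H) (hreal : K.Realizable M H)
    (hC : K.Complete M H) (hH : 1 ≤ H) (hT : 2 ≤ T) (hL : L.IsMLEGOLF M K β T) {dL dF : ℕ}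
    (hdL1 : 1 ≤ dL) (hdF1 : 1 ≤ dF) (hdL : K.dimL M H (1 / Real.sqrt T) ≤ dL)
    (hdF : K.dimF M H (1 / Real.sqrt T) ≤ dF) :
    L.regret M K x ≤ (H : ℝ) ^ 2 * (10 * Real.sqrt (dL * β * T) +
      (20 * (1 + M.η) * Real.sqrt (dF * β * T) +
        211 * ((1 + M.η) ^ 2 * Real.exp (2 * M.η)) * (dF * β * Real.log T))) := by
  obtain ⟨⟨θs, hθs, hθr⟩, hUex⟩ := hreal
  obtain ⟨Us, hUs, hUθ⟩ := hUex θs hθs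
  have hne : ∀ t : Fin T, (Us, θs) ∈ L.confSet M K β (x.before t) := fun t =>
    hg.mem_confSet (by linarith) hβ t hUs hθs hθr hUθ
  have hsup : ∀ t : Fin T, (⨆ π : K.policies H, M.J H π.1) ≤
      objective M K (L.Uhat t (x.before t), L.θhat t (x.before t)) := fun t => by
    have : Nonempty (K.policies H) := ⟨⟨_, hpol t⟩⟩
    exact ciSup_le fun π => (J_le_objective hR hA hH hUs hθs hθr hUθ π.2).trans
      (hL.optimistic t t.2 _ _ (hne t))
  calc L.regret M K x
      ≤ ∑ t : Fin T, ∑ h : Fin H,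
          (|∫ z, (L.Uhat t (x.before t) h z - K.bellmanOpt M h (L.θhat t (x.before t))
            (L.Uhat t (x.before t) (h + 1)) z) ∂(M.stepLaw (L.policyAt t (x.before t)) h)| +
          H * ∫ z, M.responseBound |M.respError (K.rew h (L.θhat t (x.before t) h)) (M.r h)
            (L.policyAt t (x.before t) h) z.1 z.2.2|
              ∂(M.stepLaw (L.policyAt t (x.before t)) h)) := by
        refine Finset.sum_le_sum fun t _ => ?_
        refine (sub_le_sub_right (hsup t) _).trans ((objective_sub_J_le hR hA hH (hconf t).1
          (hconf t).2.1 (hpol t) (hL.greedy t t.2 _ ⟨_, hne t⟩)).trans ?_)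
        exact Finset.sum_le_sum fun h _ => add_le_add (le_abs_self _) le_rfl
    _ ≤ ∑ _h : Fin H, (10 * H * Real.sqrt (dL * β * T) +
          H * (20 * (1 + M.η) * Real.sqrt (dF * β * T) +
            211 * ((1 + M.η) ^ 2 * Real.exp (2 * M.η)) * (dF * β * Real.log T))) := by
        rw [Finset.sum_comm]
        refine Finset.sum_le_sum fun h _ => ?_
        rw [Finset.sum_add_distrib, ← Finset.mul_sum]
        refine add_le_add (hg.sum_bellman_le hR hι hβ hconf hpol hA hC (by omega) h hdL1
          ((le_iSup (fun h : Fin H => dimDE (K.classL M H h) (K.measL M H h)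
            (1 / Real.sqrt T)) h).trans hdL)) ?_
        refine mul_le_mul_of_nonneg_left ?_ (Nat.cast_nonneg H)
        exact hg.sum_integral_responseBound_le_log hR hι hβ hconf hpol hT h (hθs h h.2)
          (hθr h h.2) hdF1 ((le_iSup (fun h : Fin H => dimDE (K.classF M h) (K.measF M h)
            (1 / Real.sqrt T)) h).trans hdF)
    _ = _ := by
        rw [Finset.sum_const, Finset.card_univ, Fintype.card_fin, nsmul_eq_mul]
        ring

end Learner

end Regret

/-! ### The regret bound with high probability -/

section Final

variable {S A B Par : Type*} [MeasurableSpace S] [MeasurableSpace A] [MeasurableSpace B]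
  {M : Game S A B} {K : Classes S A B Par} {H T : ℕ} {L : Learner S A B Par H}

theorem Game.two_le_BA (M : Game S A B) : 2 ≤ M.BA := by
  have h1 := Real.log_nonneg M.one_le_base
  have h2 := mul_nonneg (inv_nonneg.2 M.η_pos.le) h1
  rw [Game.BA]
  linarith

theorem Game.one_add_eta_le (M : Game S A B) : 1 + M.η ≤ M.η * M.Ceta := by
  have h1 := M.two_le_BA
  have hη := M.η_pos
  rw [Game.Ceta, mul_add, mul_inv_cancel₀ hη.ne']
  nlinarith

theorem Classes.one_le_of_coverΘ_le (hreal : K.Realizable M H) (hH : 1 ≤ H) {ε : ℝ≥0∞} {N : ℕ}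
    (h : K.coverΘ M H ε ≤ N) : 1 ≤ N := by
  obtain ⟨⟨θ, hθ, -⟩, -⟩ := hreal
  obtain ⟨C, -, hcov, hcard⟩ := exists_finset_cover
    ((le_iSup (fun h : Fin H => coveringNumber (K.distΘ M h) (K.Θ h) ε) ⟨0, hH⟩).trans h)
  obtain ⟨y, hy, -⟩ := hcov (θ 0) (hθ 0 hH)
  exact (Finset.card_pos.2 ⟨y, hy⟩).trans_le hcard

theorem Learner.regret_le_mul (hR : K.Regular H)
    (hpol : ∀ t < T, ∀ x : Hist S A B H t, L.policyAt t x ∈ K.policies H) (x : Hist S A B H T) :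
    L.regret M K x ≤ T * H := by
  have h : ∀ t : Fin T, (⨆ π : K.policies H, M.J H π.1) - M.J H (L.policyAt t (x.before t)) ≤ H := by
    intro t
    have hne : Nonempty (K.policies H) := ⟨⟨_, hpol t t.2 (x.before t)⟩⟩
    have h1 : (⨆ π : K.policies H, M.J H π.1) ≤ H := ciSup_le fun π =>
      (M.J_mem_Icc fun h hh => hR.isMarkov h hh _ (π.2 h hh)).2
    have h2 := (M.J_mem_Icc (H := H) (π := L.policyAt t (x.before t))
      fun h hh => hR.isMarkov h hh _ (hpol t t.2 (x.before t) h hh)).1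
    linarith
  refine (Finset.sum_le_sum fun t _ => h t).trans (le_of_eq ?_)
  simp

/-- An outer measure version of the complement rule, for sets that need not be measurable. -/
theorem ofReal_one_sub_le_measure {X : Type*} [MeasurableSpace X] {μ : Measure X}
    [IsProbabilityMeasure μ] {E F : Set X} {δ : ℝ} (hδ : 0 ≤ δ) (hF : μ F ≤ ENNReal.ofReal δ)
    (h : ∀ x, x ∉ F → x ∈ E) : ENNReal.ofReal (1 - δ) ≤ μ E := by
  rw [ENNReal.ofReal_sub _ hδ, ENNReal.ofReal_one, tsub_le_iff_right]
  calc (1 : ℝ≥0∞) = μ Set.univ := measure_univ.symm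
    _ ≤ μ (E ∪ F) := measure_mono fun x _ => or_iff_not_imp_right.2 (h x)
    _ ≤ μ E + μ F := measure_union_le _ _
    _ ≤ μ E + ENNReal.ofReal δ := by gcongr

/-- Comparison of the regret bound in terms of `η` with the one in terms of `B_A` and `C_η`. -/
theorem Game.regret_bound_le (M : Game S A B) {x y w h : ℝ} (hx : 0 ≤ x) (hy : 0 ≤ y) (hw : 0 ≤ w)
    (hh : 0 ≤ h) :
    h * (10 * x + (20 * (1 + M.η) * y + 211 * ((1 + M.η) ^ 2 * Real.exp (2 * M.η)) * w)) ≤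
      211 * (h * x + h * M.η * M.Ceta * y +
        h * (M.η * M.Ceta) ^ 3 * Real.exp (4 * M.η * M.BA) * w) := by
  have hη := M.η_pos
  have h1 := M.one_add_eta_le
  have h2 := M.two_le_BA
  have h3 : (1 + M.η) * y ≤ M.η * M.Ceta * y := mul_le_mul_of_nonneg_right h1 hy
  have h4 : (1 + M.η) ^ 2 * Real.exp (2 * M.η) * w ≤
      (M.η * M.Ceta) ^ 3 * Real.exp (4 * M.η * M.BA) * w := by
    refine mul_le_mul_of_nonneg_right (mul_le_mul ?_ (Real.exp_le_exp.2 (by nlinarith))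
      (Real.exp_pos _).le (pow_nonneg (by linarith) 3)) hw
    calc (1 + M.η) ^ 2 ≤ (M.η * M.Ceta) ^ 2 := by gcongr
      _ ≤ (M.η * M.Ceta) ^ 3 := pow_le_pow_right₀ (by linarith) (by norm_num)
  have h5 : 0 ≤ (1 + M.η) * y := by positivity
  calc _ ≤ h * (211 * (x + M.η * M.Ceta * y +
        (M.η * M.Ceta) ^ 3 * Real.exp (4 * M.η * M.BA) * w)) :=
        mul_le_mul_of_nonneg_left (by linarith) hh
    _ = _ := by ring

end Final

end QSE

theorem mainTheorem1 :
    ∃ C c : ℝ, 0 < C ∧ 0 < c ∧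
      ∀ (S : Type*) [MeasurableSpace S] (A : Type*) [MeasurableSpace A]
        (B : Type*) [MeasurableSpace B] (Par : Type*)
        (M : QSE.Game S A B) (K : QSE.Classes S A B Par) (H T : ℕ) (β δ : ℝ)
        (L : QSE.Learner S A B Par H),
        1 ≤ H → 1 ≤ T → 0 < δ → δ < 1 →
        K.Regular H → K.MaxAttained M H → K.Realizable M H → K.Complete M H →
        K.coverΘ M H (T : ENNReal)⁻¹ ≠ ⊤ → K.coverZ M H (T : ENNReal)⁻¹ ≠ ⊤ →
        C * Real.log (Real.exp 1 * H * T *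
          (max (K.coverΘ M H (T : ENNReal)⁻¹) (K.coverZ M H (T : ENNReal)⁻¹)).toNat / δ) ≤ β →
        K.dimL M H (1 / Real.sqrt T) ≠ ⊤ → K.dimF M H (1 / Real.sqrt T) ≠ ⊤ →
        L.IsMLEGOLF M K β T →
        let dL : ℝ := (max 1 (K.dimL M H (1 / Real.sqrt T))).toNat
        let dF : ℝ := (max 1 (K.dimF M H (1 / Real.sqrt T))).toNat
        ENNReal.ofReal (1 - δ) ≤ L.law M T {x | L.regret M K x ≤
          c * ((H : ℝ) ^ 2 * Real.sqrt (dL * β * T) +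
            (H : ℝ) ^ 2 * M.η * M.Ceta * Real.sqrt (dF * β * T) +
            (H : ℝ) ^ 2 * (M.η * M.Ceta) ^ 3 * Real.exp (4 * M.η * M.BA) * dF * β *
              Real.log T)} := by
  -- a radius of `48 ι` keeps the true model in the confidence sets, by `IsGood.mem_confSet`; `211` is
  -- the largest constant in `IsGood.regret_le`
  refine ⟨48, 211, by norm_num, by norm_num, ?_⟩
  intro S _ A _ B _ Par M K H T β δ L hH hT hδ hδ1 hR hA hreal hC hΘ hZ hβ hdL hdF hL dL dF
  have hpol : ∀ t < T, ∀ h < H,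
      QSE.IsPolicyFamily fun x : QSE.Hist S A B H t => L.policyAt t x h := fun t ht h hh =>
    have := hL.isMarkov t ht h hh
    QSE.IsPolicyFamily.sectR (L.pol t h)
  have hprob := L.isProbabilityMeasure_law M hpol le_rfl
  -- the covering numbers and dimensions as natural numbers
  have hmax : max (K.coverΘ M H (T : ENNReal)⁻¹) (K.coverZ M H (T : ENNReal)⁻¹) ≠ ⊤ :=
    (max_lt hΘ.lt_top hZ.lt_top).ne
  obtain ⟨N, hN⟩ := ENat.ne_top_iff_exists.1 hmax
  rw [← hN, ENat.toNat_natCast] at hβ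
  have hΘN : K.coverΘ M H (T : ENNReal)⁻¹ ≤ N := hN ▸ le_max_left _ _
  have hZN : K.coverZ M H (T : ENNReal)⁻¹ ≤ N := hN ▸ le_max_right _ _
  have hN1 := QSE.Classes.one_le_of_coverΘ_le hreal hH hΘN
  obtain ⟨nL, hnL⟩ := ENat.ne_top_iff_exists.1
    (max_lt (ENat.natCast_lt_top 1) hdL.lt_top : max 1 (K.dimL M H (1 / Real.sqrt T)) < ⊤).ne
  obtain ⟨nF, hnF⟩ := ENat.ne_top_iff_exists.1
    (max_lt (ENat.natCast_lt_top 1) hdF.lt_top : max 1 (K.dimF M H (1 / Real.sqrt T)) < ⊤).ne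
  have hdLn : dL = nL := by simp only [dL, ← hnL, ENat.toNat_natCast]
  have hdFn : dF = nF := by simp only [dF, ← hnF, ENat.toNat_natCast]
  have hnL1 : 1 ≤ nL := by exact_mod_cast (hnL ▸ le_max_left _ _ : (1 : ℕ∞) ≤ nL)
  have hnF1 : 1 ≤ nF := by exact_mod_cast (hnF ▸ le_max_left _ _ : (1 : ℕ∞) ≤ nF)
  have hnL2 : K.dimL M H (1 / Real.sqrt T) ≤ nL := hnL ▸ le_max_right _ _
  have hnF2 : K.dimF M H (1 / Real.sqrt T) ≤ nF := hnF ▸ le_max_right _ _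
  rw [hdLn, hdFn]
  have hH0 : (1 : ℝ) ≤ H := by exact_mod_cast hH
  have hT0 : (1 : ℝ) ≤ T := by exact_mod_cast hT
  have hN0 : (1 : ℝ) ≤ N := by exact_mod_cast hN1
  have hι : 1 ≤ Real.log (Real.exp 1 * H * T * N / δ) := by
    have h1 : (1 : ℝ) ≤ H * T * N :=
      one_le_mul_of_one_le_of_one_le (one_le_mul_of_one_le_of_one_le hH0 hT0) hN0
    rw [Real.le_log_iff_exp_le (by positivity), le_div_iff₀ hδ]
    nlinarith [Real.exp_pos 1]
  have hβ1 : 1 ≤ β := by linarith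
  have hlog : 0 ≤ Real.log T := Real.log_nonneg hT0
  have hbound := fun {a : ℝ} (ha : a ≤ _) => ha.trans (M.regret_bound_le
    (x := Real.sqrt (nL * β * T)) (y := Real.sqrt (nF * β * T)) (w := nF * β * Real.log T)
    (h := (H : ℝ) ^ 2) (Real.sqrt_nonneg _) (Real.sqrt_nonneg _) (by positivity) (by positivity))
  refine QSE.ofReal_one_sub_le_measure hδ.le
    (L.law_not_isGood_le hR hA hH hT hN1 hδ hδ1 hpol hL.measurable_rew hΘN hZN) fun x hx => ?_
  rw [Set.mem_ofPred_eq, not_not] at hx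
  rw [Set.mem_ofPred_eq]
  refine le_of_le_of_eq (hbound ?_) (by ring)
  rcases hT.eq_or_lt with rfl | hT2
  · -- a single episode: its regret is at most `H`, and `log T` vanishes
    have h1 := L.regret_le_mul (M := M) hR hL.pol_mem x
    have h2 : (1 : ℝ) ≤ Real.sqrt (nL * β * (1 : ℕ)) := by
      rw [Real.one_le_sqrt, Nat.cast_one, mul_one]
      exact one_le_mul_of_one_le_of_one_le (by exact_mod_cast hnL1) hβ1
    have h3 : 0 ≤ 20 * (1 + M.η) * Real.sqrt (nF * β * (1 : ℕ)) := by
      have := M.η_pos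
      positivity
    refine h1.trans ?_
    rw [Nat.cast_one, Real.log_one, mul_zero, mul_zero, add_zero, one_mul]
    rw [Nat.cast_one] at h2 h3
    nlinarith
  · obtain ⟨⟨θs, hθs, hθr⟩, hUex⟩ := id hreal
    obtain ⟨Us, hUs, hUθ⟩ := hUex θs hθs
    exact hx.regret_le hR hι hβ
      (fun t => hL.mem_confSet t t.2 _ ⟨_, hx.mem_confSet (by linarith) hβ t hUs hθs hθr hUθ⟩)
      (fun t => hL.pol_mem t t.2 _) hA hreal hC hH hT2 hL hnL1 hnF1 hnL2 hnF2
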